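/- **Notation.** Let $\mathbb T=\mathbb R/2\pi\mathbb Z$ with Lebesgue measure $dx$, and $H:=L^2(\mathbb T)\times L^2(\mathbb T)$, with real or complex scalars, with its usual scalar product $(\cdot,\cdot)_H$. For $a,c,d,r>0$ and $k\in\mathbb Z$ define $\omega_k^\pm\in\mathbb R$ by $$2c\,\omega_k^{\pm}=(c+1)k^3-rk\pm k\sqrt{4acd\,k^4+\left[(c-1)k^2+r\right]^2},$$ and consider the condition $$\omega_k^+\ne\omega_n^+\quad\text{and}\quad \omega_k^-\ne\omega_n^-\qquad\text{whenever } k\ne n. \tag{D}$$ For $x_0\in\mathbb T$, $(u_0,v_0)\in H$ and $f,g\in L^2_{loc}(\mathbb R)$ consider the linearized Gear–Grimshaw system $$\begin{cases} u_t+u_{xxx}+av_{xxx}=f(t)\delta_{x_0}&\text{in }\mathbb R\times\mathbb T,\\ v_t+\frac rc v_x+\frac1c v_{xxx}+\frac dc u_{xxx}=g(t)\delta_{x_0}&\text{in }\mathbb R\times\mathbb T,\\ u(0)=u_0,\quad v(0)=v_0. \end{cases}\tag{S}$$ A solution of (S) is a weakly continuous function $(u,v):\mathbb R\to H$ such that,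 for every $t\in\mathbb R$ and every weak solution $(\varphi,\psi)\in C(\mathbb R,H)$ of the homogeneous adjoint system $\varphi_t+\varphi_{xxx}+\frac dc\psi_{xxx}=0$, $\psi_t+\frac rc\psi_x+a\varphi_{xxx}+\frac1c\psi_{xxx}=0$, $$\big((u,v)(t),(\varphi,\psi)(t)\big)_H=\big((u_0,v_0),(\varphi,\psi)(0)\big)_H+\int_0^t f(s)\overline{\varphi(s,x_0)}+g(s)\overline{\psi(s,x_0)}\,ds,$$ where $\varphi(\cdot,x_0)$ and $\psi(\cdot,x_0)$ are the sums in $L^2_{loc}(\mathbb R)$ of the Fourier series in $x$ of $\varphi$ and $\psi$ at the point $x_0$. **Theorem.** Condition (D) holds for almost every $(a,c,d,r)\in(0,\infty)^4$. Moreover, let $a,c,d,r>0$ satisfy (D), and set $$T_0:=\begin{cases}0&\text{if }ad\ne1,\\ 2\pi(c+1)/r&\text{if }ad=1.\end{cases}$$ Then for every $x_0\in\mathbb T$, every $T>T_0$ and all $(u_0,v_0),(u_T,v_T)\in H$ there exist controls $f,g\in L^2_{loc}(\mathbb R)$ such that (S) has a unique solution $(u,v)$, and this solution satisfies $$u(T)=u_T\quad\text{and}\quad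 v(T)=v_T.$$ -/

import Mathlib

open MeasureTheory Filter Topology
open scoped ContDiff

noncomputable section

namespace GearGrimshaw

/-- The circle `ℝ / 2πℤ`. Its `volume` is Lebesgue measure, of total mass `2π`. -/
abbrev Circ : Type := AddCircle (2 * Real.pi)

instance factTwoPiPos : Fact (0 < 2 * Real.pi) := ⟨Real.two_pi_pos⟩

/-- The space `L²` of the circle, with scalars `𝕜` (the real or the complex numbers). -/
abbrev L2 (𝕜 : Type*) [RCLike 𝕜] : Type _ := Lp 𝕜 2 (volume : Measure Circ)

/-- The state space `H = L² × L²`. -/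
abbrev H (𝕜 : Type*) [RCLike 𝕜] : Type _ := L2 𝕜 × L2 𝕜

/-- The eigenvalue `ω_k^+` (divided by `i`) of the linearized Gear-Grimshaw operator. -/
def omegaPlus (a c d r : ℝ) (k : ℤ) : ℝ :=
  ((c + 1) * (k : ℝ) ^ 3 - r * k
    + k * Real.sqrt (4 * a * c * d * (k : ℝ) ^ 4 + ((c - 1) * (k : ℝ) ^ 2 + r) ^ 2)) / (2 * c)

/-- The eigenvalue `ω_k^-` (divided by `i`) of the linearized Gear-Grimshaw operator. -/
def omegaMinus (a c d r : ℝ) (k : ℤ) : ℝ :=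
  ((c + 1) * (k : ℝ) ^ 3 - r * k
    - k * Real.sqrt (4 * a * c * d * (k : ℝ) ^ 4 + ((c - 1) * (k : ℝ) ^ 2 + r) ^ 2)) / (2 * c)

/-- `ω_k^+ ≠ ω_n^+` and `ω_k^- ≠ ω_n^-` whenever `k ≠ n`. -/
def DistinctEigenvalues (a c d r : ℝ) : Prop :=
  ∀ k n : ℤ, k ≠ n →
    omegaPlus a c d r k ≠ omegaPlus a c d r n ∧ omegaMinus a c d r k ≠ omegaMinus a c d r n

open Classical in
/-- The critical time: `0` if `ad ≠ 1`, and `2π` divided by the limit `r / (c + 1)` of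
`|ω_{k+1}^- - ω_k^-|` if `ad = 1`. -/
def criticalTime (a c d r : ℝ) : ℝ :=
  if a * d = 1 then 2 * Real.pi * (c + 1) / r else 0

section

variable {𝕜 : Type*} [RCLike 𝕜]

/-- `f ∈ L²_loc(ℝ)`. -/
def MemL2Loc (f : ℝ → 𝕜) : Prop :=
  ∀ R : ℝ, MemLp f 2 (volume.restrict (Set.Icc (-R) R))

/-- The integral of `η w` over one period, for a `2π`-periodic `η : ℝ → ℝ` and `w ∈ L²`. -/
def pairing (η : ℝ → ℝ) (w : L2 𝕜) : 𝕜 :=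
  ∫ x in (0 : ℝ)..(2 * Real.pi), η x • w (x : Circ)

/-- `(φ, ψ) ∈ C(ℝ, H)` is a weak solution of the homogeneous adjoint system
`φ_t + φ_xxx + (d/c) ψ_xxx = 0`, `ψ_t + (r/c) ψ_x + a φ_xxx + (1/c) ψ_xxx = 0` on the circle:
the equations hold after integration against every smooth `2π`-periodic function `η`
of `x`, the space derivatives being moved to `η`. -/
structure IsAdjointSolution (a c d r : ℝ) (Φ : ℝ → H 𝕜) : Prop where
  continuous : Continuous Φ
  fst_eq : ∀ η : ℝ → ℝ, ContDiff ℝ ∞ η → Function.Periodic η (2 * Real.pi) → ∀ t : ℝ,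
    HasDerivAt (fun s => pairing η (Φ s).1)
      (pairing (iteratedDeriv 3 η) (Φ t).1 + (d / c) • pairing (iteratedDeriv 3 η) (Φ t).2) t
  snd_eq : ∀ η : ℝ → ℝ, ContDiff ℝ ∞ η → Function.Periodic η (2 * Real.pi) → ∀ t : ℝ,
    HasDerivAt (fun s => pairing η (Φ s).2)
      ((r / c) • pairing (deriv η) (Φ t).2 + a • pairing (iteratedDeriv 3 η) (Φ t).1
        + (1 / c) • pairing (iteratedDeriv 3 η) (Φ t).2) t

/-- The Dirichlet kernel `∑_{|k| ≤ N} e^{ikz}`, which is a real number. -/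
def dirichletKernel (N : ℕ) (z : Circ) : ℝ :=
  (∑ k ∈ Finset.Icc (-(N : ℤ)) N, fourier k z).re

/-- The symmetric partial sum `∑_{|k| ≤ N} ŵ(k) e^{ikx}` of the Fourier series of `w` at `x`. -/
def fourierPartialSum (N : ℕ) (w : L2 𝕜) (x : Circ) : 𝕜 :=
  (1 / (2 * Real.pi)) • ∫ y : Circ, dirichletKernel N (x - y) • w y

/-- `p = φ(·, x₀)` in `L²_loc(ℝ)`: the Fourier series of `φ(t)` at the point `x₀` converges
to `p(t)` in the sense of `L²_loc` in the variable `t`. -/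
def IsTrace (x₀ : Circ) (φ : ℝ → L2 𝕜) (p : ℝ → 𝕜) : Prop :=
  MemL2Loc p ∧ ∀ R : ℝ,
    Tendsto (fun N : ℕ => eLpNorm (fun t => fourierPartialSum N (φ t) x₀ - p t) 2
      (volume.restrict (Set.Icc (-R) R))) atTop (𝓝 0)

/-- `U = (u, v)` is the solution (in the sense of transposition) of
`u_t + u_xxx + a v_xxx = f(t) δ_{x₀}`,
`v_t + (r/c) v_x + (1/c) v_xxx + (d/c) u_xxx = g(t) δ_{x₀}`, `(u, v)(0) = U₀`:
it is weakly continuous with values in `H`, and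
`(U(t), Φ(t)) = (U₀, Φ(0)) + ∫_0^t f φ(·, x₀)* + g ψ(·, x₀)*` for every `t ∈ ℝ` and every
solution `Φ = (φ, ψ)` of the adjoint system. The scalar product of `H` is here
the usual, unweighted one; Mathlib's `inner` is conjugate linear in the first entry. -/
structure IsSolution (a c d r : ℝ) (x₀ : Circ) (f g : ℝ → 𝕜) (U₀ : H 𝕜) (U : ℝ → H 𝕜) :
    Prop where
  weakly_continuous : Continuous fun t => toWeakSpace 𝕜 (H 𝕜) (U t)
  transposition : ∀ (Φ : ℝ → H 𝕜) (p q : ℝ → 𝕜), IsAdjointSolution a c d r Φ →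
    IsTrace x₀ (fun t => (Φ t).1) p → IsTrace x₀ (fun t => (Φ t).2) q → ∀ t : ℝ,
      inner 𝕜 (Φ t).1 (U t).1 + inner 𝕜 (Φ t).2 (U t).2
        = inner 𝕜 (Φ 0).1 U₀.1 + inner 𝕜 (Φ 0).2 U₀.2
          + ∫ s in (0 : ℝ)..t, (f s * starRingEnd 𝕜 (p s) + g s * starRingEnd 𝕜 (q s))

end

end GearGrimshaw

end

namespace GearGrimshaw

theorem sum_telescope_inv_sq_sub_quarter (N : ℕ) :
    ∑ m ∈ Finset.range N, (1 : ℝ) / (((m : ℝ) + 1) ^ 2 - 1 / 4) = 2 - 2 / (2 * (N : ℝ) + 1) := by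
  induction N with
  | zero => simp
  | succ N ih =>
    rw [Finset.sum_range_succ, ih]
    have h1 : ((N : ℝ) + 1) ^ 2 - 1 / 4 ≠ 0 := by nlinarith [(Nat.cast_nonneg N : (0:ℝ) ≤ N)]
    have h2 : (2 * (N : ℝ) + 1) ≠ 0 := by positivity
    have h3 : (2 * (N : ℝ) + 3) ≠ 0 := by positivity
    have h4 : ((N : ℝ) + 1) ^ 2 - 1 / 4 = (2 * N + 1) * (2 * N + 3) / 4 := by ring
    rw [h4]; push_cast
    rw [show 2 * ((N : ℝ) + 1) + 1 = 2 * N + 3 by ring]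
    field_simp
    ring

theorem sum_int_inv_sq_sub_quarter_le (s : Finset ℤ) (hs : (0 : ℤ) ∉ s) :
    ∑ m ∈ s, (1 : ℝ) / ((m : ℝ) ^ 2 - 1 / 4) ≤ 4 := by
  classical
  have key : ∀ u : Finset ℕ, 0 ∉ u → ∑ m ∈ u, (1 : ℝ) / ((m : ℝ) ^ 2 - 1 / 4) ≤ 2 := by
    intro u hu
    obtain ⟨N, hN⟩ := u.exists_nat_subset_range
    have hsub : u ⊆ (Finset.range N).image (fun m : ℕ => m + 1) := by
      intro m hm
      have h0 : m ≠ 0 := fun h => hu (h ▸ hm)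
      have := Finset.mem_range.1 (hN hm)
      exact Finset.mem_image.2 ⟨m - 1, Finset.mem_range.2 (by omega), by omega⟩
    calc ∑ m ∈ u, (1 : ℝ) / ((m : ℝ) ^ 2 - 1 / 4)
        ≤ ∑ m ∈ (Finset.range N).image (fun m : ℕ => m + 1), (1 : ℝ) / ((m : ℝ) ^ 2 - 1 / 4) := by
          refine Finset.sum_le_sum_of_subset_of_nonneg hsub fun m hm _ => ?_
          obtain ⟨n, -, rfl⟩ := Finset.mem_image.1 hm
          have : (0 : ℝ) ≤ n := Nat.cast_nonneg n
          push_cast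
          exact div_nonneg zero_le_one (by nlinarith)
      _ = 2 - 2 / (2 * (N : ℝ) + 1) := by
          rw [Finset.sum_image (by intro a _ b _ h; simpa using h),
            ← sum_telescope_inv_sq_sub_quarter]
          push_cast; rfl
      _ ≤ 2 := by
          have : (0 : ℝ) ≤ 2 / (2 * (N : ℝ) + 1) := by positivity
          linarith
  have hsplit : s = (s.filter (0 < ·)) ∪ (s.filter (· < 0)) := by
    ext m
    simp only [Finset.mem_union, Finset.mem_filter]
    constructor
    · intro hm
      rcases lt_trichotomy m 0 with h | h | h
      · exact Or.inr ⟨hm, h⟩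
      · exact absurd (h ▸ hm) hs
      · exact Or.inl ⟨hm, h⟩
    · rintro (h | h) <;> exact h.1
  have hdisj : Disjoint (s.filter (0 < ·)) (s.filter (· < 0)) := by
    rw [Finset.disjoint_left]
    intro m h1 h2
    have := (Finset.mem_filter.1 h1).2
    have := (Finset.mem_filter.1 h2).2
    omega
  have half : ∀ v : Finset ℤ, (∀ m ∈ v, m ≠ 0) → Set.InjOn Int.natAbs (v : Set ℤ) →
      ∑ m ∈ v, (1 : ℝ) / ((m : ℝ) ^ 2 - 1 / 4) ≤ 2 := by
    intro v hv hinj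
    have := key (v.image Int.natAbs) (by
      intro h
      obtain ⟨m, hm, h0⟩ := Finset.mem_image.1 h
      exact hv m hm (Int.natAbs_eq_zero.1 h0))
    rw [Finset.sum_image hinj] at this
    refine le_trans (le_of_eq (Finset.sum_congr rfl fun m _ => ?_)) this
    rw [Nat.cast_natAbs, Int.cast_abs, sq_abs]
  rw [hsplit, Finset.sum_union hdisj]
  have h1 := half (s.filter (0 < ·)) (fun m hm => by
    have := (Finset.mem_filter.1 hm).2; omega) (by
      intro a ha b hb h
      have := (Finset.mem_filter.1 (Finset.mem_coe.1 ha)).2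
      have := (Finset.mem_filter.1 (Finset.mem_coe.1 hb)).2
      omega)
  have h2 := half (s.filter (· < 0)) (fun m hm => by
    have := (Finset.mem_filter.1 hm).2; omega) (by
      intro a ha b hb h
      have := (Finset.mem_filter.1 (Finset.mem_coe.1 ha)).2
      have := (Finset.mem_filter.1 (Finset.mem_coe.1 hb)).2
      omega)
  linarith

/-- The integral of the weight `sin (π t / T)` against an exponential. -/
theorem integral_sin_mul_exp (T ξ : ℝ) (hT : 0 < T) :
    (((Real.pi / T) ^ 2 - ξ ^ 2 : ℝ) : ℂ) *
      ∫ t in (0 : ℝ)..T, (Real.sin (Real.pi / T * t) : ℂ) * Complex.exp (ξ * t * Complex.I)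
      = (Real.pi / T : ℝ) * (1 + Complex.exp (ξ * T * Complex.I)) := by
  set p : ℝ := Real.pi / T with hp
  have hpT : p * T = Real.pi := by rw [hp]; field_simp
  have hderiv : ∀ t ∈ Set.uIcc (0 : ℝ) T, HasDerivAt
      (fun t : ℝ => ((ξ : ℂ) * Complex.I * (Real.sin (p * t) : ℂ) - (p : ℂ) * (Real.cos (p * t) : ℂ))
        * Complex.exp (ξ * t * Complex.I))
      (((p ^ 2 - ξ ^ 2 : ℝ) : ℂ) * ((Real.sin (p * t) : ℂ) * Complex.exp (ξ * t * Complex.I))) t := by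
    intro t _
    have hl : HasDerivAt (fun t : ℝ => p * t) p t := by simpa using (hasDerivAt_id t).const_mul p
    have hs : HasDerivAt (fun t : ℝ => (Real.sin (p * t) : ℂ)) ((Real.cos (p * t) * p : ℝ) : ℂ) t :=
      (hl.sin).ofReal_comp
    have hc : HasDerivAt (fun t : ℝ => (Real.cos (p * t) : ℂ)) ((-Real.sin (p * t) * p : ℝ) : ℂ) t :=
      (hl.cos).ofReal_comp
    have he : HasDerivAt (fun t : ℝ => Complex.exp (ξ * t * Complex.I))
        (Complex.exp (ξ * t * Complex.I) * ((ξ : ℂ) * Complex.I)) t := by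
      have : HasDerivAt (fun t : ℝ => (ξ : ℂ) * (t : ℂ) * Complex.I) ((ξ : ℂ) * Complex.I) t := by
        simpa using ((Complex.ofRealCLM.hasDerivAt (x := t)).const_mul (ξ : ℂ)).mul_const Complex.I
      exact this.cexp
    have := ((hs.const_mul ((ξ : ℂ) * Complex.I)).sub (hc.const_mul (p : ℂ))).mul he
    refine this.congr_deriv ?_
    simp only [Pi.sub_apply]
    push_cast
    have hI : Complex.I ^ 2 = -1 := Complex.I_sq
    linear_combination (((ξ : ℂ) ^ 2) * Complex.sin (p * t) * Complex.exp (ξ * t * Complex.I)) * hI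
  have hint : IntervalIntegrable (fun t : ℝ => ((p ^ 2 - ξ ^ 2 : ℝ) : ℂ) *
      ((Real.sin (p * t) : ℂ) * Complex.exp (ξ * t * Complex.I))) volume 0 T := by
    apply Continuous.intervalIntegrable
    fun_prop
  rw [← intervalIntegral.integral_const_mul, intervalIntegral.integral_eq_sub_of_hasDerivAt hderiv hint]
  simp only [hpT, Real.sin_pi, Real.cos_pi, mul_zero, Real.sin_zero, Real.cos_zero]
  simp
  ring

theorem integral_sin_weight (T : ℝ) (hT : 0 < T) :
    ∫ t in (0 : ℝ)..T, Real.sin (Real.pi / T * t) = 2 * T / Real.pi := by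
  have h : Real.pi / T ≠ 0 := by positivity
  rw [intervalIntegral.integral_comp_mul_left (fun x => Real.sin x) h, mul_zero,
    div_mul_cancel₀ _ hT.ne', integral_sin]
  simp
  ring

theorem norm_integral_sin_mul_exp_le (T γ ξ : ℝ) (m : ℝ) (hT : 0 < T) (hγ : 2 * Real.pi ≤ T * γ)
    (hm : 1 ≤ |m|) (hξ : γ * |m| ≤ |ξ|) :
    ‖∫ t in (0 : ℝ)..T, (Real.sin (Real.pi / T * t) : ℂ) * Complex.exp (ξ * t * Complex.I)‖
      ≤ 2 * Real.pi / (T * γ ^ 2) * (1 / (m ^ 2 - 1 / 4)) := by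
  have h := congrArg norm (integral_sin_mul_exp T ξ hT)
  rw [norm_mul, norm_mul, Complex.norm_real, Complex.norm_real, Real.norm_eq_abs, Real.norm_eq_abs,
    abs_of_pos (by positivity : 0 < Real.pi / T)] at h
  set Z := ‖∫ t in (0 : ℝ)..T, (Real.sin (Real.pi / T * t) : ℂ) * Complex.exp (ξ * t * Complex.I)‖
  have hpi := Real.pi_pos
  have hγ0 : 0 < γ := by
    by_contra hcon
    push Not at hcon
    nlinarith
  have h2 : ‖1 + Complex.exp (ξ * T * Complex.I)‖ ≤ 2 := by
    refine (norm_add_le _ _).trans ?_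
    rw [show (ξ * T * Complex.I : ℂ) = ((ξ * T : ℝ) : ℂ) * Complex.I by push_cast; ring,
      Complex.norm_exp_ofReal_mul_I]
    norm_num
  have hm2 : 1 ≤ m ^ 2 := by rw [← sq_abs]; nlinarith
  have hp2 : (Real.pi / T) ≤ γ / 2 := by rw [div_le_iff₀ hT]; linarith
  have hp3 : (Real.pi / T) ^ 2 ≤ γ ^ 2 / 4 := by
    have : 0 ≤ Real.pi / T := by positivity
    nlinarith
  have hξ2 : γ ^ 2 * m ^ 2 ≤ ξ ^ 2 := by
    rw [← sq_abs m, ← sq_abs ξ, ← mul_pow]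
    exact pow_le_pow_left₀ (by positivity) hξ 2
  have hlow : γ ^ 2 * (m ^ 2 - 1 / 4) ≤ |(Real.pi / T) ^ 2 - ξ ^ 2| := by
    rw [abs_sub_comm]
    refine le_trans ?_ (le_abs_self _)
    nlinarith
  have hpos : 0 < γ ^ 2 * (m ^ 2 - 1 / 4) := by
    have : 0 < m ^ 2 - 1 / 4 := by linarith
    positivity
  have hm4 : 0 < m ^ 2 - 1 / 4 := by linarith
  have hZ : γ ^ 2 * (m ^ 2 - 1 / 4) * Z ≤ Real.pi / T * 2 := by
    calc _ ≤ |(Real.pi / T) ^ 2 - ξ ^ 2| * Z := by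
          exact mul_le_mul_of_nonneg_right hlow (norm_nonneg _)
      _ = _ := h
      _ ≤ _ := by gcongr
  rw [show 2 * Real.pi / (T * γ ^ 2) * (1 / (m ^ 2 - 1 / 4))
    = (Real.pi / T * 2) / (γ ^ 2 * (m ^ 2 - 1 / 4)) by field_simp]
  rw [le_div_iff₀ hpos]
  linarith

/-- The exponential sum `∑ cᵢ e^{i wᵢ t}`. -/
noncomputable def expSum {ι : Type*} (S : Finset ι) (w : ι → ℝ) (c : ι → ℂ) (t : ℝ) : ℂ :=
  ∑ i ∈ S, c i * Complex.exp (w i * t * Complex.I)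

@[fun_prop]
theorem continuous_expSum {ι : Type*} (S : Finset ι) (w : ι → ℝ) (c : ι → ℂ) :
    Continuous (expSum S w c) := by
  unfold expSum; fun_prop

/-- The weighted quadratic form of an exponential sum is diagonally dominant when the exponents
have a gap larger than `2π / T`. -/
theorem abs_integral_sin_mul_normSq_expSum_sub_le {ι : Type*} (S : Finset ι)
    (w : ι → ℝ) (n : ι → ℤ) (hn : Set.InjOn n S) (c : ι → ℂ) (T γ : ℝ) (hT : 0 < T)
    (hγ : 2 * Real.pi ≤ T * γ)
    (hgap : ∀ i ∈ S, ∀ j ∈ S, γ * |((n i : ℝ) - n j)| ≤ |w i - w j|) :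
    |(∫ t in (0 : ℝ)..T, Real.sin (Real.pi / T * t) * ‖expSum S w c t‖ ^ 2)
      - 2 * T / Real.pi * ∑ i ∈ S, ‖c i‖ ^ 2|
      ≤ 8 * Real.pi / (T * γ ^ 2) * ∑ i ∈ S, ‖c i‖ ^ 2 := by
  classical
  set K : ℝ → ℂ := fun ξ => ∫ t in (0 : ℝ)..T,
    (Real.sin (Real.pi / T * t) : ℂ) * Complex.exp (ξ * t * Complex.I) with hK
  have hpi := Real.pi_pos
  have hγ0 : 0 < γ := by
    by_contra hcon
    push Not at hcon
    nlinarith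
  have hexpand : ((∫ t in (0 : ℝ)..T, Real.sin (Real.pi / T * t) * ‖expSum S w c t‖ ^ 2 : ℝ) : ℂ)
      = ∑ i ∈ S, ∑ j ∈ S, c i * (starRingEnd ℂ) (c j) * K (w i - w j) := by
    rw [← intervalIntegral.integral_ofReal]
    have : ∀ t : ℝ, ((Real.sin (Real.pi / T * t) * ‖expSum S w c t‖ ^ 2 : ℝ) : ℂ)
        = ∑ i ∈ S, ∑ j ∈ S, c i * (starRingEnd ℂ) (c j) *
          ((Real.sin (Real.pi / T * t) : ℂ) * Complex.exp ((w i - w j : ℝ) * t * Complex.I)) := by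
      intro t
      push_cast
      rw [← Complex.mul_conj', expSum, map_sum, Finset.sum_mul_sum, Finset.mul_sum]
      refine Finset.sum_congr rfl fun i _ => ?_
      rw [Finset.mul_sum]
      refine Finset.sum_congr rfl fun j _ => ?_
      rw [map_mul, ← Complex.exp_conj]
      simp only [map_mul, Complex.conj_ofReal, Complex.conj_I]
      rw [show ((w i - w j : ℂ) * t * Complex.I) = w i * t * Complex.I + w j * t * -Complex.I by ring,
        Complex.exp_add]
      ring
    simp_rw [this]
    rw [intervalIntegral.integral_finsetSum]
    · refine Finset.sum_congr rfl fun i _ => ?_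
      rw [intervalIntegral.integral_finsetSum]
      · refine Finset.sum_congr rfl fun j _ => ?_
        rw [intervalIntegral.integral_const_mul]
      · intro j _
        apply Continuous.intervalIntegrable
        fun_prop
    · intro i _
      apply Continuous.intervalIntegrable
      fun_prop
  have hK0 : K 0 = ((2 * T / Real.pi : ℝ) : ℂ) := by
    rw [hK, ← integral_sin_weight T hT, ← intervalIntegral.integral_ofReal]
    simp
  have hdiag : (∑ i ∈ S, ∑ j ∈ S, c i * (starRingEnd ℂ) (c j) * K (w i - w j))
      - ((2 * T / Real.pi * ∑ i ∈ S, ‖c i‖ ^ 2 : ℝ) : ℂ)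
      = ∑ i ∈ S, ∑ j ∈ S.erase i, c i * (starRingEnd ℂ) (c j) * K (w i - w j) := by
    rw [Complex.ofReal_mul, Complex.ofReal_sum, Finset.mul_sum, ← Finset.sum_sub_distrib]
    refine Finset.sum_congr rfl fun i hi => ?_
    rw [← Finset.add_sum_erase S _ hi, sub_self, hK0, Complex.mul_conj']
    push_cast
    ring
  have hrow : ∀ i ∈ S, ∑ j ∈ S.erase i, ‖K (w i - w j)‖ ≤ 8 * Real.pi / (T * γ ^ 2) := by
    intro i hi
    have hinj : Set.InjOn (fun j => n i - n j) (S.erase i : Finset ι) := by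
      intro a ha b hb h
      simp only [sub_right_inj] at h
      exact hn (Finset.mem_of_mem_erase ha) (Finset.mem_of_mem_erase hb) h
    have h0 : (0 : ℤ) ∉ (S.erase i).image (fun j => n i - n j) := by
      intro h
      obtain ⟨j, hj, h0⟩ := Finset.mem_image.1 h
      exact Finset.ne_of_mem_erase hj
        (hn (Finset.mem_of_mem_erase hj) hi (by linarith [sub_eq_zero.1 h0]))
    calc ∑ j ∈ S.erase i, ‖K (w i - w j)‖
        ≤ ∑ j ∈ S.erase i, 2 * Real.pi / (T * γ ^ 2) *
            (1 / (((n i - n j : ℤ) : ℝ) ^ 2 - 1 / 4)) := by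
          refine Finset.sum_le_sum fun j hj => ?_
          apply norm_integral_sin_mul_exp_le T γ (w i - w j) _ hT hγ
          · rw [← Int.cast_abs]
            have : n i - n j ≠ 0 := fun h => h0 (Finset.mem_image.2 ⟨j, hj, h⟩)
            exact_mod_cast Int.one_le_abs this
          · push_cast
            exact hgap i hi j (Finset.mem_of_mem_erase hj)
      _ = 2 * Real.pi / (T * γ ^ 2) * ∑ m ∈ (S.erase i).image (fun j => n i - n j),
            (1 / ((m : ℝ) ^ 2 - 1 / 4)) := by
          rw [Finset.sum_image hinj, Finset.mul_sum]
      _ ≤ 2 * Real.pi / (T * γ ^ 2) * 4 := by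
          gcongr
          exact sum_int_inv_sq_sub_quarter_le _ h0
      _ = _ := by ring
  have hsymm : ∀ ξ, ‖K (-ξ)‖ = ‖K ξ‖ := by
    intro ξ
    have : K (-ξ) = (starRingEnd ℂ) (K ξ) := by
      simp only [hK, intervalIntegral.integral_of_le hT.le]
      rw [← integral_conj]
      refine integral_congr_ae (Eventually.of_forall fun t => ?_)
      simp only [map_mul, ← Complex.exp_conj, Complex.conj_ofReal, Complex.conj_I]
      push_cast
      congr 2
      ring
    rw [this, RCLike.norm_conj]
  have habs : |(∫ t in (0 : ℝ)..T, Real.sin (Real.pi / T * t) * ‖expSum S w c t‖ ^ 2)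
      - 2 * T / Real.pi * ∑ i ∈ S, ‖c i‖ ^ 2|
      = ‖∑ i ∈ S, ∑ j ∈ S.erase i, c i * (starRingEnd ℂ) (c j) * K (w i - w j)‖ := by
    rw [← hdiag, ← hexpand, ← Complex.ofReal_sub, Complex.norm_real, Real.norm_eq_abs]
  rw [habs]
  have hswap : ∀ g : ι → ι → ℝ, ∑ i ∈ S, ∑ j ∈ S.erase i, g i j
      = ∑ j ∈ S, ∑ i ∈ S.erase j, g i j := by
    intro g
    refine Finset.sum_comm' fun i j => ?_
    simp only [Finset.mem_erase]
    tauto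
  calc ‖∑ i ∈ S, ∑ j ∈ S.erase i, c i * (starRingEnd ℂ) (c j) * K (w i - w j)‖
      ≤ ∑ i ∈ S, ∑ j ∈ S.erase i, (‖c i‖ ^ 2 / 2 * ‖K (w i - w j)‖
          + ‖c j‖ ^ 2 / 2 * ‖K (w i - w j)‖) := by
        refine norm_sum_le_of_le _ fun i _ => norm_sum_le_of_le _ fun j _ => ?_
        rw [norm_mul, norm_mul, RCLike.norm_conj, ← add_mul]
        refine mul_le_mul_of_nonneg_right ?_ (norm_nonneg _)
        nlinarith [sq_nonneg (‖c i‖ - ‖c j‖)]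
    _ = ∑ i ∈ S, ‖c i‖ ^ 2 / 2 * ∑ j ∈ S.erase i, ‖K (w i - w j)‖
        + ∑ j ∈ S, ‖c j‖ ^ 2 / 2 * ∑ i ∈ S.erase j, ‖K (w j - w i)‖ := by
        simp_rw [Finset.sum_add_distrib]
        rw [hswap (fun i j => ‖c j‖ ^ 2 / 2 * ‖K (w i - w j)‖)]
        simp_rw [Finset.mul_sum]
        congr 1
        refine Finset.sum_congr rfl fun j _ => Finset.sum_congr rfl fun i _ => ?_
        rw [← hsymm (w i - w j), neg_sub]
    _ ≤ ∑ i ∈ S, ‖c i‖ ^ 2 / 2 * (8 * Real.pi / (T * γ ^ 2))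
        + ∑ j ∈ S, ‖c j‖ ^ 2 / 2 * (8 * Real.pi / (T * γ ^ 2)) := by
        gcongr with i hi j hj
        · exact hrow i hi
        · exact hrow j hj
    _ = _ := by
        rw [← Finset.sum_add_distrib, Finset.mul_sum]
        refine Finset.sum_congr rfl fun i _ => ?_
        ring

/-- Ingham's inequality: exponents with a gap larger than `2π / T`. -/
theorem ingham_lower (T γ : ℝ) (hT : 0 < T) (hγ : 2 * Real.pi < T * γ) :
    ∃ m > 0, ∀ {ι : Type} (S : Finset ι) (w : ι → ℝ) (n : ι → ℤ), Set.InjOn n S → ∀ c : ι → ℂ,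
      (∀ i ∈ S, ∀ j ∈ S, γ * |((n i : ℝ) - n j)| ≤ |w i - w j|) →
      m * ∑ i ∈ S, ‖c i‖ ^ 2 ≤ ∫ t in (0 : ℝ)..T, ‖expSum S w c t‖ ^ 2 := by
  have hpi := Real.pi_pos
  have hγ0 : 0 < γ := by
    by_contra hcon
    push Not at hcon
    nlinarith
  refine ⟨2 * T / Real.pi - 8 * Real.pi / (T * γ ^ 2), ?_, fun S w n hn c hgap => ?_⟩
  · rw [gt_iff_lt, sub_pos, div_lt_div_iff₀ (by positivity) (by positivity)]
    have : (2 * Real.pi) ^ 2 < (T * γ) ^ 2 := by gcongr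
    nlinarith
  · have h1 := (abs_le.1 (abs_integral_sin_mul_normSq_expSum_sub_le S w n hn c T γ hT hγ.le hgap)).1
    have h2 : (∫ t in (0 : ℝ)..T, Real.sin (Real.pi / T * t) * ‖expSum S w c t‖ ^ 2)
        ≤ ∫ t in (0 : ℝ)..T, ‖expSum S w c t‖ ^ 2 := by
      apply intervalIntegral.integral_mono_on hT.le
      · apply Continuous.intervalIntegrable; fun_prop
      · apply Continuous.intervalIntegrable; fun_prop
      · intro t _
        have := Real.sin_le_one (Real.pi / T * t)
        nlinarith [sq_nonneg ‖expSum S w c t‖]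
    linarith

theorem expSum_add {ι : Type*} (S : Finset ι) (w : ι → ℝ) (c : ι → ℂ) (t h : ℝ) :
    expSum S w c (t + h) = expSum S w (fun i => c i * Complex.exp (w i * h * Complex.I)) t := by
  unfold expSum
  refine Finset.sum_congr rfl fun i _ => ?_
  simp only
  rw [mul_assoc (c i), ← Complex.exp_add]
  congr 2
  push_cast
  ring

theorem norm_exp_freq (w t : ℝ) : ‖Complex.exp (w * t * Complex.I)‖ = 1 := by
  rw [← Complex.ofReal_mul, Complex.norm_exp_ofReal_mul_I]

/-- The direct inequality for exponents with a gap. -/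
theorem ingham_upper (T γ : ℝ) (hT : 0 < T) (hγ : 2 * Real.pi < T * γ) :
    ∃ M > 0, ∀ {ι : Type} (S : Finset ι) (w : ι → ℝ) (n : ι → ℤ), Set.InjOn n S → ∀ c : ι → ℂ,
      (∀ i ∈ S, ∀ j ∈ S, γ * |((n i : ℝ) - n j)| ≤ |w i - w j|) →
      ∫ t in (0 : ℝ)..T, ‖expSum S w c t‖ ^ 2 ≤ M * ∑ i ∈ S, ‖c i‖ ^ 2 := by
  have hpi := Real.pi_pos
  have hγ0 : 0 < γ := by
    by_contra hcon
    push Not at hcon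
    nlinarith
  refine ⟨2 * (2 * (2 * T) / Real.pi + 8 * Real.pi / (2 * T * γ ^ 2)), by positivity,
    fun S w n hn c hgap => ?_⟩
  set c' : _ → ℂ := fun i => c i * Complex.exp (w i * ((-(T / 2) : ℝ)) * Complex.I) with hc'
  have hnorm : ∀ i, ‖c' i‖ = ‖c i‖ := fun i => by
    rw [hc', norm_mul, norm_exp_freq, mul_one]
  have h1 := (abs_le.1 (abs_integral_sin_mul_normSq_expSum_sub_le S w n hn c' (2 * T) γ
    (by positivity) (by nlinarith) hgap)).2
  simp_rw [hnorm] at h1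
  have hshift : (∫ t in (0 : ℝ)..T, ‖expSum S w c t‖ ^ 2)
      = ∫ t in (T / 2)..(T / 2 + T), ‖expSum S w c' t‖ ^ 2 := by
    have : ∀ t, ‖expSum S w c' t‖ ^ 2 = ‖expSum S w c (t - T / 2)‖ ^ 2 := by
      intro t
      rw [sub_eq_add_neg, expSum_add]
    simp_rw [this]
    rw [intervalIntegral.integral_comp_sub_right (fun t => ‖expSum S w c t‖ ^ 2)]
    simp
  have hpos : ∀ t ∈ Set.Icc (0 : ℝ) (2 * T), 0 ≤ Real.sin (Real.pi / (2 * T) * t) := by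
    intro t ht
    apply Real.sin_nonneg_of_nonneg_of_le_pi
    · exact mul_nonneg (by positivity) ht.1
    · rw [div_mul_eq_mul_div, div_le_iff₀ (by positivity)]
      exact mul_le_mul_of_nonneg_left ht.2 hpi.le
  have hlow : ∀ t ∈ Set.Icc (T / 2) (T / 2 + T), 1 / 2 ≤ Real.sin (Real.pi / (2 * T) * t) := by
    intro t ht
    have e : Real.pi / (2 * T) * t - Real.pi / 2 = Real.pi / (2 * T) * (t - T) := by
      field_simp
    rw [← Real.cos_sub_pi_div_two, e, ← Real.cos_abs]
    have : |Real.pi / (2 * T) * (t - T)| ≤ Real.pi / 4 := by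
      rw [abs_mul, abs_of_pos (by positivity : 0 < Real.pi / (2 * T))]
      have : |t - T| ≤ T / 2 := abs_le.2 ⟨by linarith [ht.1], by linarith [ht.2]⟩
      calc _ ≤ Real.pi / (2 * T) * (T / 2) := by gcongr
        _ = _ := by field_simp; norm_num
    calc (1 / 2 : ℝ) = Real.cos (Real.pi / 3) := by rw [Real.cos_pi_div_three]
      _ ≤ _ := Real.cos_le_cos_of_nonneg_of_le_pi (abs_nonneg _) (by linarith) (by linarith)
  have h2 : (∫ t in (T / 2)..(T / 2 + T), 1 / 2 * ‖expSum S w c' t‖ ^ 2)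
      ≤ ∫ t in (0 : ℝ)..(2 * T), Real.sin (Real.pi / (2 * T) * t) * ‖expSum S w c' t‖ ^ 2 := by
    calc _ ≤ ∫ t in (T / 2)..(T / 2 + T),
          Real.sin (Real.pi / (2 * T) * t) * ‖expSum S w c' t‖ ^ 2 := by
          apply intervalIntegral.integral_mono_on (by linarith)
          · apply Continuous.intervalIntegrable; fun_prop
          · apply Continuous.intervalIntegrable; fun_prop
          · intro t ht
            exact mul_le_mul_of_nonneg_right (hlow t ht) (sq_nonneg _)
      _ ≤ _ := by
          apply intervalIntegral.integral_mono_interval (by linarith) (by linarith) (by linarith)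
          · refine (ae_restrict_iff' measurableSet_Ioc).2 (Eventually.of_forall fun t ht => ?_)
            exact mul_nonneg (hpos t ⟨ht.1.le, ht.2⟩) (sq_nonneg _)
          · apply Continuous.intervalIntegrable; fun_prop
  rw [intervalIntegral.integral_const_mul, ← hshift] at h2
  linarith

/-- `‖∑ cᵢ e^{i wᵢ t} (1, σᵢ)‖²`. -/
noncomputable def obs {ι : Type*} (S : Finset ι) (w σ : ι → ℝ) (c : ι → ℂ) (t : ℝ) : ℝ :=
  ‖expSum S w c t‖ ^ 2 + ‖expSum S w (fun i => σ i * c i) t‖ ^ 2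

theorem obs_nonneg {ι : Type*} (S : Finset ι) (w σ : ι → ℝ) (c : ι → ℂ) (t : ℝ) :
    0 ≤ obs S w σ c t := by unfold obs; positivity

@[fun_prop]
theorem continuous_obs {ι : Type*} (S : Finset ι) (w σ : ι → ℝ) (c : ι → ℂ) :
    Continuous (obs S w σ c) := by
  unfold obs; fun_prop

theorem norm_sub_sq_le_two (x y : ℂ) : ‖x - y‖ ^ 2 ≤ 2 * ‖x‖ ^ 2 + 2 * ‖y‖ ^ 2 := by
  have := norm_sub_le x y
  have h := norm_nonneg (x - y)
  nlinarith [sq_nonneg (‖x‖ - ‖y‖)]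

theorem norm_add_sq_le_two (x y : ℂ) : ‖x + y‖ ^ 2 ≤ 2 * ‖x‖ ^ 2 + 2 * ‖y‖ ^ 2 := by
  simpa using norm_sub_sq_le_two x (-y)

/-- Frequencies `w` and slopes `σ` of the modes `e^{i w t} (1, σ)`, split into two families with
slopes of opposite signs, each family having asymptotically a gap larger than `2π / T` for every
`T > T₀`. -/
structure IsModeFamily (w σ : ℤ × Bool → ℝ) (s : Bool → ℝ) (s₀ B T₀ : ℝ) : Prop where
  inj : ∀ b, Function.Injective fun k => w (k, b)
  pos : 0 < s₀
  slope_true : ∀ k, s₀ ≤ σ (k, true)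
  slope_false : ∀ k, σ (k, false) ≤ -s₀
  slope_bound : ∀ j, |σ j| ≤ B
  lim : ∀ b, Tendsto (fun k : ℤ => σ (k, b)) cofinite (𝓝 (s b))
  time_nonneg : 0 ≤ T₀
  gap : ∀ T, T₀ < T → ∃ γ, 2 * Real.pi < T * γ ∧ ∃ K : ℕ, ∀ b, ∀ k n : ℤ, (K : ℤ) ≤ |k| →
    (K : ℤ) ≤ |n| → γ * |(k : ℝ) - n| ≤ |w (k, b) - w (n, b)|

theorem pair_norm_sq_le {s₀ B σ τ : ℝ} (h0 : 0 < s₀) (hσ : s₀ ≤ σ) (hτ : τ ≤ -s₀) (hσB : |σ| ≤ B)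
    (hτB : |τ| ≤ B) (a b : ℂ) :
    ‖a‖ ^ 2 + ‖b‖ ^ 2 ≤ (1 + B ^ 2) / s₀ ^ 2 * (‖a + b‖ ^ 2 + ‖σ * a + τ * b‖ ^ 2) := by
  have aux : ∀ (ρ ζ : ℝ) (z : ℂ), 2 * s₀ ≤ |ρ| → |ζ| ≤ B →
      (ρ : ℂ) * z = (σ * a + τ * b) - ζ * (a + b) →
      (2 * s₀) ^ 2 * ‖z‖ ^ 2 ≤ 2 * (1 + B ^ 2) * (‖a + b‖ ^ 2 + ‖σ * a + τ * b‖ ^ 2) := by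
    intro ρ ζ z hρ hζ h
    have h1 := norm_sub_sq_le_two (σ * a + τ * b) (ζ * (a + b))
    rw [← h, norm_mul, norm_mul, Complex.norm_real, Complex.norm_real, Real.norm_eq_abs,
      Real.norm_eq_abs, mul_pow, mul_pow] at h1
    have h2 : (2 * s₀) ^ 2 ≤ |ρ| ^ 2 := by gcongr
    have h3 : |ζ| ^ 2 ≤ B ^ 2 := by gcongr
    have h4 := mul_le_mul_of_nonneg_right h2 (sq_nonneg ‖z‖)
    have h5 := mul_le_mul_of_nonneg_right h3 (sq_nonneg ‖a + b‖)
    nlinarith [sq_nonneg ‖a + b‖, sq_nonneg ‖σ * a + τ * b‖,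
      mul_nonneg (sq_nonneg B) (sq_nonneg ‖σ * a + τ * b‖)]
  have ha := aux (σ - τ) τ a (by rw [abs_of_nonneg (by linarith)]; linarith) hτB
    (by push_cast; ring)
  have hb := aux (τ - σ) σ b (by rw [abs_sub_comm, abs_of_nonneg (by linarith)]; linarith) hσB
    (by push_cast; ring)
  rw [div_mul_eq_mul_div, le_div_iff₀ (by positivity)]
  nlinarith

theorem expSum_sub {ι : Type*} (S : Finset ι) (w : ι → ℝ) (c d : ι → ℂ) (t : ℝ) :
    expSum S w (fun i => c i - d i) t = expSum S w c t - expSum S w d t := by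
  simp only [expSum, sub_mul, Finset.sum_sub_distrib]

theorem expSum_const_mul {ι : Type*} (S : Finset ι) (w : ι → ℝ) (c : ι → ℂ) (z : ℂ) (t : ℝ) :
    expSum S w (fun i => z * c i) t = z * expSum S w c t := by
  simp only [expSum, Finset.mul_sum, mul_assoc]

theorem obs_sub_le {ι : Type*} (S : Finset ι) (w σ : ι → ℝ) (c d : ι → ℂ) (t : ℝ) :
    obs S w σ (fun i => c i - d i) t ≤ 2 * obs S w σ c t + 2 * obs S w σ d t := by
  unfold obs
  simp only [mul_sub, expSum_sub]
  have h1 := norm_sub_sq_le_two (expSum S w c t) (expSum S w d t)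
  have h2 := norm_sub_sq_le_two (expSum S w (fun i => σ i * c i) t)
    (expSum S w (fun i => σ i * d i) t)
  linarith

theorem norm_expSum_sq_le_card {ι : Type*} (S : Finset ι) (w : ι → ℝ) (c : ι → ℂ) (t : ℝ) :
    ‖expSum S w c t‖ ^ 2 ≤ S.card * ∑ i ∈ S, ‖c i‖ ^ 2 := by
  have h : ‖expSum S w c t‖ ≤ ∑ i ∈ S, ‖c i‖ := by
    refine norm_sum_le_of_le _ fun i _ => ?_
    rw [norm_mul, norm_exp_freq, mul_one]
  calc ‖expSum S w c t‖ ^ 2 ≤ (∑ i ∈ S, ‖c i‖) ^ 2 := by gcongr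
    _ ≤ _ := sq_sum_le_card_mul_sum_sq

theorem integral_norm_sq_add_le {T : ℝ} (hT : 0 ≤ T) {f g h : ℝ → ℂ} (hf : Continuous f)
    (hg : Continuous g) (hh : Continuous h) (hfgh : ∀ t, f t = g t + h t) :
    ∫ t in (0 : ℝ)..T, ‖f t‖ ^ 2
      ≤ 2 * (∫ t in (0 : ℝ)..T, ‖g t‖ ^ 2) + 2 * ∫ t in (0 : ℝ)..T, ‖h t‖ ^ 2 := by
  rw [← intervalIntegral.integral_const_mul, ← intervalIntegral.integral_const_mul,
    ← intervalIntegral.integral_add]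
  · apply intervalIntegral.integral_mono_on hT
    · apply Continuous.intervalIntegrable; fun_prop
    · apply Continuous.intervalIntegrable; fun_prop
    · intro t _
      rw [hfgh]
      exact norm_add_sq_le_two _ _
  · apply Continuous.intervalIntegrable; fun_prop
  · apply Continuous.intervalIntegrable; fun_prop

theorem expSum_filter_add {ι : Type*} (S : Finset ι) (p : ι → Prop) [DecidablePred p] (w : ι → ℝ)
    (c : ι → ℂ) (t : ℝ) :
    expSum S w c t = expSum (S.filter p) w c t + expSum (S.filter fun i => ¬ p i) w c t :=
  (Finset.sum_filter_add_sum_filter_not S p _).symm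

theorem sum_filter_norm_sq_le {ι : Type*} (S : Finset ι) (p : ι → Prop) [DecidablePred p]
    (c : ι → ℂ) : ∑ i ∈ S.filter p, ‖c i‖ ^ 2 ≤ ∑ i ∈ S, ‖c i‖ ^ 2 :=
  Finset.sum_le_sum_of_subset_of_nonneg (Finset.filter_subset _ _) fun _ _ _ => sq_nonneg _

section

variable {w σ : ℤ × Bool → ℝ} {s : Bool → ℝ} {s₀ B T₀ : ℝ}

theorem IsModeFamily.exists_expSum_le (h : IsModeFamily w σ s s₀ B T₀) {T : ℝ} (hT : T₀ < T) :
    ∃ M > 0, ∀ (S : Finset (ℤ × Bool)) (c : ℤ × Bool → ℂ),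
      ∫ t in (0 : ℝ)..T, ‖expSum S w c t‖ ^ 2 ≤ M * ∑ j ∈ S, ‖c j‖ ^ 2 := by
  classical
  obtain ⟨γ, hγ, K, hK⟩ := h.gap T hT
  have hT0 : 0 < T := h.time_nonneg.trans_lt hT
  obtain ⟨M, hM, hup⟩ := ingham_upper T γ hT0 hγ
  set A : Finset (ℤ × Bool) := Finset.Icc (-(K : ℤ)) K ×ˢ Finset.univ with hA
  refine ⟨2 * (T * A.card) + 8 * M, by positivity, fun S c => ?_⟩
  have hsplit := expSum_filter_add S (fun j => j ∈ A) w c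
  have h1 := integral_norm_sq_add_le hT0.le (continuous_expSum S w c)
    (continuous_expSum _ w c) (continuous_expSum _ w c) hsplit
  have h2 := integral_norm_sq_add_le hT0.le
    (continuous_expSum (S.filter fun j => j ∉ A) w c)
    (continuous_expSum _ w c) (continuous_expSum _ w c)
    (expSum_filter_add (S.filter fun j => j ∉ A) (fun j => j.2 = true) w c)
  have hhead : ∫ t in (0 : ℝ)..T, ‖expSum (S.filter fun j => j ∈ A) w c t‖ ^ 2
      ≤ T * A.card * ∑ j ∈ S, ‖c j‖ ^ 2 := by
    calc _ ≤ ∫ t in (0 : ℝ)..T, (A.card : ℝ) * ∑ j ∈ S, ‖c j‖ ^ 2 := by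
          apply intervalIntegral.integral_mono_on hT0.le
          · apply Continuous.intervalIntegrable; fun_prop
          · simp
          · intro t _
            refine (norm_expSum_sq_le_card _ w c t).trans ?_
            have hc : (S.filter fun j => j ∈ A).card ≤ A.card :=
              Finset.card_le_card fun j hj => (Finset.mem_filter.1 hj).2
            exact mul_le_mul (by exact_mod_cast hc) (sum_filter_norm_sq_le S _ c)
              (Finset.sum_nonneg fun _ _ => sq_nonneg _) (by positivity)
      _ = _ := by simp; ring
  have htail : ∀ (p : ℤ × Bool → Prop) [DecidablePred p] (b : Bool), (∀ j, p j → j.2 = b) →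
      ∫ t in (0 : ℝ)..T, ‖expSum ((S.filter fun j => j ∉ A).filter p) w c t‖ ^ 2
        ≤ M * ∑ j ∈ S, ‖c j‖ ^ 2 := by
    intro p _ b hp
    refine (hup _ w Prod.fst ?_ c ?_).trans ?_
    · intro i hi j hj hij
      have hi' := hp i (Finset.mem_filter.1 (Finset.mem_coe.1 hi)).2
      have hj' := hp j (Finset.mem_filter.1 (Finset.mem_coe.1 hj)).2
      exact Prod.ext hij (hi'.trans hj'.symm)
    · have large : ∀ j ∈ (S.filter fun j => j ∉ A).filter p, j = (j.1, b) ∧ (K : ℤ) ≤ |j.1| := by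
        intro j hj
        obtain ⟨hj1, hj2⟩ := Finset.mem_filter.1 hj
        have hjA := (Finset.mem_filter.1 hj1).2
        refine ⟨Prod.ext rfl (hp j hj2), ?_⟩
        by_contra hcon
        push Not at hcon
        apply hjA
        simp only [hA, Finset.mem_product, Finset.mem_Icc, Finset.mem_univ, and_true]
        exact ⟨(abs_lt.1 hcon).1.le, (abs_lt.1 hcon).2.le⟩
      intro i hi j hj
      obtain ⟨hi1, hi2⟩ := large i hi
      obtain ⟨hj1, hj2⟩ := large j hj
      have := hK b i.1 j.1 hi2 hj2
      rwa [← hi1, ← hj1] at this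
    · gcongr
      exact (Finset.filter_subset _ _).trans (Finset.filter_subset _ _)
  have ht := htail (fun j => j.2 = true) true fun _ h => h
  have hf := htail (fun j => ¬ j.2 = true) false fun _ h => by simpa using h
  nlinarith

theorem sum_slope_norm_sq_le (h : IsModeFamily w σ s s₀ B T₀) (S : Finset (ℤ × Bool))
    (c : ℤ × Bool → ℂ) : ∑ j ∈ S, ‖(σ j : ℂ) * c j‖ ^ 2 ≤ B ^ 2 * ∑ j ∈ S, ‖c j‖ ^ 2 := by
  rw [Finset.mul_sum]
  refine Finset.sum_le_sum fun j _ => ?_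
  rw [norm_mul, mul_pow, Complex.norm_real, Real.norm_eq_abs]
  have := h.slope_bound j
  gcongr

theorem integral_obs {ι : Type*} (S : Finset ι) (w σ : ι → ℝ) (c : ι → ℂ) (T : ℝ) :
    ∫ t in (0 : ℝ)..T, obs S w σ c t = (∫ t in (0 : ℝ)..T, ‖expSum S w c t‖ ^ 2)
      + ∫ t in (0 : ℝ)..T, ‖expSum S w (fun i => σ i * c i) t‖ ^ 2 := by
  unfold obs
  apply intervalIntegral.integral_add
  · apply Continuous.intervalIntegrable; fun_prop
  · apply Continuous.intervalIntegrable; fun_prop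

/-- The direct inequality for the vector valued sums. -/
theorem IsModeFamily.exists_obs_le (h : IsModeFamily w σ s s₀ B T₀) {T : ℝ} (hT : T₀ < T) :
    ∃ M > 0, ∀ (S : Finset (ℤ × Bool)) (c : ℤ × Bool → ℂ),
      ∫ t in (0 : ℝ)..T, obs S w σ c t ≤ M * ∑ j ∈ S, ‖c j‖ ^ 2 := by
  obtain ⟨M, hM, hup⟩ := h.exists_expSum_le hT
  refine ⟨M * (1 + B ^ 2), by positivity, fun S c => ?_⟩
  rw [integral_obs]
  have h1 := hup S c
  have h2 := hup S (fun i => σ i * c i)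
  have h3 := mul_le_mul_of_nonneg_left (sum_slope_norm_sq_le h S c) hM.le
  linarith

/-- Modes with a common frequency are uniformly linearly independent. -/
theorem IsModeFamily.sum_norm_sq_le_of_freq_eq (h : IsModeFamily w σ s s₀ B T₀)
    (D : Finset (ℤ × Bool)) (x : ℝ) (hD : ∀ j ∈ D, w j = x) (c : ℤ × Bool → ℂ) :
    ∑ j ∈ D, ‖c j‖ ^ 2 ≤ (1 + B ^ 2) / s₀ ^ 2 *
      (‖∑ j ∈ D, c j‖ ^ 2 + ‖∑ j ∈ D, (σ j : ℂ) * c j‖ ^ 2) := by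
  classical
  have hsub : ∀ (b : Bool) (E : Finset (ℤ × Bool)), E ⊆ D → (∀ j ∈ E, j.2 = b) →
      ∃ k, E ⊆ {(k, b)} := by
    intro b E hE hb
    rcases E.eq_empty_or_nonempty with rfl | ⟨j, hj⟩
    · exact ⟨0, by simp⟩
    · refine ⟨j.1, fun i hi => Finset.mem_singleton.2 ?_⟩
      have e1 : i = (i.1, b) := Prod.ext rfl (hb i hi)
      have e2 : j = (j.1, b) := Prod.ext rfl (hb j hj)
      have : w (i.1, b) = w (j.1, b) := by rw [← e1, ← e2, hD i (hE hi), hD j (hE hj)]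
      rw [e1, h.inj b this]
  have hcalc : ∀ (b : Bool) (E : Finset (ℤ × Bool)), E ⊆ D → (∀ j ∈ E, j.2 = b) →
      ∃ (k : ℤ) (a : ℂ), ∑ j ∈ E, c j = a ∧ ∑ j ∈ E, (σ j : ℂ) * c j = σ (k, b) * a ∧
        ∑ j ∈ E, ‖c j‖ ^ 2 = ‖a‖ ^ 2 := by
    intro b E hE hb
    obtain ⟨k, hk⟩ := hsub b E hE hb
    rcases Finset.subset_singleton_iff.1 hk with rfl | rfl
    · exact ⟨k, 0, by simp⟩
    · exact ⟨k, c (k, b), by simp⟩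
  obtain ⟨k, a, ha1, ha2, ha3⟩ := hcalc true (D.filter fun j => j.2 = true)
    (Finset.filter_subset _ _) (fun j hj => (Finset.mem_filter.1 hj).2)
  obtain ⟨n, b, hb1, hb2, hb3⟩ := hcalc false (D.filter fun j => ¬ j.2 = true)
    (Finset.filter_subset _ _) (fun j hj => by simpa using (Finset.mem_filter.1 hj).2)
  rw [← Finset.sum_filter_add_sum_filter_not D (fun j => j.2 = true) (fun j => ‖c j‖ ^ 2),
    ← Finset.sum_filter_add_sum_filter_not D (fun j => j.2 = true) c,
    ← Finset.sum_filter_add_sum_filter_not D (fun j => j.2 = true) (fun j => (σ j : ℂ) * c j),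
    ha1, ha2, ha3, hb1, hb2, hb3]
  exact pair_norm_sq_le h.pos (h.slope_true k) (h.slope_false n) (h.slope_bound _)
    (h.slope_bound _) a b

theorem IsModeFamily.slope_lim (h : IsModeFamily w σ s s₀ B T₀) :
    s₀ ≤ s true ∧ s false ≤ -s₀ ∧ ∀ b, |s b| ≤ B :=
  ⟨ge_of_tendsto' (h.lim true) h.slope_true, le_of_tendsto' (h.lim false) h.slope_false,
    fun b => le_of_tendsto' (h.lim b).abs fun k => h.slope_bound (k, b)⟩

/-- The inverse inequality for the modes outside a finite set. -/
theorem IsModeFamily.exists_tail_le (h : IsModeFamily w σ s s₀ B T₀) {T : ℝ} (hT : T₀ < T) :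
    ∃ (J : Finset (ℤ × Bool)), ∃ C > 0, ∀ (S : Finset (ℤ × Bool)) (c : ℤ × Bool → ℂ),
      (∀ j ∈ J, c j = 0) → ∑ j ∈ S, ‖c j‖ ^ 2 ≤ C * ∫ t in (0 : ℝ)..T, obs S w σ c t := by
  classical
  obtain ⟨γ, hγ, K, hK⟩ := h.gap T hT
  have hT0 : 0 < T := h.time_nonneg.trans_lt hT
  obtain ⟨m, hm, hlow⟩ := ingham_lower T γ hT0 hγ
  obtain ⟨M, hM, hup⟩ := h.exists_expSum_le hT
  set C₀ := (1 + B ^ 2) / s₀ ^ 2 with hC₀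
  have hs₀ := h.pos
  have hC₀pos : 0 < C₀ := by positivity
  obtain ⟨η, hη, hηm⟩ : ∃ η > 0, 2 * C₀ * (M * η ^ 2) ≤ m / 2 := by
    refine ⟨Real.sqrt (m / (4 * C₀ * M)), by positivity, ?_⟩
    rw [Real.sq_sqrt (by positivity)]
    apply le_of_eq
    field_simp
    ring
  have hfin : ∀ b, {k : ℤ | ¬ |σ (k, b) - s b| < η}.Finite := fun b => by
    have := (Metric.tendsto_nhds.1 (h.lim b)) η hη
    simp only [Real.dist_eq] at this
    exact Filter.eventually_cofinite.1 this
  set J : Finset (ℤ × Bool) := (Finset.Icc (-(K : ℤ)) K ∪ (hfin true).toFinset ∪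
    (hfin false).toFinset) ×ˢ Finset.univ with hJ
  refine ⟨J, 4 * C₀ / m, by positivity, ?_⟩
  have main : ∀ (S : Finset (ℤ × Bool)) (c : ℤ × Bool → ℂ), (∀ j ∈ S, j ∉ J) →
      ∑ j ∈ S, ‖c j‖ ^ 2 ≤ 4 * C₀ / m * ∫ t in (0 : ℝ)..T, obs S w σ c t := by
    intro S c hS
    have hSK : ∀ j ∈ S, (K : ℤ) ≤ |j.1| := by
      intro j hj
      by_contra hcon
      push Not at hcon
      apply hS j hj
      simp only [hJ, Finset.mem_product, Finset.mem_union, Finset.mem_Icc, Finset.mem_univ,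
        and_true]
      exact Or.inl (Or.inl ⟨(abs_lt.1 hcon).1.le, (abs_lt.1 hcon).2.le⟩)
    have hSη : ∀ j ∈ S, |σ j - s j.2| < η := by
      intro j hj
      by_contra hcon
      apply hS j hj
      simp only [hJ, Finset.mem_product, Finset.mem_union, Finset.mem_Icc, Finset.mem_univ,
        and_true, Set.Finite.mem_toFinset, Set.mem_ofPred_eq]
      rcases j with ⟨k, b⟩
      cases b
      · exact Or.inr hcon
      · exact Or.inl (Or.inr hcon)
    have hlow' : ∀ b : Bool, m * ∑ j ∈ S.filter (fun j => j.2 = b), ‖c j‖ ^ 2 ≤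
        ∫ t in (0 : ℝ)..T, ‖expSum (S.filter (fun j => j.2 = b)) w c t‖ ^ 2 := by
      intro b
      refine hlow _ w Prod.fst ?_ c ?_
      · intro i hi j hj hij
        have hi' := (Finset.mem_filter.1 (Finset.mem_coe.1 hi)).2
        have hj' := (Finset.mem_filter.1 (Finset.mem_coe.1 hj)).2
        exact Prod.ext hij (hi'.trans hj'.symm)
      · intro i hi j hj
        obtain ⟨hi1, hi2⟩ := Finset.mem_filter.1 hi
        obtain ⟨hj1, hj2⟩ := Finset.mem_filter.1 hj
        have := hK b i.1 j.1 (hSK i hi1) (hSK j hj1)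
        have e1 : i = (i.1, b) := Prod.ext rfl hi2
        have e2 : j = (j.1, b) := Prod.ext rfl hj2
        rwa [← e1, ← e2] at this
    set Q : ℤ × Bool → ℂ := fun j => ((σ j - s j.2 : ℝ) : ℂ) * c j with hQ
    have hQsum : ∑ j ∈ S, ‖Q j‖ ^ 2 ≤ η ^ 2 * ∑ j ∈ S, ‖c j‖ ^ 2 := by
      rw [Finset.mul_sum]
      refine Finset.sum_le_sum fun j hj => ?_
      rw [hQ, norm_mul, mul_pow, Complex.norm_real, Real.norm_eq_abs]
      have := (hSη j hj).le
      gcongr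
    have hpt : ∀ t, ‖expSum (S.filter (fun j => j.2 = true)) w c t‖ ^ 2
        + ‖expSum (S.filter (fun j => j.2 = false)) w c t‖ ^ 2
        ≤ 2 * C₀ * obs S w σ c t + 2 * C₀ * ‖expSum S w Q t‖ ^ 2 := by
      intro t
      have hl := h.slope_lim
      have h1 := pair_norm_sq_le h.pos hl.1 hl.2.1 (hl.2.2 _) (hl.2.2 _)
        (expSum (S.filter (fun j => j.2 = true)) w c t)
        (expSum (S.filter (fun j => j.2 = false)) w c t)
      have hneg : (S.filter fun j => ¬ j.2 = true) = S.filter fun j => j.2 = false :=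
        Finset.filter_congr fun j _ => by simp
      have e1 : expSum (S.filter (fun j => j.2 = true)) w c t
          + expSum (S.filter (fun j => j.2 = false)) w c t = expSum S w c t := by
        rw [expSum_filter_add S (fun j => j.2 = true), hneg]
      have e2 : s true * expSum (S.filter (fun j => j.2 = true)) w c t
          + s false * expSum (S.filter (fun j => j.2 = false)) w c t
          = expSum S w (fun j => σ j * c j) t - expSum S w Q t := by
        rw [← expSum_sub, expSum_filter_add S (fun j => j.2 = true), hneg, ← expSum_const_mul,
          ← expSum_const_mul]
        congr 1
        · refine Finset.sum_congr rfl fun j hj => ?_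
          simp only [hQ]
          rw [(Finset.mem_filter.1 hj).2]
          push_cast
          ring
        · refine Finset.sum_congr rfl fun j hj => ?_
          simp only [hQ]
          rw [(Finset.mem_filter.1 hj).2]
          push_cast
          ring
      rw [e1, e2] at h1
      have h2 := norm_sub_sq_le_two (expSum S w (fun j => σ j * c j) t) (expSum S w Q t)
      refine h1.trans ?_
      unfold obs
      have := mul_le_mul_of_nonneg_left h2 hC₀pos.le
      nlinarith [mul_nonneg hC₀pos.le (sq_nonneg ‖expSum S w c t‖)]
    have hint : (∫ t in (0 : ℝ)..T, ‖expSum (S.filter (fun j => j.2 = true)) w c t‖ ^ 2)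
        + (∫ t in (0 : ℝ)..T, ‖expSum (S.filter (fun j => j.2 = false)) w c t‖ ^ 2)
        ≤ 2 * C₀ * (∫ t in (0 : ℝ)..T, obs S w σ c t)
          + 2 * C₀ * ∫ t in (0 : ℝ)..T, ‖expSum S w Q t‖ ^ 2 := by
      rw [← intervalIntegral.integral_const_mul, ← intervalIntegral.integral_const_mul,
        ← intervalIntegral.integral_add, ← intervalIntegral.integral_add]
      · apply intervalIntegral.integral_mono_on hT0.le
        · apply Continuous.intervalIntegrable; fun_prop
        · apply Continuous.intervalIntegrable; fun_prop
        · intro t _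
          exact hpt t
      all_goals apply Continuous.intervalIntegrable; fun_prop
    have hsum : ∑ j ∈ S.filter (fun j => j.2 = true), ‖c j‖ ^ 2
        + ∑ j ∈ S.filter (fun j => j.2 = false), ‖c j‖ ^ 2 = ∑ j ∈ S, ‖c j‖ ^ 2 := by
      rw [← Finset.sum_filter_add_sum_filter_not S (fun j => j.2 = true)]
      simp
    have ht := hlow' true
    have hf := hlow' false
    have hQ2 : 2 * C₀ * ∫ t in (0 : ℝ)..T, ‖expSum S w Q t‖ ^ 2
        ≤ m / 2 * ∑ j ∈ S, ‖c j‖ ^ 2 := by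
      calc _ ≤ 2 * C₀ * (M * (η ^ 2 * ∑ j ∈ S, ‖c j‖ ^ 2)) := by
            have := hup S Q
            gcongr
            exact this.trans (mul_le_mul_of_nonneg_left hQsum hM.le)
        _ = 2 * C₀ * (M * η ^ 2) * ∑ j ∈ S, ‖c j‖ ^ 2 := by ring
        _ ≤ _ := by
            gcongr
    rw [div_mul_eq_mul_div, le_div_iff₀ hm]
    rw [← hsum] at hQ2 ⊢
    nlinarith
  intro S c hc
  have h1 := main (S.filter fun j => j ∉ J) c fun j hj => (Finset.mem_filter.1 hj).2
  have hzero : ∀ (F : ℤ × Bool → ℂ → ℝ), (∀ j, F j 0 = 0) →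
      ∑ j ∈ S.filter (fun j => j ∉ J), F j (c j) = ∑ j ∈ S, F j (c j) := by
    intro F hF
    refine Finset.sum_filter_of_ne fun j _ hne hj => hne ?_
    rw [hc j hj, hF]
  have hzero' : ∀ (d : ℤ × Bool → ℂ), (∀ j, c j = 0 → d j = 0) → ∀ t,
      expSum (S.filter fun j => j ∉ J) w d t = expSum S w d t := by
    intro d hd t
    refine Finset.sum_filter_of_ne fun j _ hne hj => hne ?_
    rw [hd j (hc j hj), zero_mul]
  rw [hzero (fun _ z => ‖z‖ ^ 2) (by simp)] at h1
  have hobs : obs (S.filter fun j => j ∉ J) w σ c = obs S w σ c := by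
    funext t
    unfold obs
    rw [hzero' c (fun _ h => h), hzero' _ (fun j hj => by rw [hj, mul_zero])]
  rwa [hobs] at h1

end

theorem normSq_exp_sub_exp (x y h : ℝ) :
    ‖Complex.exp (x * h * Complex.I) - Complex.exp (y * h * Complex.I)‖ ^ 2
      = 2 - 2 * Real.cos ((x - y) * h) := by
  have e : ∀ z : ℝ, Complex.exp (z * h * Complex.I)
      = Real.cos (z * h) + Real.sin (z * h) * Complex.I := by
    intro z
    rw [← Complex.ofReal_mul, Complex.exp_mul_I, Complex.ofReal_cos, Complex.ofReal_sin]
  rw [e, e, ← Complex.normSq_eq_norm_sq, Complex.normSq_apply, sub_mul, Real.cos_sub]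
  simp only [Complex.sub_re, Complex.add_re, Complex.ofReal_re, Complex.mul_re, Complex.I_re,
    Complex.ofReal_im, Complex.I_im, Complex.sub_im, Complex.add_im, Complex.mul_im]
  have h1 := Real.sin_sq_add_cos_sq (x * h)
  have h2 := Real.sin_sq_add_cos_sq (y * h)
  linear_combination h1 + h2

theorem integral_two_sub_two_cos (ξ δ : ℝ) (hξ : ξ ≠ 0) :
    ∫ h in (0 : ℝ)..δ, (2 - 2 * Real.cos (ξ * h)) = 2 * δ - 2 * (Real.sin (ξ * δ) / ξ) := by
  rw [intervalIntegral.integral_sub, intervalIntegral.integral_const_mul,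
    intervalIntegral.integral_comp_mul_left (fun x => Real.cos x) hξ, integral_cos]
  · simp
    field_simp
  · simp
  · apply Continuous.intervalIntegrable; fun_prop

theorem integral_two_sub_two_cos_pos (ξ δ : ℝ) (hξ : ξ ≠ 0) (hδ : 0 < δ) :
    0 < ∫ h in (0 : ℝ)..δ, (2 - 2 * Real.cos (ξ * h)) := by
  rw [integral_two_sub_two_cos ξ δ hξ]
  have key : ∀ x : ℝ, 0 < x → Real.sin (x * δ) / x < δ := by
    intro x hx
    rw [div_lt_iff₀ hx]
    have := Real.sin_lt (mul_pos hx hδ)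
    linarith
  rcases lt_or_gt_of_ne hξ with h | h
  · have := key (-ξ) (by linarith)
    rw [neg_mul, Real.sin_neg, neg_div_neg_eq] at this
    linarith
  · have := key ξ h
    linarith

theorem le_integral_two_sub_two_cos (ξ δ : ℝ) (hδ : 0 < δ) (hξ : 2 / δ ≤ |ξ|) :
    δ ≤ ∫ h in (0 : ℝ)..δ, (2 - 2 * Real.cos (ξ * h)) := by
  have h0 : 0 < |ξ| := lt_of_lt_of_le (by positivity) hξ
  rw [integral_two_sub_two_cos ξ δ (abs_pos.1 h0)]
  have : Real.sin (ξ * δ) / ξ ≤ δ / 2 := by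
    refine (le_abs_self _).trans ?_
    rw [abs_div, div_le_iff₀ h0]
    rw [div_le_iff₀ hδ] at hξ
    have := Real.abs_sin_le_one (ξ * δ)
    nlinarith
  linarith

section

variable {w σ : ℤ × Bool → ℝ} {s : Bool → ℝ} {s₀ B T₀ : ℝ}

theorem IsModeFamily.finite_freq_near (h : IsModeFamily w σ s s₀ B T₀) (x R : ℝ) :
    {j | |w j - x| < R}.Finite := by
  obtain ⟨γ, hγ, K, hK⟩ := h.gap (T₀ + 1) (by linarith)
  have hT0 : 0 < T₀ + 1 := by linarith [h.time_nonneg]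
  have hγ0 : 0 < γ := by
    by_contra hcon
    push Not at hcon
    nlinarith [Real.pi_pos]
  obtain ⟨N, hN⟩ := exists_nat_gt ((R + |x - w (K, true)| + |x - w (K, false)|) / γ)
  rw [div_lt_iff₀ hγ0] at hN
  apply (((Finset.Icc (-(K + N : ℤ)) (K + N)) ×ˢ Finset.univ : Finset (ℤ × Bool)).finite_toSet).subset
  rintro ⟨k, b⟩ hk
  simp only [Set.mem_ofPred_eq] at hk
  simp only [Finset.coe_product, Set.mem_prod, Finset.mem_coe, Finset.mem_Icc, Finset.mem_univ,
    and_true]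
  by_contra hcon
  rw [← abs_le, not_le] at hcon
  have h1 := hK b k K (by linarith [Int.natCast_nonneg N])
    (le_abs_self _)
  have h2 : (N : ℝ) ≤ |(k : ℝ) - (K : ℤ)| := by
    have h3 := abs_sub_abs_le_abs_sub (k : ℝ) ((K : ℤ) : ℝ)
    have h4 : ((K + N : ℤ) : ℝ) < |(k : ℝ)| := by exact_mod_cast hcon
    have h5 : |((K : ℤ) : ℝ)| = K := by simp
    push_cast at h4 h3 h5 ⊢
    linarith
  have h6 : |w (k, b) - w (K, b)| ≤ |w (k, b) - x| + |x - w (K, b)| := abs_sub_le _ _ _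
  have h7 : |x - w (K, b)| ≤ |x - w (K, true)| + |x - w (K, false)| := by
    cases b
    · linarith [abs_nonneg (x - w (K, true))]
    · linarith [abs_nonneg (x - w (K, false))]
  have h8 := mul_le_mul_of_nonneg_left h2 hγ0.le
  linarith

theorem IsModeFamily.exists_le_integral_cos (h : IsModeFamily w σ s s₀ B T₀) (x : ℝ) {δ : ℝ}
    (hδ : 0 < δ) : ∃ κ > 0, ∀ j, w j ≠ x →
      κ ≤ ∫ h in (0 : ℝ)..δ, (2 - 2 * Real.cos ((w j - x) * h)) := by
  classical
  set F := (h.finite_freq_near x (2 / δ)).toFinset.filter fun j => w j ≠ x with hF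
  have hmem : ∀ j, w j ≠ x → j ∉ F → 2 / δ ≤ |w j - x| := by
    intro j hj hjF
    by_contra hcon
    push Not at hcon
    exact hjF (Finset.mem_filter.2 ⟨(Set.Finite.mem_toFinset _).2 hcon, hj⟩)
  rcases F.eq_empty_or_nonempty with hE | hE
  · exact ⟨δ, hδ, fun j hj => le_integral_two_sub_two_cos _ δ hδ
      (hmem j hj (by rw [hE]; exact Finset.notMem_empty j))⟩
  · obtain ⟨i, hi, hmin⟩ := F.exists_min_image
      (fun j => ∫ h in (0 : ℝ)..δ, (2 - 2 * Real.cos ((w j - x) * h))) hE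
    refine ⟨min δ (∫ h in (0 : ℝ)..δ, (2 - 2 * Real.cos ((w i - x) * h))),
      lt_min hδ (integral_two_sub_two_cos_pos _ δ (sub_ne_zero.2 (Finset.mem_filter.1 hi).2) hδ),
      fun j hj => ?_⟩
    by_cases hjF : j ∈ F
    · exact (min_le_right _ _).trans (hmin j hjF)
    · exact (min_le_left _ _).trans (le_integral_two_sub_two_cos _ δ hδ (hmem j hj hjF))

/-- The inverse inequality on `(0, T)` for sums without the modes in `J`. -/
def InverseIneq (w σ : ℤ × Bool → ℝ) (J : Finset (ℤ × Bool)) (T : ℝ) : Prop :=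
  ∃ C > 0, ∀ (S : Finset (ℤ × Bool)) (c : ℤ × Bool → ℂ),
    (∀ j ∈ J, c j = 0) → ∑ j ∈ S, ‖c j‖ ^ 2 ≤ C * ∫ t in (0 : ℝ)..T, obs S w σ c t

theorem integral_obs_translate_le {ι : Type*} (S : Finset ι) (w σ : ι → ℝ) (c : ι → ℂ) (x : ℝ)
    {T δ h : ℝ} (hT : 0 ≤ T) (hh : 0 ≤ h) (hhδ : h ≤ δ) :
    ∫ t in (0 : ℝ)..T, obs S w σ
      (fun i => c i * (Complex.exp (w i * h * Complex.I) - Complex.exp (x * h * Complex.I))) t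
      ≤ 4 * ∫ t in (0 : ℝ)..(T + δ), obs S w σ c t := by
  have hpt : ∀ t, obs S w σ
      (fun i => c i * (Complex.exp (w i * h * Complex.I) - Complex.exp (x * h * Complex.I))) t
      ≤ 2 * obs S w σ c (t + h) + 2 * obs S w σ c t := by
    intro t
    have e := obs_sub_le S w σ (fun i => c i * Complex.exp (w i * h * Complex.I))
      (fun i => Complex.exp (x * h * Complex.I) * c i) t
    have e1 : obs S w σ (fun i => c i * Complex.exp (w i * h * Complex.I)) t
        = obs S w σ c (t + h) := by
      unfold obs
      rw [expSum_add, expSum_add]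
      simp only [mul_assoc]
    have e2 : obs S w σ (fun i => Complex.exp (x * h * Complex.I) * c i) t = obs S w σ c t := by
      unfold obs
      simp only [mul_left_comm _ (Complex.exp (x * h * Complex.I)), expSum_const_mul, norm_mul,
        norm_exp_freq, one_mul]
    rw [e1, e2] at e
    convert e using 3
    ring
  have hnn : ∀ (a b : ℝ), 0 ≤ a → a ≤ b → b ≤ T + δ →
      ∫ t in a..b, obs S w σ c t ≤ ∫ t in (0 : ℝ)..(T + δ), obs S w σ c t := by
    intro a b ha hab hb
    apply intervalIntegral.integral_mono_interval ha hab hb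
    · exact Eventually.of_forall fun t => obs_nonneg S w σ c t
    · apply Continuous.intervalIntegrable; fun_prop
  calc _ ≤ ∫ t in (0 : ℝ)..T, (2 * obs S w σ c (t + h) + 2 * obs S w σ c t) := by
        apply intervalIntegral.integral_mono_on hT
        · apply Continuous.intervalIntegrable; fun_prop
        · apply Continuous.intervalIntegrable; fun_prop
        · exact fun t _ => hpt t
    _ = 2 * (∫ t in (0 + h)..(T + h), obs S w σ c t) + 2 * ∫ t in (0 : ℝ)..T, obs S w σ c t := by
        rw [intervalIntegral.integral_add, intervalIntegral.integral_const_mul,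
          intervalIntegral.integral_const_mul,
          intervalIntegral.integral_comp_add_right (fun t => obs S w σ c t)]
        · apply Continuous.intervalIntegrable; fun_prop
        · apply Continuous.intervalIntegrable; fun_prop
    _ ≤ _ := by
        have h1 := hnn (0 + h) (T + h) (by linarith) (by linarith) (by linarith)
        have h2 := hnn 0 T le_rfl hT (by linarith)
        linarith

/-- Adding one mode to the inverse inequality, at the price of an arbitrarily small extension of
the time interval. -/
theorem IsModeFamily.inverseIneq_of_insert (h : IsModeFamily w σ s s₀ B T₀)
    {J : Finset (ℤ × Bool)} {j : ℤ × Bool} {T δ : ℝ} (hT : T₀ < T) (hδ : 0 < δ)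
    (hJ : InverseIneq w σ (insert j J) T) : InverseIneq w σ J (T + δ) := by
  classical
  have hT0 : 0 < T := h.time_nonneg.trans_lt hT
  have hs₀ := h.pos
  obtain ⟨C, hC, hinv⟩ := hJ
  obtain ⟨M, hM, hup⟩ := h.exists_obs_le (T := T + δ) (by linarith)
  obtain ⟨κ, hκ, hcos⟩ := h.exists_le_integral_cos (w j) hδ
  set C₀ := (1 + B ^ 2) / s₀ ^ 2 with hC₀
  have hC₀pos : 0 < C₀ := by positivity
  set C₁ := C * (4 * δ) / κ with hC₁
  have hC₁pos : 0 < C₁ := by positivity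
  refine ⟨C₁ + C₀ * (2 + 2 * M * C₁) / (T + δ), by positivity, fun S c hc => ?_⟩
  set X := ∫ t in (0 : ℝ)..(T + δ), obs S w σ c t with hX
  set c₀ : ℤ × Bool → ℂ := fun i => if w i = w j then 0 else c i with hc₀
  -- the modes with another frequency
  have hoff : ∑ i ∈ S, ‖c₀ i‖ ^ 2 ≤ C₁ * X := by
    have hpt : ∀ θ ∈ Set.Icc (0 : ℝ) δ,
        ∑ i ∈ S, ‖c i‖ ^ 2 * (2 - 2 * Real.cos ((w i - w j) * θ)) ≤ C * (4 * X) := by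
      intro θ hθ
      have h1 := hinv S (fun i => c i *
        (Complex.exp (w i * θ * Complex.I) - Complex.exp (w j * θ * Complex.I))) (by
          intro i hi
          rcases Finset.mem_insert.1 hi with rfl | hi
          · simp
          · simp [hc i hi])
      simp only [norm_mul, mul_pow, normSq_exp_sub_exp] at h1
      refine h1.trans ?_
      gcongr
      exact integral_obs_translate_le S w σ c (w j) hT0.le hθ.1 hθ.2
    have hint := intervalIntegral.integral_mono_on (μ := volume) hδ.le
      (by apply Continuous.intervalIntegrable; fun_prop)
      (by apply Continuous.intervalIntegrable; fun_prop) hpt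
    rw [intervalIntegral.integral_finsetSum] at hint
    · simp only [intervalIntegral.integral_const_mul, intervalIntegral.integral_const, sub_zero,
        smul_eq_mul] at hint
      have hle : κ * ∑ i ∈ S, ‖c₀ i‖ ^ 2 ≤ C * (4 * (δ * X)) := by
        refine le_trans ?_ hint
        rw [Finset.mul_sum]
        refine Finset.sum_le_sum fun i _ => ?_
        by_cases hi : w i = w j
        · simp only [hc₀, if_pos hi, norm_zero]
          rw [hi]
          simp
        · simp only [hc₀, if_neg hi]
          rw [mul_comm]
          exact mul_le_mul_of_nonneg_left (hcos i hi) (sq_nonneg _)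
      rw [hC₁, div_mul_eq_mul_div, le_div_iff₀ hκ]
      linarith
    · intro i _
      apply Continuous.intervalIntegrable; fun_prop
  -- the modes with the frequency of `j`
  have hon : (T + δ) * ∑ i ∈ S.filter (fun i => w i = w j), ‖c i‖ ^ 2
      ≤ C₀ * (2 * X + 2 * (M * (C₁ * X))) := by
    have hsum : ∀ (a : ℤ × Bool → ℂ) t, expSum S w (fun i => a i * (c i - c₀ i)) t
        = (∑ i ∈ S.filter (fun i => w i = w j), a i * c i) * Complex.exp (w j * t * Complex.I) := by
      intro a t
      rw [expSum, Finset.sum_mul, Finset.sum_filter]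
      refine Finset.sum_congr rfl fun i _ => ?_
      by_cases hi : w i = w j
      · simp only [hc₀, if_pos hi, sub_zero]
        rw [hi]
      · simp only [hc₀, if_neg hi, sub_self, mul_zero, zero_mul]
    have hobs : ∀ t, obs S w σ (fun i => c i - c₀ i) t
        = ‖∑ i ∈ S.filter (fun i => w i = w j), c i‖ ^ 2
          + ‖∑ i ∈ S.filter (fun i => w i = w j), (σ i : ℂ) * c i‖ ^ 2 := by
      intro t
      have h1 := hsum (fun _ => 1) t
      have h2 := hsum (fun i => (σ i : ℂ)) t
      simp only [one_mul] at h1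
      unfold obs
      rw [h1, h2, norm_mul, norm_mul, norm_exp_freq, mul_one, mul_one]
    have hle : ∫ t in (0 : ℝ)..(T + δ), obs S w σ (fun i => c i - c₀ i) t
        ≤ 2 * X + 2 * ∫ t in (0 : ℝ)..(T + δ), obs S w σ c₀ t := by
      rw [hX, ← intervalIntegral.integral_const_mul, ← intervalIntegral.integral_const_mul,
        ← intervalIntegral.integral_add]
      · apply intervalIntegral.integral_mono_on (by linarith)
        · apply Continuous.intervalIntegrable; fun_prop
        · apply Continuous.intervalIntegrable; fun_prop
        · exact fun t _ => obs_sub_le S w σ c c₀ t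
      all_goals apply Continuous.intervalIntegrable; fun_prop
    simp only [hobs, intervalIntegral.integral_const, sub_zero, smul_eq_mul] at hle
    have h1 := h.sum_norm_sq_le_of_freq_eq (S.filter fun i => w i = w j) (w j)
      (fun i hi => (Finset.mem_filter.1 hi).2) c
    have h2 := (hup S c₀).trans (mul_le_mul_of_nonneg_left hoff hM.le)
    refine (mul_le_mul_of_nonneg_left h1 (by linarith)).trans ?_
    rw [← hC₀, mul_left_comm]
    exact mul_le_mul_of_nonneg_left (by linarith) hC₀pos.le
  have htot : ∑ i ∈ S, ‖c i‖ ^ 2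
      = ∑ i ∈ S, ‖c₀ i‖ ^ 2 + ∑ i ∈ S.filter (fun i => w i = w j), ‖c i‖ ^ 2 := by
    rw [Finset.sum_filter, ← Finset.sum_add_distrib]
    refine Finset.sum_congr rfl fun i _ => ?_
    by_cases hi : w i = w j
    · simp [hc₀, if_pos hi]
    · simp [hc₀, if_neg hi]
  have hTδ : 0 < T + δ := by linarith
  have h3 : ∑ i ∈ S.filter (fun i => w i = w j), ‖c i‖ ^ 2
      ≤ C₀ * (2 + 2 * M * C₁) / (T + δ) * X := by
    rw [div_mul_eq_mul_div, le_div_iff₀ hTδ]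
    linarith
  rw [htot]
  linarith

/-- The inverse inequality for the vector valued sums. -/
theorem IsModeFamily.inverseIneq (h : IsModeFamily w σ s s₀ B T₀) {T : ℝ} (hT : T₀ < T) :
    InverseIneq w σ ∅ T := by
  classical
  have step : ∀ J : Finset (ℤ × Bool), ∀ T' T, T₀ < T' → T' < T → InverseIneq w σ J T' →
      InverseIneq w σ ∅ T := by
    intro J
    induction J using Finset.induction_on with
    | empty =>
      rintro T' T hT' hTT ⟨C, hC, hinv⟩
      refine ⟨C, hC, fun S c hc => (hinv S c hc).trans ?_⟩
      gcongr
      apply intervalIntegral.integral_mono_interval le_rfl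
        (h.time_nonneg.trans hT'.le) hTT.le
      · exact Eventually.of_forall fun t => obs_nonneg S w σ c t
      · apply Continuous.intervalIntegrable; fun_prop
    | insert j J hj ih =>
      intro T' T hT' hTT hJ
      refine ih (T' + (T - T') / 2) T (by linarith) (by linarith) ?_
      exact h.inverseIneq_of_insert hT' (by linarith) hJ
  obtain ⟨J, C, hC, hJ⟩ := h.exists_tail_le (T := (T₀ + T) / 2) (by linarith)
  exact step J ((T₀ + T) / 2) T (by linarith) (by linarith) ⟨C, hC, hJ⟩

end

theorem abs_sqrt_add_sq_sub_le {A : ℝ} (hA : 0 < A) (x y : ℝ) :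
    |Real.sqrt (A + x ^ 2) - Real.sqrt (A + y ^ 2)| ≤ |x - y| := by
  have hx := Real.sq_sqrt (by positivity : 0 ≤ A + x ^ 2)
  have hy := Real.sq_sqrt (by positivity : 0 ≤ A + y ^ 2)
  have hx0 : |x| ≤ Real.sqrt (A + x ^ 2) := Real.abs_le_sqrt (by linarith)
  have hy0 : |y| ≤ Real.sqrt (A + y ^ 2) := Real.abs_le_sqrt (by linarith)
  have hpos : 0 < Real.sqrt (A + x ^ 2) + Real.sqrt (A + y ^ 2) := by positivity
  have e : |Real.sqrt (A + x ^ 2) - Real.sqrt (A + y ^ 2)|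
      * (Real.sqrt (A + x ^ 2) + Real.sqrt (A + y ^ 2)) = |x - y| * |x + y| := by
    rw [← abs_of_pos hpos, ← abs_mul, ← abs_mul]
    congr 1
    linear_combination hx - hy
  refine le_of_mul_le_mul_right ?_ hpos
  rw [e]
  gcongr
  exact (abs_add_le x y).trans (add_le_add hx0 hy0)

/-- The square root in the eigenvalues, as a function of `z = 1 / k²`. -/
noncomputable def eigRoot (a c d r z : ℝ) : ℝ := Real.sqrt (4 * a * c * d + (c - 1 + r * z) ^ 2)

/-- The slope `σ` of the eigenvector `(1, σ)`, as a function of `z = 1 / k²`. -/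
noncomputable def slopeFun (a c d r z : ℝ) (b : Bool) : ℝ :=
  (-(c - 1 + r * z) + (if b then 1 else -1) * eigRoot a c d r z) / (2 * d)

/-- The slope of the eigenvector `(1, σ)` of the mode `(k, b)`. -/
noncomputable def slope (a c d r : ℝ) (j : ℤ × Bool) : ℝ := slopeFun a c d r (1 / (j.1 : ℝ) ^ 2) j.2

/-- The frequency of the mode `(k, b)`. -/
noncomputable def freq (a c d r : ℝ) (j : ℤ × Bool) : ℝ :=
  if j.2 then omegaPlus a c d r j.1 else omegaMinus a c d r j.1

section

variable {a c d r : ℝ}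

theorem slopeFun_quadratic (ha : 0 < a) (hc : 0 < c) (hd : 0 < d) (z : ℝ) (b : Bool) :
    d * slopeFun a c d r z b ^ 2 + (c - 1 + r * z) * slopeFun a c d r z b - a * c = 0 := by
  have h : eigRoot a c d r z ^ 2 = 4 * a * c * d + (c - 1 + r * z) ^ 2 :=
    Real.sq_sqrt (by positivity)
  unfold slopeFun
  cases b <;> simp only [if_true, if_false, Bool.false_eq_true] <;> field_simp <;>
    linear_combination h

theorem freq_eq (hc : 0 < c) (hd : 0 < d) (j : ℤ × Bool) :
    freq a c d r j = (j.1 : ℝ) ^ 3 * (1 + d / c * slope a c d r j) := by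
  rcases j with ⟨k, b⟩
  rcases eq_or_ne k 0 with rfl | hk
  · cases b <;> simp [freq, omegaPlus, omegaMinus]
  · have hk' : (k : ℝ) ≠ 0 := by exact_mod_cast hk
    have hroot : Real.sqrt (4 * a * c * d * (k : ℝ) ^ 4 + ((c - 1) * (k : ℝ) ^ 2 + r) ^ 2)
        = (k : ℝ) ^ 2 * eigRoot a c d r (1 / (k : ℝ) ^ 2) := by
      have e : 4 * a * c * d * (k : ℝ) ^ 4 + ((c - 1) * (k : ℝ) ^ 2 + r) ^ 2
          = ((k : ℝ) ^ 2) ^ 2 * (4 * a * c * d + (c - 1 + r * (1 / (k : ℝ) ^ 2)) ^ 2) := by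
        field_simp
      rw [e, Real.sqrt_mul (by positivity), Real.sqrt_sq (by positivity), eigRoot]
    cases b
    · simp only [freq, omegaMinus, slope, slopeFun, hroot, if_false, Bool.false_eq_true]
      field_simp
      ring
    · simp only [freq, omegaPlus, slope, slopeFun, hroot, if_true]
      field_simp
      ring

theorem inv_sq_mem (k : ℤ) : 0 ≤ 1 / (k : ℝ) ^ 2 ∧ 1 / (k : ℝ) ^ 2 ≤ 1 := by
  refine ⟨by positivity, ?_⟩
  rcases eq_or_ne k 0 with rfl | hk
  · simp
  · have h1 : (1 : ℝ) ≤ |(k : ℝ)| := by exact_mod_cast Int.one_le_abs hk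
    have h2 : 1 ≤ (k : ℝ) ^ 2 := by rw [← sq_abs]; nlinarith
    exact (div_le_one (by positivity)).2 h2

theorem abs_slopeFun_sub_le (ha : 0 < a) (hc : 0 < c) (hd : 0 < d) (hr : 0 < r) (y z : ℝ)
    (b : Bool) : |slopeFun a c d r y b - slopeFun a c d r z b| ≤ r / d * |y - z| := by
  have h := abs_sqrt_add_sq_sub_le (by positivity : 0 < 4 * a * c * d) (c - 1 + r * y)
    (c - 1 + r * z)
  have e : |(c - 1 + r * y) - (c - 1 + r * z)| = r * |y - z| := by
    rw [← abs_of_pos hr, ← abs_mul, abs_of_pos hr]; congr 1; ring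
  rw [e] at h
  have key : |(-(c - 1 + r * y) + (if b then 1 else -1) * eigRoot a c d r y)
      - (-(c - 1 + r * z) + (if b then 1 else -1) * eigRoot a c d r z)| ≤ 2 * (r * |y - z|) := by
    have e2 : (-(c - 1 + r * y) + (if b then 1 else -1) * eigRoot a c d r y)
      - (-(c - 1 + r * z) + (if b then 1 else -1) * eigRoot a c d r z)
      = -((c - 1 + r * y) - (c - 1 + r * z))
        + (if b then 1 else -1) * (eigRoot a c d r y - eigRoot a c d r z) := by ring
    rw [e2]
    refine (abs_add_le _ _).trans ?_
    rw [abs_neg, e, abs_mul]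
    have : |(if b then (1 : ℝ) else -1)| = 1 := by cases b <;> simp
    rw [this, one_mul]
    unfold eigRoot
    linarith
  unfold slopeFun
  rw [← sub_div, abs_div, abs_of_pos (by positivity : 0 < 2 * d), div_le_iff₀ (by positivity)]
  refine key.trans (le_of_eq ?_)
  field_simp

theorem slopeFun_bounds (ha : 0 < a) (hc : 0 < c) (hd : 0 < d) (hr : 0 < r) :
    ∃ s₀ B : ℝ, 0 < s₀ ∧ ∀ z, 0 ≤ z → z ≤ 1 → s₀ ≤ slopeFun a c d r z true ∧
      slopeFun a c d r z false ≤ -s₀ ∧ ∀ b, |slopeFun a c d r z b| ≤ B := by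
  set X₁ := |c - 1| + r with hX₁
  set R₁ := Real.sqrt (4 * a * c * d + X₁ ^ 2) with hR₁
  have hA : 0 < 4 * a * c * d := by positivity
  have hR₁0 : 0 < R₁ := Real.sqrt_pos.2 (by positivity)
  have hX₁0 : 0 < X₁ := by positivity
  refine ⟨4 * a * c * d / (R₁ + X₁) / (2 * d), (R₁ + X₁) / (2 * d), by positivity, ?_⟩
  intro z hz0 hz1
  have hX : |c - 1 + r * z| ≤ X₁ := by
    refine (abs_add_le _ _).trans ?_
    rw [abs_of_nonneg (by positivity : 0 ≤ r * z)]
    have : r * z ≤ r * 1 := by gcongr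
    linarith
  have hR : eigRoot a c d r z ≤ R₁ := by
    apply Real.sqrt_le_sqrt
    rw [← sq_abs (c - 1 + r * z)]
    gcongr
  have hRX : |c - 1 + r * z| ≤ eigRoot a c d r z := Real.abs_le_sqrt (by linarith)
  have hsq : eigRoot a c d r z ^ 2 = 4 * a * c * d + |c - 1 + r * z| ^ 2 := by
    rw [sq_abs]; exact Real.sq_sqrt (by positivity)
  have hR0 : 0 < eigRoot a c d r z := Real.sqrt_pos.2 (by positivity)
  have hlow : 4 * a * c * d / (R₁ + X₁) ≤ eigRoot a c d r z - |c - 1 + r * z| := by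
    rw [div_le_iff₀ (by positivity)]
    calc 4 * a * c * d = (eigRoot a c d r z - |c - 1 + r * z|)
          * (eigRoot a c d r z + |c - 1 + r * z|) := by linarith
      _ ≤ _ := by
        apply mul_le_mul_of_nonneg_left _ (by linarith)
        linarith
  have h1 := le_abs_self (c - 1 + r * z)
  have h2 := neg_abs_le (c - 1 + r * z)
  refine ⟨?_, ?_, ?_⟩
  · simp only [slopeFun, if_true]
    gcongr
    linarith
  · simp only [slopeFun, if_false, Bool.false_eq_true]
    rw [← neg_div]
    gcongr
    linarith
  · intro b
    rw [slopeFun, abs_div, abs_of_pos (by positivity : 0 < 2 * d)]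
    gcongr
    refine (abs_add_le _ _).trans ?_
    rw [abs_neg, abs_mul]
    have : |(if b then (1 : ℝ) else -1)| = 1 := by cases b <;> simp
    rw [this, one_mul, abs_of_pos hR0]
    linarith

theorem tendsto_inv_sq_cofinite : Tendsto (fun k : ℤ => 1 / (k : ℝ) ^ 2) cofinite (𝓝 0) := by
  have h1 : Tendsto (fun k : ℤ => |(k : ℝ)|) cofinite atTop := by
    have := Int.tendsto_coe_cofinite
    exact (tendsto_norm_cocompact_atTop (E := ℝ)).comp this
  have h2 := (tendsto_pow_atTop (two_ne_zero)).comp h1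
  have h3 := tendsto_inv_atTop_zero.comp h2
  refine h3.congr fun k => ?_
  simp

theorem tendsto_slope (ha : 0 < a) (hc : 0 < c) (hd : 0 < d) (hr : 0 < r) (b : Bool) :
    Tendsto (fun k : ℤ => slope a c d r (k, b)) cofinite (𝓝 (slopeFun a c d r 0 b)) := by
  rw [tendsto_iff_norm_sub_tendsto_zero]
  have h := (tendsto_inv_sq_cofinite.abs).const_mul (r / d)
  rw [abs_zero, mul_zero] at h
  refine squeeze_zero (fun k => norm_nonneg _) (fun k => ?_) h
  have := abs_slopeFun_sub_le ha hc hd hr (1 / (k : ℝ) ^ 2) 0 b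
  rwa [sub_zero] at this

theorem exists_nat_of_eventually_cofinite {p : ℤ → Prop} (h : ∀ᶠ k in cofinite, p k) :
    ∃ K : ℕ, ∀ k : ℤ, (K : ℤ) ≤ |k| → p k := by
  have hf := Filter.eventually_cofinite.1 h
  obtain ⟨K, hK⟩ := (hf.image Int.natAbs).bddAbove
  refine ⟨K + 1, fun k hk => ?_⟩
  by_contra hcon
  have : k.natAbs ≤ K := hK ⟨k, hcon, rfl⟩
  have := Int.natCast_natAbs k
  omega

theorem abs_inv_sq_sub {x y : ℝ} (hx : x ≠ 0) (hy : y ≠ 0) :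
    |1 / x ^ 2 - 1 / y ^ 2| = |x - y| * |x + y| / (x ^ 2 * y ^ 2) := by
  rw [← abs_mul, ← abs_of_pos (by positivity : 0 < x ^ 2 * y ^ 2), ← abs_div,
    ← abs_neg]
  congr 1
  field_simp
  ring

/-- `f k = k³ m k` with `m` tending to a nonzero limit and Lipschitz in `1 / k²` has a gap tending
to infinity. -/
theorem gap_of_cubic {f m : ℤ → ℝ} {m₀ L : ℝ} (hf : ∀ k, f k = (k : ℝ) ^ 3 * m k) (hm₀ : m₀ ≠ 0)
    (hlim : Tendsto m cofinite (𝓝 m₀))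
    (hL : ∀ k n : ℤ, |m k - m n| ≤ L * |1 / (k : ℝ) ^ 2 - 1 / (n : ℝ) ^ 2|) (γ : ℝ) :
    ∃ K : ℕ, ∀ k n : ℤ, (K : ℤ) ≤ |k| → (K : ℤ) ≤ |n| → γ * |(k : ℝ) - n| ≤ |f k - f n| := by
  have hL0 : 0 ≤ L := by
    have := (abs_nonneg _).trans (hL 1 0)
    norm_num at this
    exact this
  have hev : ∀ᶠ k in cofinite, |m₀| / 2 ≤ |m k| :=
    (hlim.abs).eventually (eventually_ge_nhds (by have := abs_pos.2 hm₀; linarith))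
  obtain ⟨K₁, hK₁⟩ := exists_nat_of_eventually_cofinite hev
  have hm₀' := abs_pos.2 hm₀
  obtain ⟨K₂, hK₂⟩ := exists_nat_gt ((|γ| + 2 * L) / (3 / 8 * |m₀|))
  have main : ∀ k n : ℤ, ((max K₁ K₂ + 1 : ℕ) : ℤ) ≤ |k| → ((max K₁ K₂ + 1 : ℕ) : ℤ) ≤ |n| →
      |n| ≤ |k| → γ * |(k : ℝ) - n| ≤ |f k - f n| := by
    intro k n hk hn hnk
    have hk1 : (K₁ : ℤ) ≤ |k| := by push_cast at hk; omega
    have hk2 : (K₂ : ℤ) ≤ |k| := by push_cast at hk; omega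
    have hk0 : (k : ℝ) ≠ 0 := by
      have : k ≠ 0 := by rintro rfl; simp at hk; omega
      exact_mod_cast this
    have hn0 : (n : ℝ) ≠ 0 := by
      have : n ≠ 0 := by rintro rfl; simp at hn; omega
      exact_mod_cast this
    have hnk' : |(n : ℝ)| ≤ |(k : ℝ)| := by exact_mod_cast hnk
    have hk2' : (K₂ : ℝ) ≤ |(k : ℝ)| := by exact_mod_cast hk2
    have hk1' : 1 ≤ |(k : ℝ)| := by
      have : 1 ≤ |k| := by push_cast at hk; omega
      exact_mod_cast this
    have e : f k - f n = ((k : ℝ) - n) * ((k : ℝ) ^ 2 + k * n + (n : ℝ) ^ 2) * m k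
        + (n : ℝ) ^ 3 * (m k - m n) := by rw [hf, hf]; ring
    have h1 : |((k : ℝ) - n) * ((k : ℝ) ^ 2 + k * n + (n : ℝ) ^ 2) * m k|
        ≥ |(k : ℝ) - n| * (3 / 4 * |(k : ℝ)| * (|m₀| / 2)) := by
      rw [abs_mul, abs_mul, mul_assoc]
      have hq : 3 / 4 * |(k : ℝ)| ≤ |(k : ℝ) ^ 2 + k * n + (n : ℝ) ^ 2| := by
        refine le_trans ?_ (le_abs_self _)
        have : |(k : ℝ)| ≤ (k : ℝ) ^ 2 := by rw [← sq_abs]; nlinarith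
        nlinarith [sq_nonneg ((k : ℝ) / 2 + n)]
      have := hK₁ k hk1
      gcongr
    have h2 : |(n : ℝ) ^ 3 * (m k - m n)| ≤ |(k : ℝ) - n| * (2 * L) := by
      rw [abs_mul]
      have h3 := hL k n
      rw [abs_inv_sq_sub hk0 hn0] at h3
      have hsum : |(k : ℝ) + n| ≤ 2 * |(k : ℝ)| := (abs_add_le _ _).trans (by linarith)
      have hn' := abs_pos.2 hn0
      have hk' := abs_pos.2 hk0
      calc |(n : ℝ) ^ 3| * |m k - m n|
          ≤ |(n : ℝ) ^ 3| * (L * (|(k : ℝ) - n| * |(k : ℝ) + n| / ((k : ℝ) ^ 2 * (n : ℝ) ^ 2))) := by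
            gcongr
        _ = |(k : ℝ) - n| * (L * (|(n : ℝ)| * |(k : ℝ) + n| / |(k : ℝ)| ^ 2)) := by
            rw [abs_pow, ← sq_abs (k : ℝ), ← sq_abs (n : ℝ)]
            field_simp
        _ ≤ |(k : ℝ) - n| * (L * (|(k : ℝ)| * (2 * |(k : ℝ)|) / |(k : ℝ)| ^ 2)) := by gcongr
        _ = _ := by field_simp
    have h4 : |γ| + 2 * L ≤ 3 / 8 * |m₀| * |(k : ℝ)| := by
      rw [div_lt_iff₀ (by positivity)] at hK₂
      have : (K₂ : ℝ) * (3 / 8 * |m₀|) ≤ |(k : ℝ)| * (3 / 8 * |m₀|) := by gcongr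
      linarith
    have h5 : |((k : ℝ) - n) * ((k : ℝ) ^ 2 + k * n + (n : ℝ) ^ 2) * m k|
        - |(n : ℝ) ^ 3 * (m k - m n)| ≤ |f k - f n| := by
      rw [e]
      have := abs_sub_abs_le_abs_sub (((k : ℝ) - n) * ((k : ℝ) ^ 2 + k * n + (n : ℝ) ^ 2) * m k)
        (-((n : ℝ) ^ 3 * (m k - m n)))
      rwa [abs_neg, sub_neg_eq_add] at this
    have h6 := mul_le_mul_of_nonneg_left h4 (abs_nonneg ((k : ℝ) - n))
    have h7 := mul_le_mul_of_nonneg_left (le_abs_self γ) (abs_nonneg ((k : ℝ) - n))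
    nlinarith
  refine ⟨max K₁ K₂ + 1, fun k n hk hn => ?_⟩
  rcases le_total |n| |k| with h | h
  · exact main k n hk hn h
  · rw [abs_sub_comm, abs_sub_comm (f k)]
    exact main n k hn hk h

/-- `f k = k m k` with `m` tending to `m₀` and Lipschitz in `1 / k²` has asymptotically any gap
less than `|m₀|`. -/
theorem gap_of_linear {f m : ℤ → ℝ} {m₀ L γ : ℝ} (hf : ∀ k, k ≠ 0 → f k = (k : ℝ) * m k)
    (hm₀ : γ < |m₀|) (hlim : Tendsto m cofinite (𝓝 m₀)) (hL0 : 0 ≤ L)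
    (hL : ∀ k n : ℤ, k ≠ 0 → n ≠ 0 → |m k - m n| ≤ L * |1 / (k : ℝ) ^ 2 - 1 / (n : ℝ) ^ 2|) :
    ∃ K : ℕ, ∀ k n : ℤ, (K : ℤ) ≤ |k| → (K : ℤ) ≤ |n| → γ * |(k : ℝ) - n| ≤ |f k - f n| := by
  obtain ⟨γ', hγ', hγ'm⟩ := exists_between hm₀
  have hev : ∀ᶠ k in cofinite, γ' ≤ |m k| :=
    (hlim.abs).eventually (eventually_ge_nhds hγ'm)
  obtain ⟨K₁, hK₁⟩ := exists_nat_of_eventually_cofinite hev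
  obtain ⟨K₂, hK₂⟩ := exists_nat_gt (2 * L / (γ' - γ))
  have main : ∀ k n : ℤ, ((max K₁ K₂ + 1 : ℕ) : ℤ) ≤ |k| → ((max K₁ K₂ + 1 : ℕ) : ℤ) ≤ |n| →
      |n| ≤ |k| → γ * |(k : ℝ) - n| ≤ |f k - f n| := by
    intro k n hk hn hnk
    have hk1 : (K₁ : ℤ) ≤ |k| := by push_cast at hk; omega
    have hn2 : (K₂ : ℤ) ≤ |n| := by push_cast at hn; omega
    have hkz : k ≠ 0 := by rintro rfl; simp at hk; omega
    have hnz : n ≠ 0 := by rintro rfl; simp at hn; omega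
    have hk0 : (k : ℝ) ≠ 0 := by exact_mod_cast hkz
    have hn0 : (n : ℝ) ≠ 0 := by exact_mod_cast hnz
    have hnk' : |(n : ℝ)| ≤ |(k : ℝ)| := by exact_mod_cast hnk
    have hn2' : (K₂ : ℝ) ≤ |(n : ℝ)| := by exact_mod_cast hn2
    have hk1' : 1 ≤ |(k : ℝ)| := by exact_mod_cast Int.one_le_abs hkz
    have hn' := abs_pos.2 hn0
    have hk' := abs_pos.2 hk0
    have e : f k - f n = ((k : ℝ) - n) * m k + (n : ℝ) * (m k - m n) := by
      rw [hf k hkz, hf n hnz]; ring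
    have h1 : |((k : ℝ) - n) * m k| ≥ |(k : ℝ) - n| * γ' := by
      rw [abs_mul]
      have := hK₁ k hk1
      gcongr
    have h2 : |(n : ℝ) * (m k - m n)| ≤ |(k : ℝ) - n| * (γ' - γ) := by
      rw [abs_mul]
      have h3 := hL k n hkz hnz
      rw [abs_inv_sq_sub hk0 hn0] at h3
      have hsum : |(k : ℝ) + n| ≤ 2 * |(k : ℝ)| := (abs_add_le _ _).trans (by linarith)
      calc |(n : ℝ)| * |m k - m n|
          ≤ |(n : ℝ)| * (L * (|(k : ℝ) - n| * |(k : ℝ) + n| / ((k : ℝ) ^ 2 * (n : ℝ) ^ 2))) := by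
            gcongr
        _ = |(k : ℝ) - n| * (L * (|(k : ℝ) + n| / (|(k : ℝ)| ^ 2 * |(n : ℝ)|))) := by
            rw [← sq_abs (k : ℝ), ← sq_abs (n : ℝ)]
            field_simp
        _ ≤ |(k : ℝ) - n| * (L * (2 * |(k : ℝ)| / (|(k : ℝ)| ^ 2 * |(n : ℝ)|))) := by gcongr
        _ = |(k : ℝ) - n| * (2 * L / (|(k : ℝ)| * |(n : ℝ)|)) := by field_simp
        _ ≤ |(k : ℝ) - n| * (2 * L / (1 * |(n : ℝ)|)) := by gcongr
        _ ≤ _ := by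
            gcongr
            rw [one_mul, div_le_iff₀ hn']
            rw [div_lt_iff₀ (by linarith)] at hK₂
            have : (K₂ : ℝ) * (γ' - γ) ≤ |(n : ℝ)| * (γ' - γ) :=
              mul_le_mul_of_nonneg_right hn2' (by linarith)
            linarith
    have h5 : |((k : ℝ) - n) * m k| - |(n : ℝ) * (m k - m n)| ≤ |f k - f n| := by
      rw [e]
      have := abs_sub_abs_le_abs_sub (((k : ℝ) - n) * m k) (-((n : ℝ) * (m k - m n)))
      rwa [abs_neg, sub_neg_eq_add] at this
    nlinarith
  refine ⟨max K₁ K₂ + 1, fun k n hk hn => ?_⟩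
  rcases le_total |n| |k| with h | h
  · exact main k n hk hn h
  · rw [abs_sub_comm, abs_sub_comm (f k)]
    exact main n k hn hk h

theorem gap_freq_cubic (ha : 0 < a) (hc : 0 < c) (hd : 0 < d) (hr : 0 < r) (b : Bool)
    (h : 1 + d / c * slopeFun a c d r 0 b ≠ 0) (γ : ℝ) :
    ∃ K : ℕ, ∀ k n : ℤ, (K : ℤ) ≤ |k| → (K : ℤ) ≤ |n| →
      γ * |(k : ℝ) - n| ≤ |freq a c d r (k, b) - freq a c d r (n, b)| := by
  refine gap_of_cubic (m := fun k => 1 + d / c * slope a c d r (k, b)) (L := r / c)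
    (fun k => freq_eq hc hd (k, b)) h
    (((tendsto_slope ha hc hd hr b).const_mul (d / c)).const_add 1) (fun k n => ?_) γ
  have := abs_slopeFun_sub_le ha hc hd hr (1 / (k : ℝ) ^ 2) (1 / (n : ℝ) ^ 2) b
  rw [add_sub_add_left_eq_sub, ← mul_sub, abs_mul, abs_of_pos (by positivity : 0 < d / c)]
  calc _ ≤ d / c * (r / d * |1 / (k : ℝ) ^ 2 - 1 / (n : ℝ) ^ 2|) := by
        gcongr; exact this
    _ = _ := by field_simp

theorem gap_freq_linear (ha : 0 < a) (hc : 0 < c) (hd : 0 < d) (hr : 0 < r) (had : a * d = 1)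
    {γ : ℝ} (hγ : γ < r / (c + 1)) :
    ∃ K : ℕ, ∀ k n : ℤ, (K : ℤ) ≤ |k| → (K : ℤ) ≤ |n| →
      γ * |(k : ℝ) - n| ≤ |freq a c d r (k, false) - freq a c d r (n, false)| := by
  set D : ℝ → ℝ := fun z => c + 1 - r * z + eigRoot a c d r z with hD
  have hDlow : ∀ z, 2 * c ≤ D z := by
    intro z
    have : c - 1 + r * z ≤ eigRoot a c d r z :=
      (le_abs_self _).trans (Real.abs_le_sqrt (by linarith [(by positivity : 0 < 4 * a * c * d)]))
    simp only [hD]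
    linarith
  have hDlip : ∀ y z, |D y - D z| ≤ 2 * r * |y - z| := by
    intro y z
    have h := abs_sqrt_add_sq_sub_le (by positivity : 0 < 4 * a * c * d) (c - 1 + r * y)
      (c - 1 + r * z)
    have e : |(c - 1 + r * y) - (c - 1 + r * z)| = r * |y - z| := by
      rw [← abs_of_pos hr, ← abs_mul, abs_of_pos hr]; congr 1; ring
    have e2 : D y - D z = -((c - 1 + r * y) - (c - 1 + r * z))
        + (eigRoot a c d r y - eigRoot a c d r z) := by simp only [hD]; ring
    rw [e2]
    refine (abs_add_le _ _).trans ?_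
    rw [abs_neg, e]
    rw [e] at h
    unfold eigRoot
    linarith
  have hD0 : D 0 = 2 * (c + 1) := by
    have : eigRoot a c d r 0 = c + 1 := by
      rw [eigRoot, show 4 * a * c * d + (c - 1 + r * 0) ^ 2 = (c + 1) ^ 2 by
        linear_combination (4 * c) * had, Real.sqrt_sq (by positivity)]
    simp only [hD, this]
    ring
  have hlip : ∀ y z, |-2 * r / D y - -2 * r / D z| ≤ r ^ 2 / c ^ 2 * |y - z| := by
    intro y z
    have hy : 0 < D y := lt_of_lt_of_le (by positivity) (hDlow y)
    have hz : 0 < D z := lt_of_lt_of_le (by positivity) (hDlow z)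
    have e : -2 * r / D y - -2 * r / D z = 2 * r * (D y - D z) / (D y * D z) := by
      field_simp
      ring
    rw [e, abs_div, abs_mul, abs_of_pos (by positivity : 0 < 2 * r),
      abs_of_pos (by positivity : 0 < D y * D z)]
    calc _ ≤ 2 * r * (2 * r * |y - z|) / (2 * c * (2 * c)) := by
          gcongr
          · exact hDlip y z
          · exact hDlow y
          · exact hDlow z
      _ = _ := by field_simp
  refine gap_of_linear (m := fun k => -2 * r / D (1 / (k : ℝ) ^ 2)) (m₀ := -2 * r / D 0)
    (L := r ^ 2 / c ^ 2) (fun k hk => ?_) ?_ ?_ (by positivity) (fun k n _ _ => hlip _ _)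
  · rw [freq_eq hc hd]
    have hk' : (k : ℝ) ≠ 0 := by exact_mod_cast hk
    set z := 1 / (k : ℝ) ^ 2 with hz
    have hkz : (k : ℝ) ^ 2 * z = 1 := by rw [hz]; field_simp
    have hDz : 0 < D z := lt_of_lt_of_le (by positivity) (hDlow z)
    have hsq : eigRoot a c d r z ^ 2 = 4 * a * c * d + (c - 1 + r * z) ^ 2 :=
      Real.sq_sqrt (by positivity)
    have h1 : (1 + d / c * slope a c d r (k, false)) = -2 * r * z / D z := by
      rw [eq_div_iff hDz.ne']
      simp only [slope, slopeFun, ← hz, hD, if_false, Bool.false_eq_true]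
      field_simp
      linear_combination -hsq - (4 * c) * had
    rw [h1]
    linear_combination ((k : ℝ) * (-2 * r) / D z) * hkz
  · rw [hD0]
    have : -2 * r / (2 * (c + 1)) = -(r / (c + 1)) := by field_simp
    rw [this, abs_neg, abs_of_pos (by positivity)]
    exact hγ
  · rw [tendsto_iff_norm_sub_tendsto_zero]
    have h := (tendsto_inv_sq_cofinite.abs).const_mul (r ^ 2 / c ^ 2)
    rw [abs_zero, mul_zero] at h
    refine squeeze_zero (fun k => norm_nonneg _) (fun k => ?_) h
    have := hlip (1 / (k : ℝ) ^ 2) 0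
    rwa [sub_zero] at this

/-- The eigenvalues and eigenvectors of the linearized Gear-Grimshaw operator satisfy the
assumptions of the vector valued Ingham inequality. -/
theorem exists_isModeFamily (ha : 0 < a) (hc : 0 < c) (hd : 0 < d) (hr : 0 < r)
    (hD : DistinctEigenvalues a c d r) :
    ∃ s₀ B : ℝ, IsModeFamily (freq a c d r) (slope a c d r) (slopeFun a c d r 0) s₀ B
      (criticalTime a c d r) := by
  obtain ⟨s₀, B, hs₀, hb⟩ := slopeFun_bounds ha hc hd hr
  have hcrit : 0 ≤ criticalTime a c d r := by
    unfold criticalTime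
    split_ifs
    · have := Real.pi_pos; positivity
    · exact le_rfl
  refine ⟨s₀, B, ?_, hs₀, fun k => (hb _ (inv_sq_mem k).1 (inv_sq_mem k).2).1,
    fun k => (hb _ (inv_sq_mem k).1 (inv_sq_mem k).2).2.1,
    fun j => (hb _ (inv_sq_mem j.1).1 (inv_sq_mem j.1).2).2.2 j.2,
    tendsto_slope ha hc hd hr, hcrit, fun T hT => ?_⟩
  · intro b k n hkn
    by_contra hne
    have := hD k n hne
    cases b
    · exact this.2 hkn
    · exact this.1 hkn
  · have hT0 : 0 < T := hcrit.trans_lt hT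
    have hnz : ∀ b, a * d ≠ 1 → 1 + d / c * slopeFun a c d r 0 b ≠ 0 := by
      intro b had h0
      have hq := slopeFun_quadratic (r := r) ha hc hd 0 b
      have hs : slopeFun a c d r 0 b = -c / d := by
        field_simp at h0 ⊢
        linarith
      rw [hs] at hq
      apply had
      field_simp at hq
      have : c * (1 - a * d) = 0 := by linear_combination hq
      rcases mul_eq_zero.1 this with h | h
      · exact absurd h hc.ne'
      · linarith
    have hpos : 1 + d / c * slopeFun a c d r 0 true ≠ 0 := by
      have := (hb 0 le_rfl zero_le_one).1
      have : 0 < d / c * slopeFun a c d r 0 true := mul_pos (by positivity) (by linarith)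
      linarith
    obtain ⟨γ, hγT, hγ⟩ : ∃ γ, 2 * Real.pi < T * γ ∧ (a * d = 1 → γ < r / (c + 1)) := by
      by_cases had : a * d = 1
      · rw [criticalTime, if_pos had] at hT
        have h1 : 2 * Real.pi / T < r / (c + 1) := by
          rw [div_lt_div_iff₀ hT0 (by positivity)]
          rw [div_lt_iff₀ hr] at hT
          linarith
        obtain ⟨γ, h2, h3⟩ := exists_between h1
        rw [div_lt_iff₀ hT0] at h2
        exact ⟨γ, by linarith, fun _ => h3⟩
      · refine ⟨(2 * Real.pi + 1) / T, ?_, fun h => absurd h had⟩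
        rw [mul_div_cancel₀ _ hT0.ne']
        linarith
    obtain ⟨K₁, hK₁⟩ := gap_freq_cubic ha hc hd hr true hpos γ
    obtain ⟨K₂, hK₂⟩ : ∃ K : ℕ, ∀ k n : ℤ, (K : ℤ) ≤ |k| → (K : ℤ) ≤ |n| →
        γ * |(k : ℝ) - n| ≤ |freq a c d r (k, false) - freq a c d r (n, false)| := by
      by_cases had : a * d = 1
      · exact gap_freq_linear ha hc hd hr had (hγ had)
      · exact gap_freq_cubic ha hc hd hr false (hnz false had) γ
    refine ⟨γ, hγT, max K₁ K₂, fun b k n hk hn => ?_⟩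
    push_cast at hk hn
    cases b
    · exact hK₂ k n (by omega) (by omega)
    · exact hK₁ k n (by omega) (by omega)

end

theorem freq_charpoly {a c d r : ℝ} (ha : 0 < a) (hc : 0 < c) (hd : 0 < d) (j : ℤ × Bool) :
    (freq a c d r j - (j.1 : ℝ) ^ 3) * (c * freq a c d r j - (j.1 : ℝ) ^ 3 + r * j.1)
      = a * d * (j.1 : ℝ) ^ 6 := by
  rw [freq_eq hc hd]
  have hq := slopeFun_quadratic (r := r) ha hc hd (1 / (j.1 : ℝ) ^ 2) j.2
  change d * slope a c d r j ^ 2 + _ * slope a c d r j - a * c = 0 at hq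
  set k : ℝ := (j.1 : ℝ)
  rcases eq_or_ne k 0 with hk | hk
  · rw [hk]; ring
  · set s := slope a c d r j
    set z := 1 / k ^ 2 with hz
    have hkz : k ^ 2 * z = 1 := by rw [hz]; field_simp
    have hqc : c * (d / c) = d := by field_simp
    have e : c * (k ^ 3 * (1 + d / c * s)) - k ^ 3 + r * k = k ^ 3 * (c - 1 + r * z + d * s) := by
      linear_combination (k ^ 3 * s) * hqc - (r * k) * hkz
    rw [e]
    linear_combination (k ^ 6 * (d / c)) * hq + (a * k ^ 6) * hqc

theorem freq_neg (a c d r : ℝ) (k : ℤ) (b : Bool) :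
    freq a c d r (-k, b) = -freq a c d r (k, b) := by
  cases b <;> simp only [freq, omegaPlus, omegaMinus, if_true, if_false, Bool.false_eq_true,
    Int.cast_neg, even_two, Even.neg_pow, Even.neg_pow (by decide : Even 4)] <;> ring

theorem finite_setOf_quadratic_eq_zero {α : ℝ} (hα : α ≠ 0) (β γ : ℝ) :
    {x : ℝ | α * x ^ 2 + β * x + γ = 0}.Finite := by
  have hp : (Polynomial.C α * Polynomial.X ^ 2 + Polynomial.C β * Polynomial.X + Polynomial.C γ :
      Polynomial ℝ) ≠ 0 := by
    intro h
    have := congrArg (fun p => Polynomial.coeff p 2) h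
    simp at this
    exact hα this
  refine (Polynomial.finite_setOfPred_isRoot hp).subset fun x hx => ?_
  simpa [Polynomial.IsRoot] using hx

theorem finite_setOf_freq_eq {c d r : ℝ} (hc : 0 < c) (hd : 0 < d) {k n : ℤ}
    (hkn : k ≠ n) (b : Bool) :
    {a : ℝ | 0 < a ∧ freq a c d r (k, b) = freq a c d r (n, b)}.Finite := by
  wlog hk : k ≠ 0 generalizing k n
  · have hn : n ≠ 0 := by
      push Not at hk
      exact fun h => hkn (hk.trans h.symm)
    refine (this hkn.symm hn).subset fun a ha => ⟨ha.1, ha.2.symm⟩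
  have hk' : (k : ℝ) ≠ 0 := by exact_mod_cast hk
  obtain ⟨Λ, hΛ, hmem⟩ : ∃ Λ : Set ℝ, Λ.Finite ∧ ∀ a, 0 < a →
      freq a c d r (k, b) = freq a c d r (n, b) → freq a c d r (k, b) ∈ Λ := by
    by_cases hneg : n = -k
    · refine ⟨{0}, Set.finite_singleton 0, fun a _ h => ?_⟩
      rw [hneg, freq_neg] at h
      rw [Set.mem_singleton_iff]
      linarith
    · have h6 : c * ((n : ℝ) ^ 6 - (k : ℝ) ^ 6) ≠ 0 := by
        refine mul_ne_zero hc.ne' (sub_ne_zero.2 fun h => ?_)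
        have h2 : ((n : ℝ) ^ 2) ^ 3 = ((k : ℝ) ^ 2) ^ 3 := by rw [← pow_mul, ← pow_mul]; exact h
        have h3 : (n : ℝ) ^ 2 = (k : ℝ) ^ 2 :=
          (Odd.strictMono_pow (by decide : Odd 3)).injective h2
        rcases sq_eq_sq_iff_eq_or_eq_neg.1 h3 with h4 | h4
        · exact hkn (by exact_mod_cast h4.symm)
        · exact hneg (by exact_mod_cast h4)
      refine ⟨_, finite_setOf_quadratic_eq_zero h6
        ((-(k : ℝ) ^ 3 + r * k - c * k ^ 3) * n ^ 6 - (-(n : ℝ) ^ 3 + r * n - c * n ^ 3) * k ^ 6)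
        ((k : ℝ) ^ 3 * (k ^ 3 - r * k) * n ^ 6 - (n : ℝ) ^ 3 * (n ^ 3 - r * n) * k ^ 6),
        fun a ha h => ?_⟩
      have e1 := freq_charpoly (r := r) ha hc hd (k, b)
      have e2 := freq_charpoly (r := r) ha hc hd (n, b)
      rw [← h] at e2
      simp only at e1 e2
      rw [Set.mem_ofPred_eq]
      linear_combination (n : ℝ) ^ 6 * e1 - (k : ℝ) ^ 6 * e2
  refine (hΛ.image fun x => (x - (k : ℝ) ^ 3) * (c * x - (k : ℝ) ^ 3 + r * k)
    / (d * (k : ℝ) ^ 6)).subset ?_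
  rintro a ⟨ha, h⟩
  refine ⟨_, hmem a ha h, ?_⟩
  simp only
  have e1 := freq_charpoly (r := r) ha hc hd (k, b)
  simp only at e1
  rw [e1]
  field_simp

theorem measurable_freq (j : ℤ × Bool) : Measurable fun p : ℝ × ℝ × ℝ × ℝ =>
    freq p.1 p.2.1 p.2.2.1 p.2.2.2 j := by
  rcases j with ⟨k, b⟩
  cases b <;> simp only [freq, omegaPlus, omegaMinus, if_true, if_false, Bool.false_eq_true] <;>
    fun_prop

theorem ae_freq_ne {k n : ℤ} (hkn : k ≠ n) (b : Bool) :
    ∀ᵐ p : ℝ × ℝ × ℝ × ℝ, 0 < p.1 → 0 < p.2.1 → 0 < p.2.2.1 → 0 < p.2.2.2 →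
      freq p.1 p.2.1 p.2.2.1 p.2.2.2 (k, b) ≠ freq p.1 p.2.1 p.2.2.1 p.2.2.2 (n, b) := by
  set N : Set (ℝ × ℝ × ℝ × ℝ) := {p | (0 < p.1 ∧ 0 < p.2.1 ∧ 0 < p.2.2.1) ∧
    freq p.1 p.2.1 p.2.2.1 p.2.2.2 (k, b) = freq p.1 p.2.1 p.2.2.1 p.2.2.2 (n, b)} with hN
  have hmeas : MeasurableSet N := by
    refine MeasurableSet.inter ?_ (measurableSet_eq_fun (measurable_freq _) (measurable_freq _))
    exact (measurableSet_lt measurable_const measurable_fst).inter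
      ((measurableSet_lt measurable_const (measurable_fst.comp measurable_snd)).inter
        (measurableSet_lt measurable_const
          ((measurable_fst.comp measurable_snd).comp measurable_snd)))
  have hnull : (volume : Measure (ℝ × ℝ × ℝ × ℝ)) N = 0 := by
    rw [Measure.volume_eq_prod, Measure.prod_apply_symm hmeas, lintegral_eq_zero_iff']
    · refine Eventually.of_forall fun q => ?_
      by_cases hq : 0 < q.1 ∧ 0 < q.2.1
      · refine Set.Finite.measure_zero ((finite_setOf_freq_eq (r := q.2.2) hq.1 hq.2 hkn b).subset
          ?_) _
        rintro a ⟨ha, h⟩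
        exact ⟨ha.1, h⟩
      · have : (fun a : ℝ => (a, q)) ⁻¹' N = ∅ :=
          Set.eq_empty_of_forall_notMem fun a h => hq h.1.2
        simp only [this, measure_empty, Pi.zero_apply]
    · exact (measurable_measure_prodMk_right hmeas).aemeasurable
  refine (measure_eq_zero_iff_ae_notMem.1 hnull).mono fun p hp h1 h2 h3 _ h => ?_
  exact hp ⟨⟨h1, h2, h3⟩, h⟩

theorem ae_distinctEigenvalues :
    ∀ᵐ p : ℝ × ℝ × ℝ × ℝ, 0 < p.1 → 0 < p.2.1 → 0 < p.2.2.1 → 0 < p.2.2.2 →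
      DistinctEigenvalues p.1 p.2.1 p.2.2.1 p.2.2.2 := by
  have h : ∀ᵐ p : ℝ × ℝ × ℝ × ℝ, ∀ (k n : ℤ) (b : Bool), k ≠ n →
      0 < p.1 → 0 < p.2.1 → 0 < p.2.2.1 → 0 < p.2.2.2 →
      freq p.1 p.2.1 p.2.2.1 p.2.2.2 (k, b) ≠ freq p.1 p.2.1 p.2.2.1 p.2.2.2 (n, b) := by
    refine ae_all_iff.2 fun k => ae_all_iff.2 fun n => ae_all_iff.2 fun b => ?_
    by_cases hkn : k = n
    · exact Eventually.of_forall fun p h => absurd hkn h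
    · exact (ae_freq_ne hkn b).mono fun p hp _ => hp
  refine h.mono fun p hp h1 h2 h3 h4 k n hkn => ⟨?_, ?_⟩
  · exact hp k n true hkn h1 h2 h3 h4
  · exact hp k n false hkn h1 h2 h3 h4

section RieszSequence

variable {ι E : Type*} [NormedAddCommGroup E] [InnerProductSpace ℂ E]

theorem sum_norm_inner_sq_le {v : ι → E} {M : ℝ} (hM : 0 < M)
    (hup : ∀ (S : Finset ι) (c : ι → ℂ), ‖∑ i ∈ S, c i • v i‖ ^ 2 ≤ M * ∑ i ∈ S, ‖c i‖ ^ 2)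
    (y : E) (S : Finset ι) : ∑ i ∈ S, ‖inner ℂ (v i) y‖ ^ 2 ≤ M * ‖y‖ ^ 2 := by
  set Q := ∑ i ∈ S, ‖inner ℂ (v i) y‖ ^ 2 with hQ
  have hQ0 : 0 ≤ Q := Finset.sum_nonneg fun _ _ => sq_nonneg _
  have h1 : inner ℂ (∑ i ∈ S, inner ℂ (v i) y • v i) y = (Q : ℂ) := by
    rw [sum_inner, hQ, Complex.ofReal_sum]
    refine Finset.sum_congr rfl fun i _ => ?_
    rw [inner_smul_left, Complex.conj_mul', Complex.ofReal_pow]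
  have h2 := norm_inner_le_norm (𝕜 := ℂ) (∑ i ∈ S, inner ℂ (v i) y • v i) y
  rw [h1, Complex.norm_real, Real.norm_eq_abs, abs_of_nonneg hQ0] at h2
  have h3 := hup S (fun i => inner ℂ (v i) y)
  have h4 : Q ^ 2 ≤ M * Q * ‖y‖ ^ 2 := by
    calc Q ^ 2 ≤ (‖∑ i ∈ S, inner ℂ (v i) y • v i‖ * ‖y‖) ^ 2 := by gcongr
      _ = ‖∑ i ∈ S, inner ℂ (v i) y • v i‖ ^ 2 * ‖y‖ ^ 2 := by ring
      _ ≤ _ := by gcongr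
  rcases hQ0.eq_or_lt with h | h
  · rw [← h]; positivity
  · refine le_of_mul_le_mul_left ?_ h
    linarith

theorem memlp_two_of_sum_le {f : ι → ℂ} {C : ℝ} (h : ∀ S : Finset ι, ∑ i ∈ S, ‖f i‖ ^ 2 ≤ C) :
    Memℓp f 2 := by
  refine memℓp_gen' (C := C) fun S => ?_
  simpa using h S

theorem lp_norm_sq_le_of_sum_le {x : lp (fun _ : ι => ℂ) 2} {C : ℝ} (hC : 0 ≤ C)
    (h : ∀ S : Finset ι, ∑ i ∈ S, ‖x i‖ ^ 2 ≤ C ^ 2) : ‖x‖ ≤ C := by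
  refine lp.norm_le_of_forall_sum_le (by norm_num) hC fun S => ?_
  simpa using h S

/-- The analysis operator `y ↦ (⟪vᵢ, y⟫)ᵢ` of a Bessel sequence. -/
noncomputable def analysisOp (v : ι → E) (M : ℝ) (hM : 0 < M)
    (hup : ∀ (S : Finset ι) (c : ι → ℂ), ‖∑ i ∈ S, c i • v i‖ ^ 2 ≤ M * ∑ i ∈ S, ‖c i‖ ^ 2) :
    E →L[ℂ] lp (fun _ : ι => ℂ) 2 :=
  LinearMap.mkContinuous
    { toFun := fun y => ⟨fun i => inner ℂ (v i) y,
        memlp_two_of_sum_le (sum_norm_inner_sq_le hM hup y)⟩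
      map_add' := fun x y => by ext i; exact inner_add_right _ _ _
      map_smul' := fun z x => by ext i; exact inner_smul_right _ _ _ }
    (Real.sqrt M) fun y => by
      refine lp_norm_sq_le_of_sum_le (by positivity) fun S => ?_
      rw [mul_pow, Real.sq_sqrt hM.le]
      exact sum_norm_inner_sq_le hM hup y S

theorem analysisOp_apply (v : ι → E) (M : ℝ) (hM : 0 < M)
    (hup : ∀ (S : Finset ι) (c : ι → ℂ), ‖∑ i ∈ S, c i • v i‖ ^ 2 ≤ M * ∑ i ∈ S, ‖c i‖ ^ 2)
    (y : E) (i : ι) : analysisOp v M hM hup y i = inner ℂ (v i) y := rfl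

/-- The moment problem for a Riesz sequence is solvable. -/
theorem analysisOp_surjective [CompleteSpace E] (v : ι → E) (M : ℝ) (hM : 0 < M)
    (hup : ∀ (S : Finset ι) (c : ι → ℂ), ‖∑ i ∈ S, c i • v i‖ ^ 2 ≤ M * ∑ i ∈ S, ‖c i‖ ^ 2)
    {C : ℝ} (hlow : ∀ (S : Finset ι) (c : ι → ℂ),
      ∑ i ∈ S, ‖c i‖ ^ 2 ≤ C * ‖∑ i ∈ S, c i • v i‖ ^ 2) (hC : 0 < C) :
    Function.Surjective (analysisOp v M hM hup) := by
  classical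
  set B := analysisOp v M hM hup with hB
  set A := ContinuousLinearMap.adjoint B with hA
  have hsingle : ∀ i z, A (lp.single 2 i z) = z • v i := by
    intro i z
    refine ext_inner_right ℂ fun y => ?_
    rw [hA, ContinuousLinearMap.adjoint_inner_left, lp.inner_single_left, hB, analysisOp_apply,
      inner_smul_left]
    simp [mul_comm]
  have hbelow : ∀ x, ‖x‖ ^ 2 ≤ C * ‖A x‖ ^ 2 := by
    intro x
    have hx := lp.hasSum_single (by norm_num : (2 : ENNReal) ≠ ⊤) x
    have hAx := hx.mapL A
    refine le_of_tendsto_of_tendsto' ((hx.norm).pow 2) (((hAx.norm).pow 2).const_mul C) fun S => ?_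
    have h1 : ‖∑ i ∈ S, lp.single 2 i (x i)‖ ^ 2 = ∑ i ∈ S, ‖x i‖ ^ 2 := by
      have := lp.norm_sum_single (p := 2) (by norm_num) (fun i => x i) S
      simpa using this
    rw [h1]
    simp only [hsingle]
    exact hlow S _
  have hre : ∀ x, inner ℂ x (B (A x)) = ((‖A x‖ ^ 2 : ℝ) : ℂ) := by
    intro x
    rw [← ContinuousLinearMap.adjoint_inner_left, ← hA, inner_self_eq_norm_sq_to_K]
    push_cast
    rfl
  have hBA : ∀ x, ‖x‖ ≤ C * ‖B (A x)‖ := by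
    intro x
    have h1 := norm_inner_le_norm (𝕜 := ℂ) x (B (A x))
    rw [hre, Complex.norm_real, Real.norm_eq_abs, abs_of_nonneg (sq_nonneg _)] at h1
    rcases (norm_nonneg x).eq_or_lt with h0 | h0
    · rw [← h0]; positivity
    · refine le_of_mul_le_mul_left ?_ h0
      nlinarith [hbelow x]
  have hclosed : IsClosed ((B.comp A).range : Set (lp (fun _ : ι => ℂ) 2)) := by
    have hanti : AntilipschitzWith C.toNNReal (B.comp A) :=
      AddMonoidHomClass.antilipschitz_of_bound _ fun x => by
        rw [Real.coe_toNNReal C hC.le]; exact hBA x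
    exact hanti.isClosed_range (B.comp A).uniformContinuous
  have htop : (B.comp A).range = ⊤ := by
    have : CompleteSpace (B.comp A).range := hclosed.completeSpace_coe
    rw [← Submodule.orthogonal_eq_bot_iff, Submodule.eq_bot_iff]
    intro z hz
    have h1 : inner ℂ z (B (A z)) = 0 :=
      Submodule.inner_left_of_mem_orthogonal (K := (B.comp A).range) ⟨z, rfl⟩ hz
    rw [hre] at h1
    have h2 : ‖A z‖ ^ 2 = 0 := by exact_mod_cast h1
    have h3 := hbelow z
    rw [h2, mul_zero] at h3
    exact norm_eq_zero.1 (pow_eq_zero_iff (two_ne_zero) |>.1 (le_antisymm h3 (sq_nonneg _)))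
  intro b
  obtain ⟨x, hx⟩ : b ∈ (B.comp A).range := htop ▸ Submodule.mem_top
  exact ⟨A x, hx⟩

end RieszSequence

section Multiplier

variable {ι κ : Type*}

theorem lp_sum_norm_sq_le (x : lp (fun _ : ι => ℂ) 2) (S : Finset ι) :
    ∑ i ∈ S, ‖x i‖ ^ 2 ≤ ‖x‖ ^ 2 := by
  have := lp.sum_rpow_le_norm_rpow (p := 2) (by norm_num) x S
  simpa using this

theorem sum_norm_mul_comp_sq_le {m : κ → ℂ} {C : ℝ} (hm : ∀ k, ‖m k‖ ≤ C) {ρ : κ → ι}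
    (hρ : Function.Injective ρ) (x : lp (fun _ : ι => ℂ) 2) (S : Finset κ) :
    ∑ k ∈ S, ‖m k * x (ρ k)‖ ^ 2 ≤ (C * ‖x‖) ^ 2 := by
  classical
  calc ∑ k ∈ S, ‖m k * x (ρ k)‖ ^ 2 ≤ ∑ k ∈ S, C ^ 2 * ‖x (ρ k)‖ ^ 2 := by
        refine Finset.sum_le_sum fun k _ => ?_
        rw [norm_mul, mul_pow]
        have := hm k
        gcongr
    _ = C ^ 2 * ∑ i ∈ S.image ρ, ‖x i‖ ^ 2 := by
        rw [Finset.sum_image hρ.injOn, Finset.mul_sum]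
    _ ≤ _ := by
        rw [mul_pow]
        gcongr
        exact lp_sum_norm_sq_le x _

/-- The operator `x ↦ (m k * x (ρ k))ₖ` between `ℓ²` spaces. -/
noncomputable def mulComp (m : κ → ℂ) (C : ℝ) (hC : 0 ≤ C) (hm : ∀ k, ‖m k‖ ≤ C) (ρ : κ → ι)
    (hρ : Function.Injective ρ) : lp (fun _ : ι => ℂ) 2 →L[ℂ] lp (fun _ : κ => ℂ) 2 :=
  LinearMap.mkContinuous
    { toFun := fun x => ⟨fun k => m k * x (ρ k),
        memlp_two_of_sum_le (sum_norm_mul_comp_sq_le hm hρ x)⟩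
      map_add' := fun x y => by ext k; exact mul_add _ _ _
      map_smul' := fun z x => by ext k; exact mul_left_comm _ _ _ }
    C fun x => lp_norm_sq_le_of_sum_le (by positivity) (sum_norm_mul_comp_sq_le hm hρ x)

/-- The diagonal unitary group with frequencies `w` on `ℓ²`. -/
noncomputable def diagGroup (w : ι → ℝ) (t : ℝ) :
    lp (fun _ : ι => ℂ) 2 →L[ℂ] lp (fun _ : ι => ℂ) 2 :=
  mulComp (fun i => Complex.exp (w i * t * Complex.I)) 1 zero_le_one
    (fun i => (norm_exp_freq (w i) t).le) id Function.injective_id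

theorem diagGroup_apply (w : ι → ℝ) (t : ℝ) (x : lp (fun _ : ι => ℂ) 2) (i : ι) :
    diagGroup w t x i = Complex.exp (w i * t * Complex.I) * x i := rfl

theorem norm_diagGroup_le (w : ι → ℝ) (t : ℝ) (x : lp (fun _ : ι => ℂ) 2) :
    ‖diagGroup w t x‖ ≤ ‖x‖ := by
  refine lp_norm_sq_le_of_sum_le (norm_nonneg _) fun S => ?_
  refine le_trans (le_of_eq (Finset.sum_congr rfl fun i _ => ?_)) (lp_sum_norm_sq_le x S)
  rw [diagGroup_apply, norm_mul, norm_exp_freq, one_mul]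

theorem lp_norm_sq_eq_tsum (x : lp (fun _ : ι => ℂ) 2) : ‖x‖ ^ 2 = ∑' i, ‖x i‖ ^ 2 := by
  have := lp.norm_rpow_eq_tsum (p := 2) (by norm_num) x
  simpa using this

theorem lp_summable_norm_sq (x : lp (fun _ : ι => ℂ) 2) : Summable fun i => ‖x i‖ ^ 2 := by
  have := (lp.memℓp x).summable (by norm_num)
  simpa using this

theorem tendsto_diagGroup (w : ι → ℝ) (x : lp (fun _ : ι => ℂ) 2) (t₀ : ℝ) :
    Tendsto (fun t => diagGroup w t x) (𝓝 t₀) (𝓝 (diagGroup w t₀ x)) := by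
  rw [tendsto_iff_norm_sub_tendsto_zero]
  have h : Tendsto (fun t => ‖diagGroup w t x - diagGroup w t₀ x‖ ^ 2) (𝓝 t₀) (𝓝 0) := by
    simp_rw [lp_norm_sq_eq_tsum]
    rw [show (0 : ℝ) = ∑' _ : ι, (0 : ℝ) by simp]
    refine tendsto_tsum_of_dominated_convergence (bound := fun i => 4 * ‖x i‖ ^ 2)
      ((lp_summable_norm_sq x).mul_left 4) (fun i => ?_) (Eventually.of_forall fun t i => ?_)
    · have hcont : Continuous fun t : ℝ => ‖Complex.exp (w i * t * Complex.I) * x i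
          - Complex.exp (w i * t₀ * Complex.I) * x i‖ ^ 2 := by fun_prop
      have := hcont.tendsto t₀
      simpa [diagGroup_apply] using this
    · rw [Real.norm_eq_abs, abs_of_nonneg (sq_nonneg _), lp.coeFn_sub, Pi.sub_apply]
      refine (norm_sub_sq_le_two _ _).trans (le_of_eq ?_)
      simp only [diagGroup_apply, norm_mul, norm_exp_freq, one_mul]
      ring
  have h2 := h.sqrt
  simpa using h2

theorem continuous_diagGroup_comp (w : ι → ℝ) {Y : ℝ → lp (fun _ : ι => ℂ) 2}
    (hY : Continuous Y) : Continuous fun t => diagGroup w t (Y t) := by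
  refine continuous_iff_continuousAt.2 fun t₀ => ?_
  have h1 : Tendsto (fun t => diagGroup w t (Y t - Y t₀)) (𝓝 t₀) (𝓝 0) := by
    refine squeeze_zero_norm (fun t => norm_diagGroup_le w t _) ?_
    exact tendsto_iff_norm_sub_tendsto_zero.1 (hY.tendsto t₀)
  have h2 := h1.add (tendsto_diagGroup w (Y t₀) t₀)
  rw [zero_add] at h2
  refine h2.congr fun t => ?_
  rw [← map_add, sub_add_cancel]

theorem sum_comp_fst_le [DecidableEq κ] {g : κ → ℝ} (hg : ∀ k, 0 ≤ g k)
    (S : Finset (κ × Bool)) : ∑ j ∈ S, g j.1 ≤ 2 * ∑ k ∈ S.image Prod.fst, g k := by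
  have hsub : S ⊆ S.image Prod.fst ×ˢ Finset.univ := fun j hj =>
    Finset.mem_product.2 ⟨Finset.mem_image_of_mem _ hj, Finset.mem_univ _⟩
  refine (Finset.sum_le_sum_of_subset_of_nonneg hsub fun j _ _ => hg j.1).trans (le_of_eq ?_)
  rw [Finset.sum_product, Finset.mul_sum]
  simp

theorem exists_lp_eq_add_mul (x y : lp (fun _ : κ => ℂ) 2) {m : κ × Bool → ℝ} {C : ℝ}
    (hm : ∀ j, |m j| ≤ C) :
    ∃ z : lp (fun _ : κ × Bool => ℂ) 2, ∀ j, z j = x j.1 + m j * y j.1 := by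
  classical
  refine ⟨⟨fun j => x j.1 + m j * y j.1, memlp_two_of_sum_le
    (C := 4 * ‖x‖ ^ 2 + 4 * C ^ 2 * ‖y‖ ^ 2) fun S => ?_⟩, fun j => rfl⟩
  calc ∑ j ∈ S, ‖x j.1 + m j * y j.1‖ ^ 2
      ≤ ∑ j ∈ S, (2 * ‖x j.1‖ ^ 2 + 2 * C ^ 2 * ‖y j.1‖ ^ 2) := by
        refine Finset.sum_le_sum fun j _ => (norm_add_sq_le_two _ _).trans ?_
        rw [norm_mul, mul_pow, Complex.norm_real, Real.norm_eq_abs, mul_assoc]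
        have := hm j
        gcongr
    _ = 2 * ∑ j ∈ S, ‖x j.1‖ ^ 2 + 2 * C ^ 2 * ∑ j ∈ S, ‖y j.1‖ ^ 2 := by
        rw [Finset.sum_add_distrib, Finset.mul_sum, Finset.mul_sum]
    _ ≤ 2 * (2 * ‖x‖ ^ 2) + 2 * C ^ 2 * (2 * ‖y‖ ^ 2) := by
        gcongr
        · refine (sum_comp_fst_le (fun k => sq_nonneg ‖x k‖) S).trans ?_
          gcongr
          exact lp_sum_norm_sq_le x _
        · refine (sum_comp_fst_le (fun k => sq_nonneg ‖y k‖) S).trans ?_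
          gcongr
          exact lp_sum_norm_sq_le y _
    _ = _ := by ring

end Multiplier

/-- The length factor normalizing the exponentials in `L²`. -/
noncomputable def nrm : ℝ := 1 / Real.sqrt (2 * Real.pi)

theorem nrm_pos : 0 < nrm := by unfold nrm; have := Real.pi_pos; positivity

theorem nrm_sq : nrm * nrm = 1 / (2 * Real.pi) := by
  have := Real.pi_pos
  unfold nrm
  rw [div_mul_div_comm, Real.mul_self_sqrt (by positivity), one_mul]

/-- The normalized exponential `e^{ikx} / √(2π)` in `L²` of the circle. -/
noncomputable def fourierVec (k : ℤ) : L2 ℂ :=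
  ((nrm : ℝ) : ℂ) • ContinuousMap.toLp 2 (volume : Measure Circ) ℂ (fourier k)

theorem coeFn_fourierVec (k : ℤ) :
    (fourierVec k : Circ → ℂ) =ᵐ[volume] fun x => (nrm : ℂ) * fourier k x := by
  filter_upwards [Lp.coeFn_smul (nrm : ℂ) (ContinuousMap.toLp 2 (volume : Measure Circ) ℂ
    (fourier k)), ContinuousMap.coeFn_toLp (p := 2) (𝕜 := ℂ) (volume : Measure Circ)
    (fourier k : C(Circ, ℂ))] with x h1 h2
  rw [fourierVec, h1, Pi.smul_apply, h2, smul_eq_mul]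

theorem inner_fourierVec (k : ℤ) (u : L2 ℂ) :
    inner ℂ (fourierVec k) u = nrm * ∫ x : Circ, fourier (-k) x * u x := by
  rw [L2.inner_def, ← integral_const_mul]
  refine integral_congr_ae ?_
  filter_upwards [coeFn_fourierVec k] with x hx
  rw [hx, RCLike.inner_apply, fourier_neg, map_mul, Complex.conj_ofReal]
  ring

theorem orthonormal_fourierVec : Orthonormal ℂ fourierVec := by
  rw [orthonormal_iff_ite]
  intro i j
  have hpi := Real.pi_pos
  have h1 : ∫ x : Circ, fourier (-i) x * fourierVec j x
      = nrm * ∫ x : Circ, fourier (j - i) x := by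
    rw [← integral_const_mul]
    refine integral_congr_ae ?_
    filter_upwards [coeFn_fourierVec j] with x hx
    rw [hx, sub_eq_neg_add, fourier_add]
    ring
  rw [inner_fourierVec, h1]
  split_ifs with h
  · subst h
    simp only [sub_self, fourier_zero, integral_const]
    have hv : (volume : Measure Circ).real Set.univ = 2 * Real.pi := by
      rw [measureReal_def, AddCircle.measure_univ, ENNReal.toReal_ofReal (by positivity)]
    rw [hv, Complex.real_smul, mul_one, ← mul_assoc, ← Complex.ofReal_mul, nrm_sq,
      ← Complex.ofReal_mul, one_div, inv_mul_cancel₀ (by positivity), Complex.ofReal_one]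
  · have hij : j - i ≠ 0 := sub_ne_zero.2 (Ne.symm h)
    have h0 : ∫ x : Circ, fourier (j - i) x = 0 :=
      integral_eq_zero_of_add_right_eq_neg (μ := volume)
        (fourier_add_half_inv_index hij Real.two_pi_pos)
    rw [h0, mul_zero, mul_zero]

theorem span_fourierVec_closure_eq_top :
    (Submodule.span ℂ (Set.range fourierVec)).topologicalClosure = ⊤ := by
  have h := (ContinuousMap.toLp_denseRange ℂ (volume : Measure Circ) ℂ
    (by norm_num : (2 : ENNReal) ≠ ⊤)).topologicalClosure_map_submodule
      (span_fourier_closure_eq_top (T := 2 * Real.pi))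
  rw [eq_top_iff, ← h]
  refine Submodule.topologicalClosure_mono ?_
  rw [Submodule.map_span, Submodule.span_le]
  rintro _ ⟨_, ⟨k, rfl⟩, rfl⟩
  have hn : (nrm : ℂ) ≠ 0 := by exact_mod_cast nrm_pos.ne'
  have e : ContinuousMap.toLp 2 (volume : Measure Circ) ℂ (fourier k)
      = (nrm : ℂ)⁻¹ • fourierVec k := by
    rw [fourierVec, inv_smul_smul₀ hn]
  change ContinuousMap.toLp 2 (volume : Measure Circ) ℂ (fourier k) ∈ _
  rw [e]
  exact Submodule.smul_mem _ _ (Submodule.subset_span ⟨k, rfl⟩)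

/-- The Fourier basis of `L²` of the circle of length `2π`. -/
noncomputable def circBasis : HilbertBasis ℤ ℂ (L2 ℂ) :=
  HilbertBasis.mk orthonormal_fourierVec span_fourierVec_closure_eq_top.ge

theorem coe_circBasis (k : ℤ) : circBasis k = fourierVec k := by
  rw [circBasis, HilbertBasis.coe_mk]

/-- The Fourier coefficient in the normalized basis. -/
noncomputable def coef (k : ℤ) (u : L2 ℂ) : ℂ := inner ℂ (fourierVec k) u

theorem circBasis_repr (u : L2 ℂ) (k : ℤ) : circBasis.repr u k = coef k u := by
  rw [HilbertBasis.repr_apply_apply, coe_circBasis, coef]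

theorem ext_coef {u v : L2 ℂ} (h : ∀ k, coef k u = coef k v) : u = v := by
  apply circBasis.repr.injective
  ext k
  rw [circBasis_repr, circBasis_repr, h]

theorem continuous_coef (k : ℤ) : Continuous (coef k) := by unfold coef; fun_prop

theorem hasSum_inner_coef (u v : L2 ℂ) :
    HasSum (fun k => (starRingEnd ℂ) (coef k u) * coef k v) (inner ℂ u v) := by
  have h := circBasis.hasSum_inner_mul_inner u v
  refine h.congr_fun fun k => ?_
  rw [coe_circBasis, coef, coef, inner_conj_symm]

theorem coef_fourierVec (k n : ℤ) : coef n (fourierVec k) = if n = k then 1 else 0 :=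
  orthonormal_iff_ite.1 orthonormal_fourierVec n k

theorem tendsto_sum_Icc_of_hasSum {f : ℤ → ℂ} {s : ℂ} (h : HasSum f s) :
    Tendsto (fun N : ℕ => ∑ k ∈ Finset.Icc (-(N : ℤ)) N, f k) atTop (𝓝 s) := by
  refine h.comp (tendsto_atTop_finset_of_monotone (fun M N hMN => ?_) fun k => ⟨k.natAbs, ?_⟩)
  · exact Finset.Icc_subset_Icc (by simpa using hMN) (by simpa using hMN)
  · rw [Finset.mem_Icc]
    omega

/-- The value `e^{ikx} / √(2π)` of the normalized exponential. -/
noncomputable def fval (x : Circ) (k : ℤ) : ℂ := nrm * fourier k x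

theorem norm_fval (x : Circ) (k : ℤ) : ‖fval x k‖ = nrm := by
  rw [fval, norm_mul, fourier_apply, Circle.norm_coe, mul_one, Complex.norm_real,
    Real.norm_eq_abs, abs_of_pos nrm_pos]

theorem dirichletKernel_eq (N : ℕ) (z : Circ) :
    ((dirichletKernel N z : ℝ) : ℂ) = ∑ k ∈ Finset.Icc (-(N : ℤ)) N, fourier k z := by
  rw [dirichletKernel, ← Complex.conj_eq_iff_re, map_sum]
  refine Finset.sum_bij' (fun k _ => -k) (fun k _ => -k) ?_ ?_ ?_ ?_ ?_
  · intro k hk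
    rw [Finset.mem_Icc] at hk ⊢
    omega
  · intro k hk
    rw [Finset.mem_Icc] at hk ⊢
    omega
  · intro k _; exact neg_neg k
  · intro k _; exact neg_neg k
  · intro k _
    rw [fourier_neg]

theorem integrable_fourier_mul (k : ℤ) (u : L2 ℂ) :
    Integrable fun x : Circ => fourier k x * u x := by
  have hu : Integrable (u : Circ → ℂ) := (Lp.memLp u).integrable (by norm_num)
  refine hu.bdd_mul (c := 1) (by fun_prop) (Eventually.of_forall fun x => ?_)
  rw [fourier_apply, Circle.norm_coe]

theorem fourierPartialSum_eq (N : ℕ) (u : L2 ℂ) (x : Circ) :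
    fourierPartialSum N u x = ∑ k ∈ Finset.Icc (-(N : ℤ)) N, fval x k * coef k u := by
  have h1 : ∫ y : Circ, dirichletKernel N (x - y) • u y
      = ∑ k ∈ Finset.Icc (-(N : ℤ)) N, fourier k x * ∫ y : Circ, fourier (-k) y * u y := by
    have : ∀ y : Circ, dirichletKernel N (x - y) • u y
        = ∑ k ∈ Finset.Icc (-(N : ℤ)) N, fourier k x * (fourier (-k) y * u y) := by
      intro y
      rw [Complex.real_smul, dirichletKernel_eq, Finset.sum_mul]
      refine Finset.sum_congr rfl fun k _ => ?_
      have : (fourier k (x - y) : ℂ) = fourier k x * fourier (-k) y := by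
        simp only [fourier_apply, sub_eq_add_neg, neg_smul, smul_add, smul_neg]
        rw [AddCircle.toCircle_add, Circle.coe_mul]
      rw [this, mul_assoc]
    simp_rw [this]
    rw [integral_finsetSum _ fun k _ => (integrable_fourier_mul (-k) u).const_mul _]
    simp_rw [integral_const_mul]
  rw [fourierPartialSum, h1, ← nrm_sq, Complex.real_smul, Finset.mul_sum]
  refine Finset.sum_congr rfl fun k _ => ?_
  rw [fval, coef, inner_fourierVec]
  push_cast
  ring

theorem fourier_coe_eq (k : ℤ) (x : ℝ) :
    (fourier k (x : Circ) : ℂ) = Real.cos (k * x) + Real.sin (k * x) * Complex.I := by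
  rw [fourier_coe_apply, Complex.ofReal_cos, Complex.ofReal_sin, ← Complex.exp_mul_I]
  congr 1
  have : (Real.pi : ℂ) ≠ 0 := by exact_mod_cast Real.pi_ne_zero
  push_cast
  field_simp

theorem integrable_coe {𝕜 : Type*} [RCLike 𝕜] (u : L2 𝕜) :
    IntervalIntegrable (fun x : ℝ => u (x : Circ)) volume 0 (2 * Real.pi) := by
  have hu : Integrable (u : Circ → 𝕜) := (Lp.memLp u).integrable (by norm_num)
  have hmp := AddCircle.measurePreserving_mk (2 * Real.pi) 0
  rw [intervalIntegrable_iff_integrableOn_Ioc_of_le Real.two_pi_pos.le]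
  have := hmp.integrable_comp_of_integrable hu
  rwa [zero_add] at this

theorem coef_eq_pairing (k : ℤ) (u : L2 ℂ) :
    coef k u = nrm * (pairing (fun x => Real.cos (k * x)) u
      - Complex.I * pairing (fun x => Real.sin (k * x)) u) := by
  have hint : ∀ g : ℝ → ℝ, Continuous g →
      IntervalIntegrable (fun x : ℝ => g x • u (x : Circ)) volume 0 (2 * Real.pi) := fun g hg => by
    have := (integrable_coe u).continuousOn_mul (f := fun x : ℝ => u (x : Circ))
      (g := fun x => (g x : ℂ)) (by fun_prop)
    simpa [Complex.real_smul] using this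
  have h1 := AddCircle.intervalIntegral_preimage (2 * Real.pi) 0
    (fun x : Circ => fourier (-k) x * u x)
  rw [zero_add] at h1
  rw [coef, inner_fourierVec, ← h1, pairing, pairing]
  congr 1
  rw [← intervalIntegral.integral_const_mul Complex.I,
    ← intervalIntegral.integral_sub (hint _ (by fun_prop))
      ((hint _ (by fun_prop)).const_mul Complex.I)]
  refine intervalIntegral.integral_congr fun x _ => ?_
  rw [fourier_coe_eq, Complex.real_smul, Complex.real_smul]
  push_cast
  rw [neg_mul, Complex.cos_neg, Complex.sin_neg]
  ring

theorem hasDerivAt_cos_mul (k x : ℝ) :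
    HasDerivAt (fun x => Real.cos (k * x)) (-k * Real.sin (k * x)) x := by
  have h : HasDerivAt (fun x : ℝ => k * x) k x := by simpa using (hasDerivAt_id x).const_mul k
  simpa [mul_comm] using h.cos

theorem hasDerivAt_sin_mul (k x : ℝ) :
    HasDerivAt (fun x => Real.sin (k * x)) (k * Real.cos (k * x)) x := by
  have h : HasDerivAt (fun x : ℝ => k * x) k x := by simpa using (hasDerivAt_id x).const_mul k
  simpa [mul_comm] using h.sin

theorem deriv_cos_mul (k : ℝ) :
    deriv (fun x => Real.cos (k * x)) = fun x => -k * Real.sin (k * x) :=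
  funext fun x => (hasDerivAt_cos_mul k x).deriv

theorem deriv_sin_mul (k : ℝ) :
    deriv (fun x => Real.sin (k * x)) = fun x => k * Real.cos (k * x) :=
  funext fun x => (hasDerivAt_sin_mul k x).deriv

theorem iteratedDeriv_three_cos_mul (k : ℝ) :
    iteratedDeriv 3 (fun x => Real.cos (k * x)) = fun x => k ^ 3 * Real.sin (k * x) := by
  rw [iteratedDeriv_succ', iteratedDeriv_succ', iteratedDeriv_one, deriv_cos_mul]
  funext x
  have e : deriv (fun x => -k * Real.sin (k * x)) = fun x => -k ^ 2 * Real.cos (k * x) :=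
    funext fun x => by
      rw [((hasDerivAt_sin_mul k x).const_mul (-k)).deriv]; ring
  rw [e, ((hasDerivAt_cos_mul k x).const_mul (-k ^ 2)).deriv]
  ring

theorem iteratedDeriv_three_sin_mul (k : ℝ) :
    iteratedDeriv 3 (fun x => Real.sin (k * x)) = fun x => -k ^ 3 * Real.cos (k * x) := by
  rw [iteratedDeriv_succ', iteratedDeriv_succ', iteratedDeriv_one, deriv_sin_mul]
  funext x
  have e : deriv (fun x => k * Real.cos (k * x)) = fun x => -k ^ 2 * Real.sin (k * x) :=
    funext fun x => by
      rw [((hasDerivAt_cos_mul k x).const_mul k).deriv]; ring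
  rw [e, ((hasDerivAt_sin_mul k x).const_mul (-k ^ 2)).deriv]
  ring

theorem pairing_const_mul {𝕜 : Type*} [RCLike 𝕜] (z : ℝ) (η : ℝ → ℝ) (u : L2 𝕜) :
    pairing (fun x => z * η x) u = z • pairing η u := by
  unfold pairing
  rw [← intervalIntegral.integral_smul]
  simp only [mul_smul]

theorem contDiff_cos_mul (k : ℝ) : ContDiff ℝ ∞ fun x => Real.cos (k * x) :=
  Real.contDiff_cos.comp (contDiff_const.mul contDiff_id)

theorem contDiff_sin_mul (k : ℝ) : ContDiff ℝ ∞ fun x => Real.sin (k * x) :=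
  Real.contDiff_sin.comp (contDiff_const.mul contDiff_id)

theorem periodic_cos_mul (k : ℤ) :
    Function.Periodic (fun x => Real.cos (k * x)) (2 * Real.pi) := fun x => by
  simp only
  rw [mul_add, Real.cos_add_int_mul_two_pi]

theorem periodic_sin_mul (k : ℤ) :
    Function.Periodic (fun x => Real.sin (k * x)) (2 * Real.pi) := fun x => by
  simp only
  rw [mul_add, Real.sin_add_int_mul_two_pi]

theorem eq_exp_mul_of_hasDerivAt {q : ℝ → ℂ} {w : ℝ}
    (hq : ∀ t, HasDerivAt q (Complex.I * w * q t) t) (t : ℝ) :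
    q t = Complex.exp (w * t * Complex.I) * q 0 := by
  have he : ∀ t : ℝ, HasDerivAt (fun t : ℝ => Complex.exp (-(w * t * Complex.I)))
      (Complex.exp (-(w * t * Complex.I)) * (-(w * Complex.I))) t := by
    intro t
    have : HasDerivAt (fun t : ℝ => -((w : ℂ) * (t : ℂ) * Complex.I)) (-((w : ℂ) * Complex.I)) t := by
      simpa using (((Complex.ofRealCLM.hasDerivAt (x := t)).const_mul
        (w : ℂ)).mul_const Complex.I).fun_neg
    exact this.cexp
  have hd : ∀ t, HasDerivAt (fun t : ℝ => Complex.exp (-(w * t * Complex.I)) * q t) 0 t := by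
    intro t
    refine ((he t).mul (hq t)).congr_deriv ?_
    ring
  have hconst := is_const_of_deriv_eq_zero (fun t => (hd t).differentiableAt)
    (fun t => (hd t).deriv) t 0
  simp only [Complex.ofReal_zero, mul_zero, zero_mul, neg_zero, Complex.exp_zero, one_mul] at hconst
  rw [← hconst, ← mul_assoc, ← Complex.exp_add, add_neg_cancel, Complex.exp_zero, one_mul]

section

variable {a c d r : ℝ}

theorem IsAdjointSolution.hasDerivAt_coef_fst {Φ : ℝ → H ℂ} (h : IsAdjointSolution a c d r Φ)
    (k : ℤ) (t : ℝ) : HasDerivAt (fun t => coef k (Φ t).1)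
      (Complex.I * k ^ 3 * (coef k (Φ t).1 + (d / c : ℝ) * coef k (Φ t).2)) t := by
  have h1 := h.fst_eq _ (contDiff_cos_mul k) (periodic_cos_mul k) t
  have h2 := h.fst_eq _ (contDiff_sin_mul k) (periodic_sin_mul k) t
  rw [iteratedDeriv_three_cos_mul] at h1
  rw [iteratedDeriv_three_sin_mul] at h2
  simp_rw [pairing_const_mul] at h1 h2
  have h3 := (h1.sub (h2.const_mul Complex.I)).const_mul (nrm : ℂ)
  simp_rw [coef_eq_pairing]
  refine h3.congr_deriv ?_
  simp only [Complex.real_smul]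
  push_cast
  linear_combination ((nrm : ℂ) * k ^ 3 * (pairing (fun x => Real.sin (k * x)) (Φ t).1
    + d / c * pairing (fun x => Real.sin (k * x)) (Φ t).2)) * Complex.I_sq

theorem IsAdjointSolution.hasDerivAt_coef_snd {Φ : ℝ → H ℂ} (h : IsAdjointSolution a c d r Φ)
    (k : ℤ) (t : ℝ) : HasDerivAt (fun t => coef k (Φ t).2)
      (Complex.I * (a * k ^ 3 * coef k (Φ t).1
        + ((1 / c : ℝ) * k ^ 3 - (r / c : ℝ) * k) * coef k (Φ t).2)) t := by
  have h1 := h.snd_eq _ (contDiff_cos_mul k) (periodic_cos_mul k) t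
  have h2 := h.snd_eq _ (contDiff_sin_mul k) (periodic_sin_mul k) t
  rw [iteratedDeriv_three_cos_mul, deriv_cos_mul] at h1
  rw [iteratedDeriv_three_sin_mul, deriv_sin_mul] at h2
  simp_rw [pairing_const_mul] at h1 h2
  have h3 := (h1.sub (h2.const_mul Complex.I)).const_mul (nrm : ℂ)
  simp_rw [coef_eq_pairing]
  refine h3.congr_deriv ?_
  simp only [Complex.real_smul]
  push_cast
  linear_combination ((nrm : ℂ) * (a * k ^ 3 * pairing (fun x => Real.sin (k * x)) (Φ t).1
    + (1 / c * k ^ 3 - r / c * k) * pairing (fun x => Real.sin (k * x)) (Φ t).2)) * Complex.I_sq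

theorem slope_add_slope (hd : 0 < d) (k : ℤ) (b : Bool) :
    d * (slope a c d r (k, b) + slope a c d r (k, !b)) = -(c - 1 + r * (1 / (k : ℝ) ^ 2)) := by
  simp only [slope, slopeFun]
  cases b <;> simp only [Bool.not_true, Bool.not_false, if_true, if_false, Bool.false_eq_true] <;>
    field_simp <;> ring

theorem slope_quadratic (ha : 0 < a) (hc : 0 < c) (hd : 0 < d) (j : ℤ × Bool) :
    d * slope a c d r j ^ 2 + (c - 1 + r * (1 / (j.1 : ℝ) ^ 2)) * slope a c d r j - a * c = 0 :=
  slopeFun_quadratic ha hc hd _ _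

theorem slope_mul_slope (ha : 0 < a) (hc : 0 < c) (hd : 0 < d) (k : ℤ) (b : Bool) :
    d * (slope a c d r (k, b) * slope a c d r (k, !b)) = -(a * c) := by
  have h1 := slope_add_slope (a := a) (c := c) (r := r) hd k b
  have h2 := slope_quadratic (r := r) ha hc hd (k, b)
  simp only at h2
  linear_combination slope a c d r (k, b) * h1 - h2

theorem cube_mul_inv_sq (k : ℤ) : (k : ℝ) ^ 3 * (1 / (k : ℝ) ^ 2) = k := by
  rcases eq_or_ne (k : ℝ) 0 with h | h
  · simp [h]
  · field_simp

/-- The combination `ψ̂ - σ' φ̂` of the Fourier coefficients of an adjoint solution oscillates with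
a single frequency. -/
theorem IsAdjointSolution.coef_combination (ha : 0 < a) (hc : 0 < c) (hd : 0 < d) {Φ : ℝ → H ℂ}
    (h : IsAdjointSolution a c d r Φ) (k : ℤ) (b : Bool) (t : ℝ) :
    coef k (Φ t).2 - slope a c d r (k, !b) * coef k (Φ t).1
      = Complex.exp (freq a c d r (k, b) * t * Complex.I)
        * (coef k (Φ 0).2 - slope a c d r (k, !b) * coef k (Φ 0).1) := by
  refine eq_exp_mul_of_hasDerivAt
    (q := fun t => coef k (Φ t).2 - slope a c d r (k, !b) * coef k (Φ t).1) (fun t => ?_) t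
  refine ((h.hasDerivAt_coef_snd k t).sub
    ((h.hasDerivAt_coef_fst k t).const_mul (slope a c d r (k, !b) : ℂ))).congr_deriv ?_
  have h1 : freq a c d r (k, b) * slope a c d r (k, !b)
      = (k : ℝ) ^ 3 * (slope a c d r (k, !b) - a) := by
    rw [freq_eq hc hd]
    have := slope_mul_slope (r := r) ha hc hd k b
    field_simp
    linear_combination ((k : ℝ) ^ 3) * this
  have h2 : freq a c d r (k, b) = 1 / c * (k : ℝ) ^ 3 - r / c * k
      - slope a c d r (k, !b) * (k ^ 3 * (d / c)) := by
    rw [freq_eq hc hd]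
    have := slope_add_slope (a := a) (c := c) (r := r) hd k b
    have hk := cube_mul_inv_sq k
    simp only
    generalize 1 / (k : ℝ) ^ 2 = z at this hk
    field_simp
    linear_combination ((k : ℝ) ^ 3) * this - r * hk
  have h1' := congrArg (fun x : ℝ => (x : ℂ)) h1
  have h2' := congrArg (fun x : ℝ => (x : ℂ)) h2
  push_cast at h1' h2' ⊢
  linear_combination (Complex.I * coef k (Φ t).1) * h1' - (Complex.I * coef k (Φ t).2) * h2'

/-- Expansion of the adjoint solutions into modes. -/
theorem IsAdjointSolution.exists_modes (ha : 0 < a) (hc : 0 < c) (hd : 0 < d) {Φ : ℝ → H ℂ}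
    (h : IsAdjointSolution a c d r Φ)
    (hne : ∀ k : ℤ, slope a c d r (k, true) - slope a c d r (k, false) ≠ 0) :
    ∃ P : ℤ × Bool → ℂ, ∀ k t,
      coef k (Φ t).1 = ∑ b, P (k, b) * Complex.exp (freq a c d r (k, b) * t * Complex.I) ∧
      coef k (Φ t).2 = ∑ b, slope a c d r (k, b) *
        (P (k, b) * Complex.exp (freq a c d r (k, b) * t * Complex.I)) := by
  refine ⟨fun j => (if j.2 then 1 else -1) * (coef j.1 (Φ 0).2
    - slope a c d r (j.1, !j.2) * coef j.1 (Φ 0).1)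
      / ((slope a c d r (j.1, true) - slope a c d r (j.1, false) : ℝ) : ℂ), fun k t => ?_⟩
  have hne' : ((slope a c d r (k, true) - slope a c d r (k, false) : ℝ) : ℂ) ≠ 0 := by
    exact_mod_cast hne k
  have ht := h.coef_combination ha hc hd k true t
  have hf := h.coef_combination ha hc hd k false t
  simp only [Bool.not_true, Bool.not_false] at ht hf
  simp only [Fintype.sum_bool, Bool.not_true, Bool.not_false, if_true, if_false, Bool.false_eq_true]
  generalize Complex.exp (freq a c d r (k, true) * t * Complex.I) = E₁ at ht ⊢
  generalize Complex.exp (freq a c d r (k, false) * t * Complex.I) = E₂ at hf ⊢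
  refine ⟨mul_right_cancel₀ hne' ?_, mul_right_cancel₀ hne' ?_⟩
  · field_simp
    push_cast
    linear_combination ht - hf
  · field_simp
    push_cast
    linear_combination (slope a c d r (k, true) : ℂ) * ht - (slope a c d r (k, false) : ℂ) * hf

end

/-- Integration by parts against an exponential. -/
theorem pairing_deriv_fourierVec (k : ℤ) {η : ℝ → ℝ} (hη : ContDiff ℝ ∞ η)
    (hper : Function.Periodic η (2 * Real.pi)) :
    pairing (deriv η) (fourierVec k) = -(Complex.I * k) * pairing η (fourierVec k) := by
  set E : ℝ → ℂ := fun x => nrm * Complex.exp (k * x * Complex.I) with hE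
  have hpair : ∀ g : ℝ → ℝ, pairing g (fourierVec k) = ∫ x in (0 : ℝ)..2 * Real.pi, (g x : ℂ) * E x := by
    intro g
    have hmp := AddCircle.measurePreserving_mk (2 * Real.pi) 0
    rw [zero_add] at hmp
    have hae := hmp.quasiMeasurePreserving.ae_eq_comp (coeFn_fourierVec k)
    rw [pairing, intervalIntegral.integral_of_le Real.two_pi_pos.le,
      intervalIntegral.integral_of_le Real.two_pi_pos.le]
    refine integral_congr_ae ?_
    filter_upwards [hae] with x hx
    simp only [Function.comp_apply] at hx
    rw [hx, Complex.real_smul, fourier_coe_eq, hE]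
    simp only
    rw [show (k * x * Complex.I : ℂ) = ((k * x : ℝ) : ℂ) * Complex.I by push_cast; ring,
      Complex.exp_mul_I, Complex.ofReal_cos, Complex.ofReal_sin]
  have hEd : ∀ x : ℝ, HasDerivAt E (Complex.I * k * E x) x := by
    intro x
    have : HasDerivAt (fun x : ℝ => (k : ℂ) * (x : ℂ) * Complex.I) ((k : ℂ) * Complex.I) x := by
      simpa using ((Complex.ofRealCLM.hasDerivAt (x := x)).const_mul (k : ℂ)).mul_const Complex.I
    refine (this.cexp.const_mul (nrm : ℂ)).congr_deriv ?_
    simp only [hE]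
    ring
  have hηd : ∀ x : ℝ, HasDerivAt (fun x => (η x : ℂ)) ((deriv η x : ℝ) : ℂ) x := fun x =>
    ((hη.differentiable (by simp)) x).hasDerivAt.ofReal_comp
  have hηc : Continuous (deriv η) := hη.continuous_deriv (by simp)
  have hEc : Continuous E := by rw [hE]; fun_prop
  have hparts := intervalIntegral.integral_mul_deriv_eq_deriv_mul (a := 0) (b := 2 * Real.pi)
    (u := E) (v := fun x => (η x : ℂ)) (fun x _ => hEd x) (fun x _ => hηd x)
    (by apply Continuous.intervalIntegrable; fun_prop)
    (by apply Continuous.intervalIntegrable; fun_prop)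
  have hbdry : E (2 * Real.pi) * (η (2 * Real.pi) : ℂ) - E 0 * (η 0 : ℂ) = 0 := by
    have e1 : η (2 * Real.pi) = η 0 := by simpa using hper 0
    have e2 : E (2 * Real.pi) = E 0 := by
      simp only [hE]
      congr 1
      have := Complex.exp_int_mul_two_pi_mul_I k
      simp only [Complex.ofReal_mul, Complex.ofReal_ofNat, Complex.ofReal_zero, mul_zero, zero_mul,
        Complex.exp_zero]
      rw [← this]
      congr 1
      ring
    rw [e1, e2, sub_self]
  rw [hbdry, zero_sub] at hparts
  rw [hpair, hpair, ← intervalIntegral.integral_const_mul]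
  calc _ = ∫ x in (0 : ℝ)..2 * Real.pi, E x * ((deriv η x : ℝ) : ℂ) := by
        simp_rw [mul_comm]
    _ = _ := hparts
    _ = _ := by
        rw [← intervalIntegral.integral_neg]
        refine intervalIntegral.integral_congr fun x _ => ?_
        ring

theorem contDiff_deriv {η : ℝ → ℝ} (hη : ContDiff ℝ ∞ η) : ContDiff ℝ ∞ (deriv η) :=
  (contDiff_infty_iff_deriv.1 hη).2

theorem periodic_deriv {η : ℝ → ℝ} {T : ℝ} (hη : Function.Periodic η T) :
    Function.Periodic (deriv η) T := fun x => by
  rw [← deriv_comp_add_const]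
  congr 1
  exact funext hη

theorem pairing_iteratedDeriv_three_fourierVec (k : ℤ) {η : ℝ → ℝ} (hη : ContDiff ℝ ∞ η)
    (hper : Function.Periodic η (2 * Real.pi)) :
    pairing (iteratedDeriv 3 η) (fourierVec k) = Complex.I * k ^ 3 * pairing η (fourierVec k) := by
  rw [iteratedDeriv_succ, iteratedDeriv_succ, iteratedDeriv_one,
    pairing_deriv_fourierVec k (contDiff_deriv (contDiff_deriv hη))
      (periodic_deriv (periodic_deriv hper)),
    pairing_deriv_fourierVec k (contDiff_deriv hη) (periodic_deriv hper),
    pairing_deriv_fourierVec k hη hper]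
  linear_combination (-(Complex.I * k ^ 3) * pairing η (fourierVec k)) * Complex.I_sq

theorem pairing_smul {𝕜 : Type*} [RCLike 𝕜] (η : ℝ → ℝ) (z : 𝕜) (u : L2 𝕜) :
    pairing η (z • u) = z * pairing η u := by
  have hmp := AddCircle.measurePreserving_mk (2 * Real.pi) 0
  rw [zero_add] at hmp
  have hae := hmp.quasiMeasurePreserving.ae_eq_comp (Lp.coeFn_smul z u)
  unfold pairing
  rw [← intervalIntegral.integral_const_mul, intervalIntegral.integral_of_le Real.two_pi_pos.le,
    intervalIntegral.integral_of_le Real.two_pi_pos.le]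
  refine integral_congr_ae ?_
  filter_upwards [hae] with x hx
  simp only [Function.comp_apply, Pi.smul_apply] at hx
  rw [hx, smul_comm, smul_eq_mul]

/-- The mode `z e^{i w t} e^{ikx} (1, σ)` of the adjoint system. -/
noncomputable def modeSol (a c d r : ℝ) (j : ℤ × Bool) (z : ℂ) (t : ℝ) : H ℂ :=
  ((z * Complex.exp (freq a c d r j * t * Complex.I)) • fourierVec j.1,
    ((slope a c d r j : ℂ) * (z * Complex.exp (freq a c d r j * t * Complex.I))) • fourierVec j.1)

section

variable {a c d r : ℝ}

theorem isAdjointSolution_modeSol (ha : 0 < a) (hc : 0 < c) (hd : 0 < d) (j : ℤ × Bool) (z : ℂ) :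
    IsAdjointSolution a c d r (modeSol a c d r j z) := by
  have hE : ∀ t : ℝ, HasDerivAt (fun t : ℝ => z * Complex.exp (freq a c d r j * t * Complex.I))
      (Complex.I * freq a c d r j * (z * Complex.exp (freq a c d r j * t * Complex.I))) t := by
    intro t
    have : HasDerivAt (fun t : ℝ => (freq a c d r j : ℂ) * (t : ℂ) * Complex.I)
        ((freq a c d r j : ℂ) * Complex.I) t := by
      simpa using ((Complex.ofRealCLM.hasDerivAt (x := t)).const_mul
        (freq a c d r j : ℂ)).mul_const Complex.I
    refine (this.cexp.const_mul z).congr_deriv ?_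
    ring
  have h1 : freq a c d r j = (j.1 : ℝ) ^ 3 * (1 + d / c * slope a c d r j) := freq_eq hc hd j
  have h2 : freq a c d r j * slope a c d r j
      = a * (j.1 : ℝ) ^ 3 + (1 / c * (j.1 : ℝ) ^ 3 - r / c * j.1) * slope a c d r j := by
    rw [h1]
    have := slope_quadratic (r := r) ha hc hd j
    have hk := cube_mul_inv_sq j.1
    generalize 1 / (j.1 : ℝ) ^ 2 = y at this hk
    field_simp
    linear_combination ((j.1 : ℝ) ^ 3) * this - r * slope a c d r j * hk
  have h1' := congrArg (fun x : ℝ => (x : ℂ)) h1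
  have h2' := congrArg (fun x : ℝ => (x : ℂ)) h2
  push_cast at h1' h2'
  refine ⟨?_, fun η hη hper t => ?_, fun η hη hper t => ?_⟩
  · unfold modeSol
    fun_prop
  · simp only [modeSol, pairing_smul, pairing_iteratedDeriv_three_fourierVec j.1 hη hper]
    refine ((hE t).mul_const _).congr_deriv ?_
    rw [Complex.real_smul]
    push_cast
    linear_combination (Complex.I * (z * Complex.exp (freq a c d r j * t * Complex.I))
      * pairing η (fourierVec j.1)) * h1'
  · simp only [modeSol, pairing_smul, pairing_iteratedDeriv_three_fourierVec j.1 hη hper,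
      pairing_deriv_fourierVec j.1 hη hper]
    refine (((hE t).const_mul (slope a c d r j : ℂ)).mul_const _).congr_deriv ?_
    simp only [Complex.real_smul]
    push_cast
    linear_combination (Complex.I * (z * Complex.exp (freq a c d r j * t * Complex.I))
      * pairing η (fourierVec j.1)) * h2'

theorem memL2Loc_of_continuous {𝕜 : Type*} [RCLike 𝕜] {f : ℝ → 𝕜} (hf : Continuous f) :
    MemL2Loc f := fun R => by
  obtain ⟨C, hC⟩ := isCompact_Icc.exists_bound_of_continuousOn (hf.continuousOn (s := Set.Icc (-R) R))
  refine MemLp.of_bound hf.aestronglyMeasurable C ?_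
  exact (ae_restrict_iff' measurableSet_Icc).2 (Eventually.of_forall hC)

theorem fourierPartialSum_smul_fourierVec (N : ℕ) (k : ℤ) (z : ℂ) (x : Circ)
    (hN : k.natAbs ≤ N) : fourierPartialSum N (z • fourierVec k) x = fval x k * z := by
  rw [fourierPartialSum_eq, Finset.sum_eq_single k]
  · rw [coef, inner_smul_right]
    change _ * (z * coef k (fourierVec k)) = _
    rw [coef_fourierVec, if_pos rfl, mul_one]
  · intro n _ hn
    rw [coef, inner_smul_right]
    change _ * (z * coef n (fourierVec k)) = _
    rw [coef_fourierVec, if_neg hn, mul_zero, mul_zero]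
  · intro h
    exact absurd (Finset.mem_Icc.2 ⟨by omega, by omega⟩) h

theorem isTrace_smul_fourierVec (x : Circ) (k : ℤ) {q : ℝ → ℂ} (hq : Continuous q) :
    IsTrace x (fun t => q t • fourierVec k) (fun t => fval x k * q t) := by
  refine ⟨memL2Loc_of_continuous (by fun_prop), fun R => ?_⟩
  refine tendsto_const_nhds.congr' ?_
  filter_upwards [eventually_ge_atTop k.natAbs] with N hN
  simp only [fourierPartialSum_smul_fourierVec N k _ x hN, sub_self]
  rw [show (fun _ : ℝ => (0 : ℂ)) = 0 from rfl, eLpNorm_zero]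

end

section TimeSpace

theorem lp_norm_sq_eq_integral {α : Type*} [MeasurableSpace α] {μ : Measure α} (F : Lp ℂ 2 μ) :
    ‖F‖ ^ 2 = ∫ s, ‖F s‖ ^ 2 ∂μ := by
  have h := inner_self_eq_norm_sq_to_K (𝕜 := ℂ) F
  rw [L2.inner_def] at h
  have h2 : ∫ s, inner ℂ (F s) (F s) ∂μ = ((∫ s, ‖F s‖ ^ 2 ∂μ : ℝ) : ℂ) := by
    rw [← integral_complex_ofReal]
    refine integral_congr_ae (Eventually.of_forall fun s => ?_)
    simp only [inner_self_eq_norm_sq_to_K]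
    push_cast
    rfl
  rw [h2] at h
  refine (Complex.ofReal_injective ?_).symm
  rw [h]
  push_cast
  rfl

/-- Lebesgue measure on `(0, T)`. -/
noncomputable abbrev timeMeasure (T : ℝ) : Measure ℝ := volume.restrict (Set.Ioc 0 T)

theorem memLp_timeMeasure (T : ℝ) (φ : C(ℝ, ℂ)) : MemLp φ 2 (timeMeasure T) := by
  have h := memL2Loc_of_continuous φ.continuous |T|
  refine h.mono_measure (Measure.restrict_mono ?_ le_rfl)
  intro s hs
  have := le_abs_self T
  exact ⟨by linarith [hs.1, abs_nonneg T], hs.2.trans this⟩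

/-- Restriction of continuous functions to `(0, T)`, as elements of `L²`. -/
noncomputable def contToLp (T : ℝ) : C(ℝ, ℂ) →ₗ[ℂ] Lp ℂ 2 (timeMeasure T) where
  toFun φ := (memLp_timeMeasure T φ).toLp
  map_add' _ _ := rfl
  map_smul' _ _ := rfl

theorem coeFn_contToLp (T : ℝ) (φ : C(ℝ, ℂ)) : contToLp T φ =ᵐ[timeMeasure T] φ :=
  (memLp_timeMeasure T φ).coeFn_toLp

theorem norm_contToLp_sq {T : ℝ} (hT : 0 ≤ T) (φ : C(ℝ, ℂ)) :
    ‖contToLp T φ‖ ^ 2 = ∫ s in (0 : ℝ)..T, ‖φ s‖ ^ 2 := by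
  rw [lp_norm_sq_eq_integral, intervalIntegral.integral_of_le hT]
  refine integral_congr_ae ?_
  filter_upwards [coeFn_contToLp T φ] with s hs
  rw [hs]

theorem inner_contToLp (T : ℝ) (φ : C(ℝ, ℂ)) (F : Lp ℂ 2 (timeMeasure T)) :
    inner ℂ (contToLp T φ) F = ∫ s in Set.Ioc 0 T, (starRingEnd ℂ) (φ s) * F s := by
  rw [L2.inner_def]
  refine integral_congr_ae ?_
  filter_upwards [coeFn_contToLp T φ] with s hs
  rw [hs, RCLike.inner_apply, mul_comm]

/-- The truncation of an element of `L²(0, T)` to times at most `t`. -/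
noncomputable def truncate {T : ℝ} (F : Lp ℂ 2 (timeMeasure T)) (t : ℝ) : Lp ℂ 2 (timeMeasure T) :=
  ((Lp.memLp F).indicator (measurableSet_Iic (a := t))).toLp

theorem coeFn_truncate {T : ℝ} (F : Lp ℂ 2 (timeMeasure T)) (t : ℝ) :
    truncate F t =ᵐ[timeMeasure T] (Set.Iic t).indicator F := MemLp.coeFn_toLp _

theorem truncate_self {T : ℝ} (F : Lp ℂ 2 (timeMeasure T)) : truncate F T = F := by
  refine Lp.ext ((coeFn_truncate F T).trans ?_)
  refine (ae_restrict_iff' measurableSet_Ioc).2 (Eventually.of_forall fun s hs => ?_)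
  exact Set.indicator_of_mem (Set.mem_Iic.2 hs.2) _

theorem continuous_truncate {T : ℝ} (F : Lp ℂ 2 (timeMeasure T)) : Continuous (truncate F) := by
  refine continuous_iff_continuousAt.2 fun t₀ => tendsto_iff_norm_sub_tendsto_zero.2 ?_
  have hF2 : Integrable (fun s => ‖F s‖ ^ 2) (timeMeasure T) :=
    (Lp.memLp F).integrable_norm_pow (by norm_num)
  have hnorm : ∀ t, ‖truncate F t - truncate F t₀‖ ^ 2
      = ∫ s, ‖(Set.Iic t).indicator F s - (Set.Iic t₀).indicator F s‖ ^ 2 ∂timeMeasure T := by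
    intro t
    rw [lp_norm_sq_eq_integral]
    refine integral_congr_ae ?_
    filter_upwards [Lp.coeFn_sub (truncate F t) (truncate F t₀), coeFn_truncate F t,
      coeFn_truncate F t₀] with s h1 h2 h3
    rw [h1, Pi.sub_apply, h2, h3]
  have h : Tendsto (fun t => ‖truncate F t - truncate F t₀‖ ^ 2) (𝓝 t₀) (𝓝 0) := by
    simp_rw [hnorm]
    rw [show (0 : ℝ) = ∫ s, (0 : ℝ) ∂timeMeasure T by simp]
    refine tendsto_integral_filter_of_dominated_convergence (fun s => ‖F s‖ ^ 2)
      (Eventually.of_forall fun t => ?_) (Eventually.of_forall fun t => Eventually.of_forall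
        fun s => ?_) hF2 ?_
    · have hm := (Lp.memLp F).aestronglyMeasurable
      exact (((hm.indicator measurableSet_Iic).sub (hm.indicator measurableSet_Iic)).norm).pow 2
    · rw [Real.norm_eq_abs, abs_of_nonneg (sq_nonneg _)]
      gcongr
      by_cases h1 : s ∈ Set.Iic t <;> by_cases h2 : s ∈ Set.Iic t₀ <;>
        simp [Set.indicator_of_mem, Set.indicator_of_notMem, h1, h2]
    · have hne : ∀ᵐ s ∂timeMeasure T, s ≠ t₀ :=
        ae_restrict_of_ae (Measure.ae_ne volume t₀)
      filter_upwards [hne] with s hs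
      refine tendsto_const_nhds.congr' ?_
      rcases lt_or_gt_of_ne hs with hlt | hgt
      · filter_upwards [eventually_gt_nhds hlt] with t ht
        rw [Set.indicator_of_mem (Set.mem_Iic.2 ht.le), Set.indicator_of_mem (Set.mem_Iic.2 hlt.le)]
        simp
      · filter_upwards [eventually_lt_nhds hgt] with t ht
        rw [Set.indicator_of_notMem (by simpa using ht),
          Set.indicator_of_notMem (by simpa using hgt)]
        simp
  have h2 := h.sqrt
  simpa using h2

theorem integral_truncate {T : ℝ} (F : Lp ℂ 2 (timeMeasure T)) (φ : C(ℝ, ℂ)) (t : ℝ) :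
    inner ℂ (contToLp T φ) (truncate F t)
      = ∫ s in (0 : ℝ)..t, (Set.Ioc 0 T).indicator F s * (starRingEnd ℂ) (φ s) := by
  have h1 : inner ℂ (contToLp T φ) (truncate F t)
      = ∫ s in Set.Ioc 0 T ∩ Set.Iic t, F s * (starRingEnd ℂ) (φ s) := by
    rw [inner_contToLp, ← setIntegral_indicator measurableSet_Iic]
    refine integral_congr_ae ?_
    filter_upwards [coeFn_truncate F t] with s hs
    rw [hs]
    by_cases h : s ∈ Set.Iic t
    · rw [Set.indicator_of_mem h, Set.indicator_of_mem h, mul_comm]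
    · rw [Set.indicator_of_notMem h, Set.indicator_of_notMem h, mul_zero]
  have h2 : ∀ A : Set ℝ, ∫ s in A, (Set.Ioc 0 T).indicator F s * (starRingEnd ℂ) (φ s)
      = ∫ s in A ∩ Set.Ioc 0 T, F s * (starRingEnd ℂ) (φ s) := by
    intro A
    rw [← setIntegral_indicator measurableSet_Ioc]
    congr 1
    funext s
    by_cases h : s ∈ Set.Ioc 0 T
    · rw [Set.indicator_of_mem h, Set.indicator_of_mem h]
    · rw [Set.indicator_of_notMem h, Set.indicator_of_notMem h, zero_mul]
  rw [h1]
  rcases le_total 0 t with ht | ht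
  · rw [intervalIntegral.integral_of_le ht, h2]
    congr 2
    ext s
    simp only [Set.mem_inter_iff, Set.mem_Ioc, Set.mem_Iic]
    tauto
  · rw [intervalIntegral.integral_of_ge ht, h2]
    have e1 : Set.Ioc 0 T ∩ Set.Iic t = ∅ := by
      ext s
      simp only [Set.mem_inter_iff, Set.mem_Ioc, Set.mem_Iic, Set.mem_empty_iff_false, iff_false]
      rintro ⟨⟨h3, _⟩, h4⟩
      linarith
    have e2 : Set.Ioc t 0 ∩ Set.Ioc 0 T = ∅ := by
      ext s
      simp only [Set.mem_inter_iff, Set.mem_Ioc, Set.mem_empty_iff_false, iff_false]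
      rintro ⟨⟨_, h3⟩, h4, _⟩
      linarith
    rw [e1, e2]
    simp

theorem memL2Loc_indicator {T : ℝ} (F : Lp ℂ 2 (timeMeasure T)) :
    MemL2Loc ((Set.Ioc 0 T).indicator F) := fun _ =>
  ((memLp_indicator_iff_restrict measurableSet_Ioc).2 (Lp.memLp F)).restrict _

end TimeSpace

theorem MemL2Loc.intervalIntegrable {f : ℝ → ℂ} (hf : MemL2Loc f) (a b : ℝ) :
    IntervalIntegrable f volume a b := by
  have h : IntegrableOn f (Set.Icc (-(max |a| |b|)) (max |a| |b|)) :=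
    (hf _).integrable (by norm_num)
  refine (h.mono_set ?_).intervalIntegrable
  have h1 := abs_le.1 (le_max_left |a| |b|)
  have h2 := abs_le.1 (le_max_right |a| |b|)
  exact Set.uIcc_subset_Icc ⟨h1.1, h1.2⟩ ⟨h2.1, h2.2⟩

section

variable {w σ : ℤ × Bool → ℝ} {s : Bool → ℝ} {s₀ B T₀ : ℝ}

/-- The function `e^{iwt} e^{ikx₀} / √(2π)` of time. -/
noncomputable def modeVal (w : ℤ × Bool → ℝ) (x₀ : Circ) (j : ℤ × Bool) : C(ℝ, ℂ) :=
  ⟨fun t => fval x₀ j.1 * Complex.exp (w j * t * Complex.I), by fun_prop⟩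

/-- The trace of a mode in `L²(0, T)²`. -/
noncomputable def modeTrace (w σ : ℤ × Bool → ℝ) (x₀ : Circ) (T : ℝ) (j : ℤ × Bool) :
    WithLp 2 (Lp ℂ 2 (timeMeasure T) × Lp ℂ 2 (timeMeasure T)) :=
  WithLp.toLp 2 (contToLp T (modeVal w x₀ j), contToLp T ((σ j : ℂ) • modeVal w x₀ j))

theorem norm_sum_modeTrace_sq (w σ : ℤ × Bool → ℝ) (x₀ : Circ) {T : ℝ} (hT : 0 ≤ T)
    (S : Finset (ℤ × Bool)) (c : ℤ × Bool → ℂ) :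
    ‖∑ j ∈ S, c j • modeTrace w σ x₀ T j‖ ^ 2
      = ∫ t in (0 : ℝ)..T, obs S w σ (fun j => fval x₀ j.1 * c j) t := by
  have h1 : ∑ j ∈ S, c j • modeTrace w σ x₀ T j
      = WithLp.toLp 2 (contToLp T (∑ j ∈ S, c j • modeVal w x₀ j),
        contToLp T (∑ j ∈ S, c j • (σ j : ℂ) • modeVal w x₀ j)) := by
    simp only [modeTrace, map_sum, map_smul, ← WithLp.toLp_smul, ← WithLp.toLp_sum]
    congr 1
    exact Prod.ext (by simp only [Prod.fst_sum, Prod.smul_fst])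
      (by simp only [Prod.snd_sum, Prod.smul_snd])
  rw [h1, WithLp.prod_norm_sq_eq_of_L2]
  change ‖contToLp T _‖ ^ 2 + ‖contToLp T _‖ ^ 2 = _
  rw [norm_contToLp_sq hT, norm_contToLp_sq hT, integral_obs]
  congr 1
  · refine intervalIntegral.integral_congr fun t _ => ?_
    simp only [expSum, ContinuousMap.coe_sum, Finset.sum_apply]
    congr 2
    refine Finset.sum_congr rfl fun j _ => ?_
    simp only [modeVal, ContinuousMap.coe_smul, ContinuousMap.coe_mk, Pi.smul_apply, smul_eq_mul]
    ring
  · refine intervalIntegral.integral_congr fun t _ => ?_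
    simp only [expSum, ContinuousMap.coe_sum, Finset.sum_apply]
    congr 2
    refine Finset.sum_congr rfl fun j _ => ?_
    simp only [modeVal, ContinuousMap.coe_smul, ContinuousMap.coe_mk, Pi.smul_apply, smul_eq_mul]
    ring

/-- Solution of the moment problem for the traces of the modes. -/
theorem IsModeFamily.exists_control (h : IsModeFamily w σ s s₀ B T₀) (x₀ : Circ) {T : ℝ}
    (hT : T₀ < T) (z : lp (fun _ : ℤ × Bool => ℂ) 2) :
    ∃ f g : ℝ → ℂ, MemL2Loc f ∧ MemL2Loc g ∧ ∃ Z : ℝ → lp (fun _ : ℤ × Bool => ℂ) 2,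
      Continuous Z ∧ Z T = z ∧ ∀ t j, Z t j = ∫ s in (0 : ℝ)..t,
        (f s + σ j * g s) * (starRingEnd ℂ) (fval x₀ j.1 * Complex.exp (w j * s * Complex.I)) := by
  have hT0 : 0 < T := h.time_nonneg.trans_lt hT
  obtain ⟨M, hM, hup⟩ := h.exists_obs_le hT
  obtain ⟨C, hC, hlow⟩ := h.inverseIneq hT
  have hn := nrm_pos
  have hsum : ∀ (S : Finset (ℤ × Bool)) (c : ℤ × Bool → ℂ),
      ∑ j ∈ S, ‖fval x₀ j.1 * c j‖ ^ 2 = nrm ^ 2 * ∑ j ∈ S, ‖c j‖ ^ 2 := by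
    intro S c
    rw [Finset.mul_sum]
    refine Finset.sum_congr rfl fun j _ => ?_
    rw [norm_mul, norm_fval, mul_pow]
  have hup' : ∀ (S : Finset (ℤ × Bool)) (c : ℤ × Bool → ℂ),
      ‖∑ j ∈ S, c j • modeTrace w σ x₀ T j‖ ^ 2 ≤ (M * nrm ^ 2) * ∑ j ∈ S, ‖c j‖ ^ 2 := by
    intro S c
    rw [norm_sum_modeTrace_sq w σ x₀ hT0.le, mul_assoc, ← hsum]
    exact hup S _
  have hlow' : ∀ (S : Finset (ℤ × Bool)) (c : ℤ × Bool → ℂ),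
      ∑ j ∈ S, ‖c j‖ ^ 2 ≤ (C / nrm ^ 2) * ‖∑ j ∈ S, c j • modeTrace w σ x₀ T j‖ ^ 2 := by
    intro S c
    rw [norm_sum_modeTrace_sq w σ x₀ hT0.le, div_mul_eq_mul_div, le_div_iff₀ (by positivity),
      mul_comm, ← hsum]
    exact hlow S _ (by simp)
  set A := analysisOp (modeTrace w σ x₀ T) (M * nrm ^ 2) (by positivity) hup' with hA
  obtain ⟨y, hy⟩ := analysisOp_surjective (modeTrace w σ x₀ T) (M * nrm ^ 2) (by positivity) hup'
    hlow' (by positivity) z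
  have hval : ∀ t j, A (WithLp.toLp 2 (truncate y.fst t, truncate y.snd t)) j
      = ∫ s in (0 : ℝ)..t, ((Set.Ioc 0 T).indicator y.fst s + σ j * (Set.Ioc 0 T).indicator y.snd s)
        * (starRingEnd ℂ) (fval x₀ j.1 * Complex.exp (w j * s * Complex.I)) := by
    intro t j
    have hi : ∀ F : Lp ℂ 2 (timeMeasure T), IntervalIntegrable (fun s =>
        (Set.Ioc 0 T).indicator F s * (starRingEnd ℂ) (modeVal w x₀ j s)) volume 0 t := fun F =>
      ((memL2Loc_indicator F).intervalIntegrable 0 t).mul_continuousOn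
        (Complex.continuous_conj.comp (modeVal w x₀ j).continuous).continuousOn
    rw [hA, analysisOp_apply, modeTrace, WithLp.prod_inner_apply]
    change inner ℂ (contToLp T (modeVal w x₀ j)) (truncate y.fst t)
      + inner ℂ (contToLp T ((σ j : ℂ) • modeVal w x₀ j)) (truncate y.snd t) = _
    rw [map_smul, inner_smul_left, Complex.conj_ofReal, integral_truncate, integral_truncate,
      ← intervalIntegral.integral_const_mul,
      ← intervalIntegral.integral_add (hi _) ((hi _).const_mul _)]
    refine intervalIntegral.integral_congr fun s _ => ?_
    change _ = _ * (starRingEnd ℂ) (modeVal w x₀ j s)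
    ring
  refine ⟨_, _, memL2Loc_indicator y.fst, memL2Loc_indicator y.snd,
    fun t => A (WithLp.toLp 2 (truncate y.fst t, truncate y.snd t)), ?_, ?_, hval⟩
  · refine A.continuous.comp ?_
    exact (WithLp.prod_continuous_toLp 2 _ _).comp
      ((continuous_truncate _).prodMk (continuous_truncate _))
  · simp only [truncate_self]
    exact hy

end

theorem intervalIntegrable_mul_conj {𝕜 : Type*} [RCLike 𝕜] {f p : ℝ → 𝕜} (hf : MemL2Loc f) (hp : MemL2Loc p) (t : ℝ) :
    IntervalIntegrable (fun s => f s * starRingEnd 𝕜 (p s)) volume 0 t := by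
  have h1 : IntegrableOn (fun s => f s * starRingEnd 𝕜 (p s)) (Set.Icc (-|t|) |t|) :=
    (hf |t|).integrable_mul (hp |t|).star
  refine (h1.mono_set (Set.uIcc_subset_Icc ⟨?_, abs_nonneg t⟩ ?_)).intervalIntegrable
  · simp
  · exact ⟨neg_abs_le t, le_abs_self t⟩

/-- Convergence of integrals of products, one factor converging in `L²_loc`. -/
theorem tendsto_integral_mul_conj {f p : ℝ → ℂ} {q : ℕ → ℝ → ℂ} (hf : MemL2Loc f)
    (hp : MemL2Loc p) (hq : ∀ N, MemL2Loc (q N))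
    (hlim : ∀ R : ℝ, Tendsto (fun N => eLpNorm (fun t => q N t - p t) 2
      (volume.restrict (Set.Icc (-R) R))) atTop (𝓝 0)) (t : ℝ) :
    Tendsto (fun N => ∫ s in (0 : ℝ)..t, f s * (starRingEnd ℂ) (q N s)) atTop
      (𝓝 (∫ s in (0 : ℝ)..t, f s * (starRingEnd ℂ) (p s))) := by
  set μ : Measure ℝ := volume.restrict (Set.Icc (-|t|) |t|) with hμ
  have hconj : ∀ {g : ℝ → ℂ}, MemLp g 2 μ → MemLp (fun s => (starRingEnd ℂ) (g s)) 2 μ :=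
    fun hg => hg.star
  have hL1 : ∀ {g : ℝ → ℂ}, MemLp g 2 μ →
      Integrable (fun s => f s * (starRingEnd ℂ) (g s)) μ := fun hg =>
    (hf |t|).integrable_mul (hconj hg)
  have hnorm : ∀ N, eLpNorm ((fun s => f s * (starRingEnd ℂ) (q N s))
      - fun s => f s * (starRingEnd ℂ) (p s)) 1 μ
      ≤ eLpNorm f 2 μ * eLpNorm (fun s => q N s - p s) 2 μ := by
    intro N
    have hsub : MemLp (fun s => q N s - p s) 2 μ := (hq N |t|).sub (hp |t|)
    have e : ((fun s => f s * (starRingEnd ℂ) (q N s)) - fun s => f s * (starRingEnd ℂ) (p s))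
        = f • fun s => (starRingEnd ℂ) (q N s - p s) := by
      funext s
      simp only [Pi.sub_apply, Pi.smul_apply', smul_eq_mul, map_sub]
      ring
    rw [e]
    refine (eLpNorm_smul_le_mul_eLpNorm (p := 2) (q := 2) (r := 1)
      (hconj hsub).aestronglyMeasurable (hf |t|).aestronglyMeasurable).trans (le_of_eq ?_)
    congr 1
    exact eLpNorm_congr_norm_ae (Eventually.of_forall fun s => RCLike.norm_conj _)
  have hzero : Tendsto (fun N => eLpNorm f 2 μ * eLpNorm (fun s => q N s - p s) 2 μ) atTop
      (𝓝 0) := by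
    have := ENNReal.Tendsto.const_mul (hlim |t|) (Or.inr (hf |t|).eLpNorm_ne_top)
    rwa [mul_zero] at this
  have hset := tendsto_setIntegral_of_L1' (fun s => f s * (starRingEnd ℂ) (p s))
    (hL1 (hp |t|)).aestronglyMeasurable
    (F := fun N s => f s * (starRingEnd ℂ) (q N s)) (l := atTop)
    (Eventually.of_forall fun N => hL1 (hq N |t|))
    (tendsto_of_tendsto_of_tendsto_of_le_of_le tendsto_const_nhds hzero (fun _ => zero_le)
      hnorm) (Set.uIoc 0 t)
  have hsub : Set.uIoc 0 t ⊆ Set.Icc (-|t|) |t| := by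
    refine Set.uIoc_subset_uIcc.trans (Set.uIcc_subset_Icc ⟨?_, abs_nonneg t⟩ ?_)
    · simp
    · exact ⟨neg_abs_le t, le_abs_self t⟩
  rw [hμ, Measure.restrict_restrict_of_subset hsub] at hset
  simp_rw [intervalIntegral.intervalIntegral_eq_integral_uIoc]
  exact hset.const_smul _

section

variable {a c d r : ℝ}

/-- The mode coordinates `û + σ v̂` of a state `(u, v)`. -/
noncomputable def modeCoord (a c d r : ℝ) (V : H ℂ) (j : ℤ × Bool) : ℂ :=
  coef j.1 V.1 + slope a c d r j * coef j.1 V.2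

theorem slope_sub_ne_zero (ha : 0 < a) (hc : 0 < c) (hd : 0 < d) (hr : 0 < r) (k : ℤ) :
    slope a c d r (k, true) - slope a c d r (k, false) ≠ 0 := by
  obtain ⟨s₀, B, hs₀, hb⟩ := slopeFun_bounds ha hc hd hr
  have := hb _ (inv_sq_mem k).1 (inv_sq_mem k).2
  have h1 : s₀ ≤ slope a c d r (k, true) := this.1
  have h2 : slope a c d r (k, false) ≤ -s₀ := this.2.1
  linarith

theorem ext_modeCoord (ha : 0 < a) (hc : 0 < c) (hd : 0 < d) (hr : 0 < r) {V W : H ℂ}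
    (h : ∀ j, modeCoord a c d r V j = modeCoord a c d r W j) : V = W := by
  have hne : ∀ k : ℤ, ((slope a c d r (k, true) : ℂ) - slope a c d r (k, false)) ≠ 0 := fun k => by
    rw [← Complex.ofReal_sub]
    exact_mod_cast slope_sub_ne_zero ha hc hd hr k
  refine Prod.ext (ext_coef fun k => ?_) (ext_coef fun k => ?_)
  all_goals
    have ht := h (k, true)
    have hf := h (k, false)
    simp only [modeCoord] at ht hf
    refine mul_left_cancel₀ (hne k) ?_
  · linear_combination (slope a c d r (k, true) : ℂ) * hf - (slope a c d r (k, false) : ℂ) * ht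
  · linear_combination ht - hf

/-- Reconstruction of a state from its mode coordinates. -/
theorem exists_state (ha : 0 < a) (hc : 0 < c) (hd : 0 < d) (hr : 0 < r) :
    ∃ L : lp (fun _ : ℤ × Bool => ℂ) 2 → H ℂ, Continuous L ∧
      ∀ y j, modeCoord a c d r (L y) j = y j := by
  obtain ⟨s₀, B, hs₀, hb⟩ := slopeFun_bounds ha hc hd hr
  have hb' : ∀ k : ℤ, s₀ ≤ slope a c d r (k, true) ∧ slope a c d r (k, false) ≤ -s₀ ∧
      ∀ b, |slope a c d r (k, b)| ≤ B := fun k => hb _ (inv_sq_mem k).1 (inv_sq_mem k).2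
  have hB : 0 ≤ B := (abs_nonneg _).trans ((hb' 0).2.2 true)
  set Δ : ℤ → ℝ := fun k => slope a c d r (k, true) - slope a c d r (k, false) with hΔ
  have hΔlow : ∀ k, 2 * s₀ ≤ Δ k := fun k => by
    have := hb' k
    simp only [hΔ]
    linarith
  have hm : ∀ (m : ℤ → ℝ) (C : ℝ), (∀ k, |m k| ≤ C) → ∀ k,
      ‖((m k / Δ k : ℝ) : ℂ)‖ ≤ C / (2 * s₀) := by
    intro m C hm k
    have := hΔlow k
    rw [Complex.norm_real, Real.norm_eq_abs, abs_div, abs_of_pos (by linarith : 0 < Δ k)]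
    have := hm k
    have := (abs_nonneg _).trans this
    gcongr
  have hinj : ∀ b : Bool, Function.Injective fun k : ℤ => (k, b) := fun b k n h =>
    congrArg Prod.fst h
  set O : (m : ℤ → ℝ) → (C : ℝ) → 0 ≤ C → (∀ k, |m k| ≤ C) → Bool →
      lp (fun _ : ℤ × Bool => ℂ) 2 →L[ℂ] lp (fun _ : ℤ => ℂ) 2 := fun m C hC hmC b =>
    mulComp (fun k => ((m k / Δ k : ℝ) : ℂ)) (C / (2 * s₀)) (by positivity) (hm m C hmC)
      (fun k => (k, b)) (hinj b) with hO
  set S₁ := O (fun k => slope a c d r (k, true)) B hB (fun k => (hb' k).2.2 true) false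
  set S₂ := O (fun k => slope a c d r (k, false)) B hB (fun k => (hb' k).2.2 false) true
  set S₃ := O (fun _ => 1) 1 zero_le_one (fun _ => by simp) true
  set S₄ := O (fun _ => 1) 1 zero_le_one (fun _ => by simp) false
  refine ⟨fun y => (circBasis.repr.symm (S₁ y - S₂ y), circBasis.repr.symm (S₃ y - S₄ y)),
    by fun_prop, fun y j => ?_⟩
  rcases j with ⟨k, b⟩
  have hΔk : (Δ k : ℂ) ≠ 0 := by
    have := hΔlow k
    exact_mod_cast (by linarith : 0 < Δ k).ne'
  have e1 : coef k (circBasis.repr.symm (S₁ y - S₂ y))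
      = (slope a c d r (k, true) * y (k, false) - slope a c d r (k, false) * y (k, true)) / Δ k := by
    rw [← circBasis_repr, LinearIsometryEquiv.apply_symm_apply]
    change ((slope a c d r (k, true) / Δ k : ℝ) : ℂ) * y (k, false)
      - ((slope a c d r (k, false) / Δ k : ℝ) : ℂ) * y (k, true) = _
    push_cast
    ring
  have e2 : coef k (circBasis.repr.symm (S₃ y - S₄ y)) = (y (k, true) - y (k, false)) / Δ k := by
    rw [← circBasis_repr, LinearIsometryEquiv.apply_symm_apply]
    change ((1 / Δ k : ℝ) : ℂ) * y (k, true) - ((1 / Δ k : ℝ) : ℂ) * y (k, false) = _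
    push_cast
    ring
  simp only [modeCoord]
  rw [e1, e2]
  have hΔe : (Δ k : ℂ) = slope a c d r (k, true) - slope a c d r (k, false) := by
    simp only [hΔ]; push_cast; rfl
  cases b
  · field_simp
    rw [hΔe]
    ring
  · field_simp
    rw [hΔe]
    ring

/-- A state whose scalar products with all modes at time `t` vanish is zero. -/
theorem eq_zero_of_inner_modeSol (ha : 0 < a) (hc : 0 < c) (hd : 0 < d) (hr : 0 < r) (t : ℝ)
    {W : H ℂ} (h : ∀ j, inner ℂ (modeSol a c d r j 1 t).1 W.1
      + inner ℂ (modeSol a c d r j 1 t).2 W.2 = 0) : W = 0 := by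
  refine ext_modeCoord ha hc hd hr fun j => ?_
  have hj := h j
  simp only [modeSol, inner_smul_left, map_mul, one_mul, Complex.conj_ofReal] at hj
  have hE : (starRingEnd ℂ) (Complex.exp (freq a c d r j * t * Complex.I)) ≠ 0 := by
    rw [Ne, map_eq_zero]
    exact Complex.exp_ne_zero _
  have h0 : modeCoord a c d r 0 j = 0 := by
    simp [modeCoord, coef]
  rw [h0]
  refine mul_left_cancel₀ hE ?_
  rw [mul_zero, ← hj, modeCoord, coef, coef]
  ring

theorem exists_isTrace_modeSol (x₀ : Circ) (j : ℤ × Bool) (z : ℂ) :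
    ∃ p q : ℝ → ℂ, IsTrace x₀ (fun t => (modeSol a c d r j z t).1) p ∧
      IsTrace x₀ (fun t => (modeSol a c d r j z t).2) q :=
  ⟨_, _, isTrace_smul_fourierVec x₀ j.1 (by fun_prop), isTrace_smul_fourierVec x₀ j.1 (by fun_prop)⟩

/-- A state with the mode coordinates given by Duhamel's formula solves the problem in the sense of
transposition. -/
theorem transposition_of_modeCoord (ha : 0 < a) (hc : 0 < c) (hd : 0 < d) (hr : 0 < r) {x₀ : Circ}
    {f g : ℝ → ℂ} (hf : MemL2Loc f) (hg : MemL2Loc g) {U₀ : H ℂ} {U : ℝ → H ℂ}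
    (hU : ∀ t j, modeCoord a c d r (U t) j = Complex.exp (freq a c d r j * t * Complex.I)
      * (modeCoord a c d r U₀ j + ∫ s in (0 : ℝ)..t, (f s + slope a c d r j * g s)
        * (starRingEnd ℂ) (fval x₀ j.1 * Complex.exp (freq a c d r j * s * Complex.I))))
    {Φ : ℝ → H ℂ} {p q : ℝ → ℂ} (hΦ : IsAdjointSolution a c d r Φ)
    (hp : IsTrace x₀ (fun t => (Φ t).1) p) (hq : IsTrace x₀ (fun t => (Φ t).2) q) (t : ℝ) :
    inner ℂ (Φ t).1 (U t).1 + inner ℂ (Φ t).2 (U t).2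
      = inner ℂ (Φ 0).1 U₀.1 + inner ℂ (Φ 0).2 U₀.2
        + ∫ s in (0 : ℝ)..t, (f s * starRingEnd ℂ (p s) + g s * starRingEnd ℂ (q s)) := by
  obtain ⟨P, hP⟩ := hΦ.exists_modes ha hc hd (slope_sub_ne_zero ha hc hd hr)
  have hΦ1 : ∀ k, Continuous fun s => coef k (Φ s).1 := fun k =>
    (continuous_coef k).comp (continuous_fst.comp hΦ.continuous)
  have hΦ2 : ∀ k, Continuous fun s => coef k (Φ s).2 := fun k =>
    (continuous_coef k).comp (continuous_snd.comp hΦ.continuous)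
  have hint : ∀ {f φ : ℝ → ℂ}, MemL2Loc f → Continuous φ → ∀ t,
      IntervalIntegrable (fun s => f s * (starRingEnd ℂ) (φ s)) volume 0 t := fun hf hφ t =>
    (hf.intervalIntegrable 0 t).mul_continuousOn (Complex.continuous_conj.comp hφ).continuousOn
  have hmode : ∀ k, (starRingEnd ℂ) (coef k (Φ t).1) * coef k (U t).1
      + (starRingEnd ℂ) (coef k (Φ t).2) * coef k (U t).2
      = (starRingEnd ℂ) (coef k (Φ 0).1) * coef k U₀.1
        + (starRingEnd ℂ) (coef k (Φ 0).2) * coef k U₀.2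
        + ((∫ s in (0 : ℝ)..t, f s * (starRingEnd ℂ) (fval x₀ k * coef k (Φ s).1))
          + ∫ s in (0 : ℝ)..t, g s * (starRingEnd ℂ) (fval x₀ k * coef k (Φ s).2)) := by
    intro k
    have hterm : ∀ b, (starRingEnd ℂ) (P (k, b) * Complex.exp (freq a c d r (k, b) * t * Complex.I))
        * modeCoord a c d r (U t) (k, b)
        = (starRingEnd ℂ) (P (k, b)) * modeCoord a c d r U₀ (k, b)
          + ∫ s in (0 : ℝ)..t, (f s + slope a c d r (k, b) * g s) * (starRingEnd ℂ)
            (fval x₀ k * (P (k, b) * Complex.exp (freq a c d r (k, b) * s * Complex.I))) := by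
      intro b
      have hE : (starRingEnd ℂ) (Complex.exp (freq a c d r (k, b) * t * Complex.I))
          * Complex.exp (freq a c d r (k, b) * t * Complex.I) = 1 := by
        rw [Complex.conj_mul', norm_exp_freq]
        norm_num
      have hI : ∫ s in (0 : ℝ)..t, (f s + slope a c d r (k, b) * g s) * (starRingEnd ℂ)
            (fval x₀ k * (P (k, b) * Complex.exp (freq a c d r (k, b) * s * Complex.I)))
          = (starRingEnd ℂ) (P (k, b)) * ∫ s in (0 : ℝ)..t, (f s + slope a c d r (k, b) * g s)
            * (starRingEnd ℂ) (fval x₀ k * Complex.exp (freq a c d r (k, b) * s * Complex.I)) := by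
        rw [← intervalIntegral.integral_const_mul]
        refine intervalIntegral.integral_congr fun s _ => ?_
        simp only [map_mul]
        ring
      rw [hU, hI, map_mul]
      linear_combination ((starRingEnd ℂ) (P (k, b)) * (modeCoord a c d r U₀ (k, b)
        + ∫ s in (0 : ℝ)..t, (f s + slope a c d r (k, b) * g s) * (starRingEnd ℂ)
          (fval x₀ k * Complex.exp (freq a c d r (k, b) * s * Complex.I)))) * hE
    have hsplit : ∀ b, ∫ s in (0 : ℝ)..t, (f s + slope a c d r (k, b) * g s) * (starRingEnd ℂ)
            (fval x₀ k * (P (k, b) * Complex.exp (freq a c d r (k, b) * s * Complex.I)))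
        = (∫ s in (0 : ℝ)..t, f s * (starRingEnd ℂ)
            (fval x₀ k * (P (k, b) * Complex.exp (freq a c d r (k, b) * s * Complex.I))))
          + ∫ s in (0 : ℝ)..t, g s * (starRingEnd ℂ) (fval x₀ k * (slope a c d r (k, b)
            * (P (k, b) * Complex.exp (freq a c d r (k, b) * s * Complex.I)))) := by
      intro b
      rw [← intervalIntegral.integral_add (hint hf (by fun_prop) t) (hint hg (by fun_prop) t)]
      refine intervalIntegral.integral_congr fun s _ => ?_
      simp only [map_mul, Complex.conj_ofReal]
      ring
    have hf' : ∫ s in (0 : ℝ)..t, f s * (starRingEnd ℂ) (fval x₀ k * coef k (Φ s).1)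
        = ∑ b, ∫ s in (0 : ℝ)..t, f s * (starRingEnd ℂ)
          (fval x₀ k * (P (k, b) * Complex.exp (freq a c d r (k, b) * s * Complex.I))) := by
      rw [← intervalIntegral.integral_finsetSum fun b _ => hint hf (by fun_prop) t]
      refine intervalIntegral.integral_congr fun s _ => ?_
      simp only [(hP k s).1, Finset.mul_sum, map_sum]
    have hg' : ∫ s in (0 : ℝ)..t, g s * (starRingEnd ℂ) (fval x₀ k * coef k (Φ s).2)
        = ∑ b, ∫ s in (0 : ℝ)..t, g s * (starRingEnd ℂ) (fval x₀ k * (slope a c d r (k, b)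
          * (P (k, b) * Complex.exp (freq a c d r (k, b) * s * Complex.I)))) := by
      rw [← intervalIntegral.integral_finsetSum fun b _ => hint hg (by fun_prop) t]
      refine intervalIntegral.integral_congr fun s _ => ?_
      simp only [(hP k s).2, Finset.mul_sum, map_sum]
    have h0 := hP k 0
    simp only [Complex.ofReal_zero, mul_zero, zero_mul, Complex.exp_zero, mul_one] at h0
    have ht := hterm true
    have hfa := hterm false
    rw [hsplit] at ht hfa
    rw [hf', hg', (hP k t).1, (hP k t).2, h0.1, h0.2]
    simp only [Fintype.sum_bool, map_add, map_mul, Complex.conj_ofReal] at ht hfa ⊢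
    simp only [modeCoord] at ht hfa
    linear_combination ht + hfa
  have hsum := (hasSum_inner_coef (Φ t).1 (U t).1).add (hasSum_inner_coef (Φ t).2 (U t).2)
  have hsum0 := (hasSum_inner_coef (Φ 0).1 U₀.1).add (hasSum_inner_coef (Φ 0).2 U₀.2)
  have hlim := tendsto_sum_Icc_of_hasSum hsum
  have hlim0 := tendsto_sum_Icc_of_hasSum hsum0
  have hpart : ∀ {f : ℝ → ℂ}, MemL2Loc f → ∀ {φ : ℝ → L2 ℂ} {p : ℝ → ℂ},
      (∀ k, Continuous fun s => coef k (φ s)) → IsTrace x₀ φ p →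
      Tendsto (fun N : ℕ => ∑ k ∈ Finset.Icc (-(N : ℤ)) N,
        ∫ s in (0 : ℝ)..t, f s * (starRingEnd ℂ) (fval x₀ k * coef k (φ s))) atTop
        (𝓝 (∫ s in (0 : ℝ)..t, f s * (starRingEnd ℂ) (p s))) := by
    intro f hf φ p hφ hp
    have h := tendsto_integral_mul_conj (q := fun N s => fourierPartialSum N (φ s) x₀) hf hp.1
      (fun N => memL2Loc_of_continuous (by simp only [fourierPartialSum_eq]; fun_prop)) hp.2 t
    refine h.congr fun N => ?_
    rw [← intervalIntegral.integral_finsetSum fun k _ => hint hf (by fun_prop) t]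
    refine intervalIntegral.integral_congr fun s _ => ?_
    simp only [fourierPartialSum_eq, Finset.mul_sum, map_sum]
  have hlim1 := hlim0.add ((hpart hf hΦ1 hp).add (hpart hg hΦ2 hq))
  have heq := tendsto_nhds_unique hlim (hlim1.congr fun N => by
    rw [← Finset.sum_add_distrib, ← Finset.sum_add_distrib]
    exact Finset.sum_congr rfl fun k _ => (hmode k).symm)
  rw [heq, intervalIntegral.integral_add
    (intervalIntegrable_mul_conj hf hp.1 t) (intervalIntegrable_mul_conj hg hq.1 t)]

/-- Exact controllability over the complex numbers. -/
theorem exists_control_complex (ha : 0 < a) (hc : 0 < c) (hd : 0 < d) (hr : 0 < r)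
    (hD : DistinctEigenvalues a c d r) (x₀ : Circ) {T : ℝ} (hT : criticalTime a c d r < T)
    (U₀ U₁ : H ℂ) :
    ∃ f g : ℝ → ℂ, MemL2Loc f ∧ MemL2Loc g ∧ ∃ U : ℝ → H ℂ, Continuous U ∧
      IsSolution a c d r x₀ f g U₀ U ∧ U T = U₁ := by
  obtain ⟨s₀, B, hfam⟩ := exists_isModeFamily ha hc hd hr hD
  obtain ⟨L, hL, hLc⟩ := exists_state ha hc hd hr
  have hcoord : ∀ V : H ℂ, ∃ z : lp (fun _ : ℤ × Bool => ℂ) 2, ∀ j,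
      z j = modeCoord a c d r V j := fun V => by
    obtain ⟨z, hz⟩ := exists_lp_eq_add_mul (circBasis.repr V.1) (circBasis.repr V.2)
      hfam.slope_bound
    refine ⟨z, fun j => ?_⟩
    rw [hz, circBasis_repr, circBasis_repr, modeCoord]
  obtain ⟨z₀, hz₀⟩ := hcoord U₀
  obtain ⟨z₁, hz₁⟩ := hcoord U₁
  obtain ⟨f, g, hf, hg, Z, hZ, hZT, hZv⟩ := hfam.exists_control x₀ hT
    (diagGroup (freq a c d r) (-T) z₁ - z₀)
  set U : ℝ → H ℂ := fun t => L (diagGroup (freq a c d r) t (z₀ + Z t)) with hU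
  have hUc : ∀ t j, modeCoord a c d r (U t) j = Complex.exp (freq a c d r j * t * Complex.I)
      * (modeCoord a c d r U₀ j + ∫ s in (0 : ℝ)..t, (f s + slope a c d r j * g s)
        * (starRingEnd ℂ) (fval x₀ j.1 * Complex.exp (freq a c d r j * s * Complex.I))) := by
    intro t j
    rw [hU, hLc, diagGroup_apply, lp.coeFn_add, Pi.add_apply, hz₀, hZv]
  have hcont : Continuous U :=
    hL.comp (continuous_diagGroup_comp _ (continuous_const.add hZ))
  refine ⟨f, g, hf, hg, U, hcont, ⟨(toWeakSpaceCLM ℂ (H ℂ)).continuous.comp hcont,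
    fun Φ p q hΦ hp hq t => transposition_of_modeCoord ha hc hd hr hf hg hUc hΦ hp hq t⟩, ?_⟩
  refine ext_modeCoord ha hc hd hr fun j => ?_
  rw [hU, hLc, hZT, add_sub_cancel, diagGroup_apply, diagGroup_apply, hz₁, ← mul_assoc,
    ← Complex.exp_add]
  push_cast
  rw [mul_neg, neg_mul, add_neg_cancel, Complex.exp_zero, one_mul]

end

section

variable {𝕜 𝕜' : Type*} [RCLike 𝕜] [RCLike 𝕜']

/-- The map of `L²` spaces induced by a real linear map of the scalars. -/
noncomputable def mapL2 (L : 𝕜 →L[ℝ] 𝕜') : L2 𝕜 →L[ℝ] L2 𝕜' := L.compLpL 2 volume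

/-- The map of state spaces induced by a real linear map of the scalars. -/
noncomputable def mapH (L : 𝕜 →L[ℝ] 𝕜') : H 𝕜 →L[ℝ] H 𝕜' := (mapL2 L).prodMap (mapL2 L)

theorem mapH_fst (L : 𝕜 →L[ℝ] 𝕜') (V : H 𝕜) : (mapH L V).1 = mapL2 L V.1 := rfl

theorem mapH_snd (L : 𝕜 →L[ℝ] 𝕜') (V : H 𝕜) : (mapH L V).2 = mapL2 L V.2 := rfl

theorem coeFn_mapL2 (L : 𝕜 →L[ℝ] 𝕜') (u : L2 𝕜) : mapL2 L u =ᵐ[volume] fun x => L (u x) :=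
  L.coeFn_compLpL u

theorem pairing_mapL2 (L : 𝕜 →L[ℝ] 𝕜') {η : ℝ → ℝ} (hη : Continuous η) (u : L2 𝕜) :
    pairing η (mapL2 L u) = L (pairing η u) := by
  have hmp := AddCircle.measurePreserving_mk (2 * Real.pi) 0
  rw [zero_add] at hmp
  have hae := hmp.quasiMeasurePreserving.ae_eq_comp (coeFn_mapL2 L u)
  unfold pairing
  rw [← L.intervalIntegral_comp_comm ((integrable_coe u).continuousOn_smul hη.continuousOn),
    intervalIntegral.integral_of_le Real.two_pi_pos.le,
    intervalIntegral.integral_of_le Real.two_pi_pos.le]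
  refine integral_congr_ae ?_
  filter_upwards [hae] with x hx
  simp only [Function.comp_apply] at hx
  rw [hx, L.map_smul]

theorem continuous_dirichletKernel (N : ℕ) : Continuous (dirichletKernel N) := by
  unfold dirichletKernel
  fun_prop

theorem integrable_dirichletKernel_smul (N : ℕ) (u : L2 𝕜) (x : Circ) :
    Integrable fun y : Circ => dirichletKernel N (x - y) • u y := by
  have hD : Continuous fun y => dirichletKernel N (x - y) :=
    (continuous_dirichletKernel N).comp (continuous_const.sub continuous_id)
  obtain ⟨C, hC⟩ := isCompact_univ.exists_bound_of_continuousOn hD.continuousOn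
  have hu : Integrable (u : Circ → 𝕜) := (Lp.memLp u).integrable (by norm_num)
  refine (hu.norm.const_mul C).mono' (hD.aestronglyMeasurable.smul hu.aestronglyMeasurable)
    (Eventually.of_forall fun y => ?_)
  rw [norm_smul]
  exact mul_le_mul_of_nonneg_right (hC y (Set.mem_univ y)) (norm_nonneg _)

theorem fourierPartialSum_mapL2 (L : 𝕜 →L[ℝ] 𝕜') (N : ℕ) (u : L2 𝕜) (x : Circ) :
    fourierPartialSum N (mapL2 L u) x = L (fourierPartialSum N u x) := by
  have h : ∫ y : Circ, dirichletKernel N (x - y) • mapL2 L u y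
      = L (∫ y : Circ, dirichletKernel N (x - y) • u y) := by
    rw [← L.integral_comp_comm (integrable_dirichletKernel_smul N u x)]
    refine integral_congr_ae ?_
    filter_upwards [coeFn_mapL2 L u] with y hy
    rw [hy, L.map_smul]
  rw [fourierPartialSum, fourierPartialSum, h, L.map_smul]

theorem MemL2Loc.map (L : 𝕜 →L[ℝ] 𝕜') {f : ℝ → 𝕜} (hf : MemL2Loc f) :
    MemL2Loc fun t => L (f t) := fun R => L.comp_memLp' (hf R)

theorem IsTrace.map (L : 𝕜 →L[ℝ] 𝕜') {x₀ : Circ} {φ : ℝ → L2 𝕜} {p : ℝ → 𝕜}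
    (h : IsTrace x₀ φ p) : IsTrace x₀ (fun t => mapL2 L (φ t)) fun t => L (p t) := by
  refine ⟨h.1.map L, fun R => ?_⟩
  have hlim := ENNReal.Tendsto.const_mul (a := ENNReal.ofReal ‖L‖) (h.2 R)
    (Or.inr ENNReal.ofReal_ne_top)
  rw [mul_zero] at hlim
  refine tendsto_of_tendsto_of_tendsto_of_le_of_le tendsto_const_nhds hlim (fun _ => zero_le)
    fun N => ?_
  refine eLpNorm_le_mul_eLpNorm_of_ae_le_mul (Eventually.of_forall fun t => ?_) 2
  rw [fourierPartialSum_mapL2, ← L.map_sub]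
  exact L.le_opNorm _

theorem IsAdjointSolution.map (L : 𝕜 →L[ℝ] 𝕜') {a c d r : ℝ} {Φ : ℝ → H 𝕜}
    (h : IsAdjointSolution a c d r Φ) : IsAdjointSolution a c d r fun t => mapH L (Φ t) := by
  refine ⟨(mapH L).continuous.comp h.continuous, fun η hη hper t => ?_, fun η hη hper t => ?_⟩
  all_goals
    have hη0 : Continuous η := hη.continuous
    have hη1 : Continuous (deriv η) := hη.continuous_deriv (by simp)
    have hη3 : Continuous (iteratedDeriv 3 η) := by
      rw [iteratedDeriv_succ, iteratedDeriv_succ, iteratedDeriv_one]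
      exact (contDiff_deriv (contDiff_deriv (contDiff_deriv hη))).continuous
    simp only [mapH_fst, mapH_snd, pairing_mapL2 L hη0, pairing_mapL2 L hη1, pairing_mapL2 L hη3,
      ← L.map_smul, ← L.map_add]
  · exact L.hasFDerivAt.comp_hasDerivAt t (h.fst_eq η hη hper t)
  · exact L.hasFDerivAt.comp_hasDerivAt t (h.snd_eq η hη hper t)

end

section

variable {𝕜 : Type*} [RCLike 𝕜]

theorem map_complex_map (x : 𝕜) : RCLike.map ℂ 𝕜 (RCLike.map 𝕜 ℂ x) = x := by
  simp

theorem map_mul_conj_map (z : ℂ) (y : 𝕜) :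
    RCLike.map ℂ 𝕜 (z * (starRingEnd ℂ) (RCLike.map 𝕜 ℂ y))
      = RCLike.map ℂ 𝕜 z * (starRingEnd 𝕜) y := by
  rw [RCLike.conj_eq_re_sub_im y]
  rcases RCLike.I_mul_I (K := 𝕜) with h | h
  · have him : RCLike.im y = 0 := by
      rw [← RCLike.mul_im_I_ax y, h]; simp
    simp [h, him]
  · simp
    linear_combination (z.im * RCLike.im y : 𝕜) * h

theorem map_map_mul_conj (z : ℂ) (y : 𝕜) :
    RCLike.map ℂ 𝕜 (RCLike.map 𝕜 ℂ y * (starRingEnd ℂ) z)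
      = y * (starRingEnd 𝕜) (RCLike.map ℂ 𝕜 z) := by
  conv_rhs => rw [← RCLike.re_add_im y]
  rcases RCLike.I_mul_I (K := 𝕜) with h | h
  · have him : RCLike.im y = 0 := by
      rw [← RCLike.mul_im_I_ax y, h]; simp
    simp [-RCLike.re_add_im, h, him]
  · simp [-RCLike.re_add_im]
    linear_combination (z.im * RCLike.im y : 𝕜) * h

theorem map_inner_mapL2_left (φ : L2 𝕜) (u : L2 ℂ) :
    RCLike.map ℂ 𝕜 (inner ℂ (mapL2 (RCLike.map 𝕜 ℂ) φ) u)
      = inner 𝕜 φ (mapL2 (RCLike.map ℂ 𝕜) u) := by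
  rw [L2.inner_def, L2.inner_def,
    ← (RCLike.map ℂ 𝕜).integral_comp_comm (L2.integrable_inner (𝕜 := ℂ) _ u)]
  refine integral_congr_ae ?_
  filter_upwards [coeFn_mapL2 (RCLike.map 𝕜 ℂ) φ, coeFn_mapL2 (RCLike.map ℂ 𝕜) u] with x h1 h2
  rw [h1, h2, RCLike.inner_apply, RCLike.inner_apply, map_mul_conj_map]

theorem map_inner_mapL2_right (φ : L2 ℂ) (w : L2 𝕜) :
    RCLike.map ℂ 𝕜 (inner ℂ φ (mapL2 (RCLike.map 𝕜 ℂ) w))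
      = inner 𝕜 (mapL2 (RCLike.map ℂ 𝕜) φ) w := by
  rw [L2.inner_def, L2.inner_def,
    ← (RCLike.map ℂ 𝕜).integral_comp_comm (L2.integrable_inner (𝕜 := ℂ) φ _)]
  refine integral_congr_ae ?_
  filter_upwards [coeFn_mapL2 (RCLike.map ℂ 𝕜) φ, coeFn_mapL2 (RCLike.map 𝕜 ℂ) w] with x h1 h2
  rw [h1, h2, RCLike.inner_apply, RCLike.inner_apply, map_map_mul_conj]

theorem mapL2_mapL2 (w : L2 𝕜) :
    mapL2 (RCLike.map ℂ 𝕜) (mapL2 (RCLike.map 𝕜 ℂ) w) = w := by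
  refine Lp.ext ?_
  filter_upwards [coeFn_mapL2 (RCLike.map ℂ 𝕜) (mapL2 (RCLike.map 𝕜 ℂ) w),
    coeFn_mapL2 (RCLike.map 𝕜 ℂ) w] with x h1 h2
  rw [h1, h2, map_complex_map]

theorem mapH_mapH (W : H 𝕜) : mapH (RCLike.map ℂ 𝕜) (mapH (RCLike.map 𝕜 ℂ) W) = W :=
  Prod.ext (mapL2_mapL2 W.1) (mapL2_mapL2 W.2)

variable {a c d r : ℝ}

/-- The projection to `𝕜` of a complex solution is a solution. -/
theorem IsSolution.mapH {x₀ : Circ} {f g : ℝ → ℂ} {U₀ : H 𝕜} {U : ℝ → H ℂ} (hU : Continuous U)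
    (hf : MemL2Loc f) (hg : MemL2Loc g)
    (h : IsSolution a c d r x₀ f g (GearGrimshaw.mapH (RCLike.map 𝕜 ℂ) U₀) U) :
    IsSolution a c d r x₀ (fun t => RCLike.map ℂ 𝕜 (f t)) (fun t => RCLike.map ℂ 𝕜 (g t)) U₀
      fun t => GearGrimshaw.mapH (RCLike.map ℂ 𝕜) (U t) := by
  refine ⟨(toWeakSpaceCLM 𝕜 (H 𝕜)).continuous.comp
    ((GearGrimshaw.mapH (RCLike.map ℂ 𝕜)).continuous.comp hU), fun Φ p q hΦ hp hq t => ?_⟩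
  have hp' := hp.map (RCLike.map 𝕜 ℂ)
  have hq' := hq.map (RCLike.map 𝕜 ℂ)
  have key := congrArg (RCLike.map ℂ 𝕜) (h.transposition _ _ _ (hΦ.map _) hp' hq' t)
  rw [map_add, map_add, map_add, ← (RCLike.map ℂ 𝕜).intervalIntegral_comp_comm
    ((intervalIntegrable_mul_conj hf hp'.1 t).add (intervalIntegrable_mul_conj hg hq'.1 t))] at key
  simp only [mapH_fst, mapH_snd, map_inner_mapL2_left, map_add, map_mul_conj_map,
    mapL2_mapL2] at key
  exact key

/-- Two solutions with the same data agree. -/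
theorem IsSolution.unique (ha : 0 < a) (hc : 0 < c) (hd : 0 < d) (hr : 0 < r) {x₀ : Circ}
    {f g : ℝ → 𝕜} {U₀ : H 𝕜} {U V : ℝ → H 𝕜} (hU : IsSolution a c d r x₀ f g U₀ U)
    (hV : IsSolution a c d r x₀ f g U₀ V) : V = U := by
  funext t
  set W : H 𝕜 := V t - U t with hW
  set S : ℤ × Bool → ℂ → ℂ := fun j z =>
    inner ℂ (modeSol a c d r j z t).1 (mapL2 (RCLike.map 𝕜 ℂ) W.1)
      + inner ℂ (modeSol a c d r j z t).2 (mapL2 (RCLike.map 𝕜 ℂ) W.2) with hS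
  have hρ : ∀ j z, RCLike.map ℂ 𝕜 (S j z) = 0 := by
    intro j z
    obtain ⟨p, q, hp, hq⟩ := exists_isTrace_modeSol (a := a) (c := c) (d := d) (r := r) x₀ j z
    have hΦ := (isAdjointSolution_modeSol (r := r) ha hc hd j z).map (RCLike.map ℂ 𝕜)
    have h1 := hU.transposition _ _ _ hΦ (hp.map _) (hq.map _) t
    have h2 := hV.transposition _ _ _ hΦ (hp.map _) (hq.map _) t
    rw [hS]
    simp only
    rw [map_add, map_inner_mapL2_right, map_inner_mapL2_right, hW, Prod.fst_sub, Prod.snd_sub,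
      inner_sub_right, inner_sub_right]
    have h3 := h2.trans h1.symm
    simp only [mapH_fst, mapH_snd] at h3
    linear_combination h3
  have hlin : ∀ j z, S j z = (starRingEnd ℂ) z * S j 1 := by
    intro j z
    simp only [hS, modeSol, inner_smul_left, map_mul, map_one]
    ring
  have hS1 : ∀ j, S j 1 = 0 := by
    intro j
    have h := hρ j (S j 1)
    rw [hlin, Complex.conj_mul'] at h
    have h' : ((‖S j 1‖ ^ 2 : ℝ) : 𝕜) = 0 := by
      rw [← h, ← Complex.ofReal_pow]
      simp only [RCLike.map_apply, RCLike.re_eq_complex_re, RCLike.im_eq_complex_im,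
        Complex.ofReal_re, Complex.ofReal_im, RCLike.ofReal_zero, zero_mul, add_zero]
    have h'' : ‖S j 1‖ ^ 2 = 0 := by exact_mod_cast h'
    exact norm_eq_zero.1 (pow_eq_zero_iff two_ne_zero |>.1 h'')
  have h0 := eq_zero_of_inner_modeSol ha hc hd hr t (W := GearGrimshaw.mapH (RCLike.map 𝕜 ℂ) W) hS1
  have hW0 : W = 0 := by rw [← mapH_mapH W, h0, map_zero]
  exact sub_eq_zero.1 hW0

end

end GearGrimshaw

theorem theorem4p1 {𝕜 : Type*} [RCLike 𝕜] :
    (∀ᵐ p : ℝ × ℝ × ℝ × ℝ, 0 < p.1 → 0 < p.2.1 → 0 < p.2.2.1 → 0 < p.2.2.2 →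
      GearGrimshaw.DistinctEigenvalues p.1 p.2.1 p.2.2.1 p.2.2.2) ∧
    ∀ a c d r : ℝ, 0 < a → 0 < c → 0 < d → 0 < r →
      GearGrimshaw.DistinctEigenvalues a c d r →
      ∀ (x₀ : GearGrimshaw.Circ) (T : ℝ), GearGrimshaw.criticalTime a c d r < T →
      ∀ U₀ U₁ : GearGrimshaw.H 𝕜,
      ∃ f g : ℝ → 𝕜, GearGrimshaw.MemL2Loc f ∧ GearGrimshaw.MemL2Loc g ∧
        ∃ U : ℝ → GearGrimshaw.H 𝕜,
          GearGrimshaw.IsSolution a c d r x₀ f g U₀ U ∧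
          (∀ V : ℝ → GearGrimshaw.H 𝕜,
            GearGrimshaw.IsSolution a c d r x₀ f g U₀ V → V = U) ∧
          U T = U₁ := by
  refine ⟨GearGrimshaw.ae_distinctEigenvalues, fun a c d r ha hc hd hr hD x₀ T hT U₀ U₁ => ?_⟩
  obtain ⟨f, g, hf, hg, U, hUc, hU, hUT⟩ := GearGrimshaw.exists_control_complex ha hc hd hr hD x₀ hT
    (GearGrimshaw.mapH (RCLike.map 𝕜 ℂ) U₀) (GearGrimshaw.mapH (RCLike.map 𝕜 ℂ) U₁)
  have hsol := GearGrimshaw.IsSolution.mapH hUc hf hg hU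
  exact ⟨_, _, hf.map _, hg.map _, _, hsol, fun V hV => hsol.unique ha hc hd hr hV,
    by simp only [hUT, GearGrimshaw.mapH_mapH]⟩
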